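/- Let $X$ be a locally noetherian scheme, $(L_1,s_1),\dots,(L_n,s_n)$ line bundles on $X$ with global sections, and $\vec r=(r_1,\dots,r_n)$ positive integers. Write $\sigma_i: F\to L_i\otimes F$ for multiplication by $s_i$, $\mathrm{div}(s_i)\subseteq X$ for the closed subscheme defined by the image ideal of $s_i^\vee: L_i^{\vee}\to\mathcal O_X$ (so $\mathrm{div}(s_i)=X$ if $s_i=0$), and let intersections of such subschemes be scheme-theoretic. A *coherent extendable pair* is a functor $F_\bullet$ from the poset $\prod_{i=1}^n[0,r_i]$ of integer points to $\mathrm{Coh}(X)$, with isomorphisms $\rho: F_\alpha\cong L_i\otimes F_{\alpha-r_ie_i}$ whenever $\alpha_i=r_i$, such that: (EX1) for all $\alpha$ and $i$ the composite $F_\alpha\to F_{\alpha+(r_i-\alpha_i)e_i}\xrightarrow{\rho}L_i\otimes F_{\alpha-\alpha_ie_i}\to L_i\otimes F_\alpha$ is $\sigma_i$; (EX2) $\rho$ is compatible with the transition maps inside the face $\alpha_i=r_i$; (EX3) for $i\neq j$, $\alpha_i=r_i$, $\alpha_j=r_j$, the two isomorphisms $F_\alpha\cong L_i\otimes L_j\otimes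 F_{\alpha-r_ie_i-r_je_j}$ obtained by applying the $\rho$'s in the two orders agree, up to the symmetry $L_i\otimes L_j\cong L_j\otimes L_i$. Morphisms are natural transformations compatible with $\rho$; the category is denoted $\mathcal{EP}(X,L,\vec r)$. For $T\subseteq\{1,\dots,n\}$ let $\iota_T:\prod_{i\in T}[0,r_i]\to\prod_{i=1}^n[0,r_i]$ be extension by $0$, $\pi_T$ the projection in the other direction, and $\iota_T^*:\mathcal{EP}(X,L,\vec r)\to\mathcal{EP}(X,L_T,\pi_T\vec r)$ the restriction, where $L_T=(L_i,s_i)_{i\in T}$. Put $S(k)=\{T: |T|=k\}$. Let $\ker^0$ be the full subcategory of those $F_\bullet$ with $F_0\cong0$, and for $k\ge1$ let $\ker^k$ be the kernel of $\prod_{T\in S(k)}\iota_T^*$. **Theorem.** Let $1\le k\le n$. Then $\ker^k\subseteq\ker^{k-1}$, and $\ker^{k-1}$ and $\mathcal B^k:=\prod_{T\in S(k)}\mathrm{Func}\big(\prod_{i\in T}[1,r_i-1],\mathrm{Coh}(\bigcap_{i\in T}\mathrm{div}(s_i))\big)$ are abelian categories. (i) Restriction to $k$-faces defines an exact functor $\mathrm{Face}^k:\ker^{k-1}\to\mathcal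 B^k$: for each $T$, the pushforward to $X$ of the $T$-component of $\mathrm{Face}^k(F_\bullet)$ is, naturally in $F_\bullet$, the restriction of $F_\bullet\circ\iota_T$ to $\prod_{i\in T}[1,r_i-1]$. Its kernel is $\ker^k$. (ii) $\mathrm{Face}^k$ has a left adjoint $D^k$, and the unit $1\to\mathrm{Face}^k\circ D^k$ is an isomorphism. Explicitly, for $G=(G^T_\bullet)_T\in\mathcal B^k$ and $u$ with $u_i<r_i$ for all $i$, the canonical maps $G^T_{\pi_T(u)}\to D^k(G)_{\iota_T\pi_T(u)}\to D^k(G)_u$ (given by the unit and the transition maps, and omitting pushforwards to $X$) exhibit $D^k(G)_u$ as the direct sum $\bigoplus_T G^T_{\pi_T(u)}$ over those $T\in S(k)$ with $u_i\ge1$ for all $i\in T$; the remaining values are given by the isomorphisms $\rho$. (iii) Every object of $\mathcal B^k$ is isomorphic to some $\mathrm{Face}^k(F)$; and for all $F,F'\in\ker^{k-1}$ and every $f:\mathrm{Face}^k(F)\to\mathrm{Face}^k(F')$ there are $h:F''\to F$ and $g:F''\to F'$ in $\ker^{k-1}$ such that $\mathrm{Face}^k(h)$ is an isomorphism and $f\circ\mathrm{Face}^k(h)=\mathrm{Face}^k(g)$.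 Consequently $\mathrm{Face}^k$ is a Serre quotient functor: it exhibits $\mathcal B^k$ as the localization of $\ker^{k-1}$ at the morphisms whose kernel and cokernel lie in $\ker^k$, i.e. $\ker^{k-1}/\ker^k\simeq\mathcal B^k$. (iv) If $k=n$, then $\mathrm{Face}^n:\ker^{n-1}\to\mathrm{Func}\big(\prod_{i=1}^n[1,r_i-1],\mathrm{Coh}(\bigcap_{i=1}^n\mathrm{div}(s_i))\big)$ is an equivalence of categories. -/

import Mathlib

universe u

open CategoryTheory CategoryTheory.Limits MonoidalCategory Opposite AlgebraicGeometry

/-! ### The tensor product of sheaves of modules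

The class of morphisms of presheaves of modules which become isomorphisms after sheafification
is stable under tensor products, so that the tensor product descends to sheaves of modules. -/

section
open scoped TensorProduct

/-- An equational criterion for an element of a tensor product to be killed by `N ⊗ f`. -/
theorem exists_relations_of_lTensor_eq_zero {R : Type*} [CommRing R] {N M₁ M₂ : Type*}
    [AddCommGroup N] [AddCommGroup M₁] [AddCommGroup M₂] [Module R N] [Module R M₁] [Module R M₂]
    (f : M₁ →ₗ[R] M₂) (x : N ⊗[R] M₁) (hx : f.lTensor N x = 0) :
    ∃ (p q : ℕ) (n : Fin p → N) (m : Fin p → M₁) (a : Fin p → Fin q → R) (y : Fin q → M₂),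
      x = ∑ i, n i ⊗ₜ[R] m i ∧ (∀ i, f (m i) = ∑ j, a i j • y j) ∧
        ∀ j, ∑ i, a i j • n i = 0 := by
  obtain ⟨k, n, m, rfl⟩ := TensorProduct.exists_sum_tmul_eq x
  let N₀ : Submodule R N := Submodule.span R (Set.range n)
  have hn₀ (i) : n i ∈ N₀ := Submodule.subset_span ⟨i, rfl⟩
  have fg₀ : N₀.FG := Submodule.fg_span (Set.finite_range n)
  obtain ⟨N', fg', le, h⟩ := fg₀.exists_rTensor_fg_inclusion_eq
    (x := ∑ i, (⟨n i, hn₀ i⟩ : N₀) ⊗ₜ[R] f (m i)) (y := 0) (by simpa using hx)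
  have : Module.Finite R N' := Module.Finite.iff_fg.mpr fg'
  obtain ⟨p, g, hg⟩ := Module.Finite.exists_fin (R := R) (M := N')
  let n' : Fin k ⊕ Fin p → N' := Sum.elim (fun i => ⟨n i, le (hn₀ i)⟩) g
  let m' : Fin k ⊕ Fin p → M₁ := Sum.elim m 0
  have hspan : Submodule.span R (Set.range n') = ⊤ := by
    rw [eq_top_iff, ← hg]
    exact Submodule.span_mono (by rintro _ ⟨i, rfl⟩; exact ⟨Sum.inr i, rfl⟩)
  obtain ⟨q, a, y, h₁, h₂⟩ := TensorProduct.vanishesTrivially_of_sum_tmul_eq_zero R (m := n')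
    (n := fun i => f (m' i)) hspan (by
      rw [Fintype.sum_sum_type]
      simp only [map_sum, LinearMap.rTensor_tmul, map_zero] at h
      simpa [n', m'] using! h)
  refine ⟨k + p, q, fun i => (n' (finSumFinEquiv.symm i) : N),
    fun i => m' (finSumFinEquiv.symm i), fun i => a (finSumFinEquiv.symm i), y, ?_, ?_, ?_⟩
  · rw [finSumFinEquiv.symm.sum_comp (fun i => (n' i : N) ⊗ₜ[R] m' i), Fintype.sum_sum_type]
    simp [n', m']
  · intro i; exact h₁ _
  · intro j
    rw [finSumFinEquiv.symm.sum_comp (fun i => a i j • (n' i : N))]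
    simpa using congr_arg Subtype.val (h₂ j)

theorem CategoryTheory.Functor.map_comp_apply_ab {C : Type*} [Category C] (F : Cᵒᵖ ⥤ Ab) {X Y Z : Cᵒᵖ} (f : X ⟶ Y) (g : Y ⟶ Z)
    (x : F.obj X) : F.map (f ≫ g) x = F.map g (F.map f x) := by simp

theorem sum_tmul_eq_zero_of_relations {R : Type*} [CommRing R] {N M : Type*} [AddCommGroup N]
    [AddCommGroup M] [Module R N] [Module R M] {p q : ℕ} (n : Fin p → N) (m : Fin p → M)
    (a : Fin p → Fin q → R) (z : Fin q → M) (h₁ : ∀ i, m i = ∑ j, a i j • z j)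
    (h₂ : ∀ j, ∑ i, a i j • n i = 0) : ∑ i, n i ⊗ₜ[R] m i = 0 := by
  simp_rw [h₁, TensorProduct.tmul_sum, TensorProduct.tmul_smul, TensorProduct.smul_tmul']
  rw [Finset.sum_comm]
  simp [← TensorProduct.sum_tmul, h₂]

theorem CategoryTheory.GrothendieckTopology.iInf_fin_covering {C : Type*} [Category C]
    (J : GrothendieckTopology C) {U : C} {q : ℕ} (A : Fin q → Sieve U) (hA : ∀ j, A j ∈ J U) :
    (⨅ j, A j) ∈ J U := by
  rw [← Finset.inf_univ_eq_iInf]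
  refine Finset.inf_induction (p := fun S => S ∈ J U) (J.top_mem U) ?_ (fun j _ => hA j)
  exact fun S hS T hT => J.intersection_covering hS hT

namespace PresheafOfModules
variable {C : Type*} [Category C] (J : GrothendieckTopology C) {R : Cᵒᵖ ⥤ CommRingCat.{u}}

variable {J} in
theorem isLocallySurjective_whiskerLeft (N : PresheafOfModules.{u} (R ⋙ forget₂ _ _))
    {M₁ M₂ : PresheafOfModules.{u} (R ⋙ forget₂ _ _)} (f : M₁ ⟶ M₂)
    [Presheaf.IsLocallySurjective J ((toPresheaf _).map f)] :
    Presheaf.IsLocallySurjective J ((toPresheaf _).map (N ◁ f)) where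
  imageSieve_mem {U} s := by
    change N.obj (op U) ⊗[R.obj (op U)] M₂.obj (op U) at s
    induction s with
    | zero =>
      refine J.superset_covering (fun V g _ => ⟨0, ?_⟩) (J.top_mem U)
      exact (map_zero _).trans (map_zero (((toPresheaf _).obj (N ⊗ M₂)).map g.op).hom).symm
    | tmul x y =>
      refine J.superset_covering ?_ (Presheaf.imageSieve_mem J ((toPresheaf _).map f) (U := op U) y)
      rintro V g ⟨t, ht⟩
      refine ⟨(N.map g.op x) ⊗ₜ[R.obj (op V)] (show M₁.obj (op V) from t), ?_⟩
      change (N.map g.op x) ⊗ₜ[R.obj (op V)] (f.app (op V) t) =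
        (N.map g.op x) ⊗ₜ[R.obj (op V)] (M₂.map g.op y)
      exact congr_arg _ ht
    | add x y hx hy =>
      refine J.superset_covering ?_ (J.intersection_covering hx hy)
      rintro V g ⟨⟨t, ht⟩, t', ht'⟩
      exact ⟨t + t', (map_add _ t t').trans ((congr_arg₂ _ ht ht').trans
        (map_add (((toPresheaf _).obj (N ⊗ M₂)).map g.op).hom _ _).symm)⟩

variable {J} in
theorem isLocallyInjective_whiskerLeft (N : PresheafOfModules.{u} (R ⋙ forget₂ _ _))
    {M₁ M₂ : PresheafOfModules.{u} (R ⋙ forget₂ _ _)} (f : M₁ ⟶ M₂)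
    [Presheaf.IsLocallyInjective J ((toPresheaf _).map f)]
    [Presheaf.IsLocallySurjective J ((toPresheaf _).map f)] :
    Presheaf.IsLocallyInjective J ((toPresheaf _).map (N ◁ f)) where
  equalizerSieve_mem {U} s s' h := by
    change N.obj U ⊗[R.obj U] M₁.obj U at s s'
    obtain ⟨p, q, n, m, a, y, h₀, h₁, h₂⟩ := exists_relations_of_lTensor_eq_zero
      (R := R.obj U) (f.app U).hom (s - s') (by
        rw [map_sub, sub_eq_zero]
        exact h)
    refine J.transitive (J.iInf_fin_covering (fun j =>
      Presheaf.imageSieve ((toPresheaf _).map f) (U := U.unop) (y j))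
      (fun j => Presheaf.imageSieve_mem J _ _)) _ ?_
    intro V g hg
    have hg (j) := iInf_le (fun j => Presheaf.imageSieve ((toPresheaf _).map f)
      (U := U.unop) (y j)) j _ hg
    choose z hz using hg
    replace hz : ∀ j, f.app (op V) (z j) = M₂.map g.op (y j) := hz
    change ∀ j, M₁.obj (op V) at z
    have key (i : Fin p) : f.app (op V) (M₁.map g.op (m i)) =
        f.app (op V) (∑ j, (R.map g.op).hom (a i j) • z j) := by
      rw [naturality_apply]
      refine (congr_arg (M₂.map g.op) (h₁ i)).trans ?_
      refine (map_sum (M₂.map g.op).hom _ _).trans ?_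
      refine Eq.trans ?_ (map_sum (f.app (op V)).hom _ _).symm
      refine Finset.sum_congr rfl fun j _ => ?_
      refine (M₂.map_smul g.op (a i j) (y j)).trans ?_
      refine Eq.trans ?_ ((f.app (op V)).hom.map_smul _ _).symm
      exact congr_arg _ (hz j).symm
    refine J.superset_covering ?_ (J.iInf_fin_covering _
      (fun i => Presheaf.equalizerSieve_mem J ((toPresheaf _).map f) (X := op V) _ _ (key i)))
    intro W g' hg'
    have hg' (i) : M₁.map g'.op (M₁.map g.op (m i)) =
        M₁.map g'.op (∑ j, (R.map g.op).hom (a i j) • z j) := iInf_le (fun i =>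
      Presheaf.equalizerSieve (F := (toPresheaf _).obj M₁) (X := op V) (M₁.map g.op (m i))
        (∑ j, (R.map g.op).hom (a i j) • z j)) i _ hg'
    let T := (toPresheaf _).obj (N ⊗ M₁)
    change T.map (g' ≫ g).op s = T.map (g' ≫ g).op s'
    refine sub_eq_zero.mp ((map_sub (T.map (g' ≫ g).op).hom s s').symm.trans ?_)
    refine (congr_arg (T.map (g' ≫ g).op) h₀).trans ?_
    refine (map_sum (T.map (g' ≫ g).op).hom _ _).trans ?_
    have e₁ (i : Fin p) : M₁.map (g' ≫ g).op (m i) = ∑ j,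
        (R.map (g' ≫ g).op).hom (a i j) • (M₁.map g'.op (z j) : M₁.obj (op W)) := by
      have h₃ : M₁.map (g' ≫ g).op (m i) = M₁.map g'.op (M₁.map g.op (m i)) :=
        CategoryTheory.Functor.map_comp_apply_ab ((toPresheaf _).obj M₁) g.op g'.op (m i)
      refine (h₃.trans (hg' i)).trans ?_
      refine (map_sum (M₁.map g'.op).hom _ _).trans (Finset.sum_congr rfl fun j _ => ?_)
      refine (M₁.map_smul g'.op _ _).trans ?_
      refine congr_arg (fun b : R.obj (op W) => b • (M₁.map g'.op (z j) : M₁.obj (op W))) ?_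
      exact (RingHom.congr_fun (congr_arg CommRingCat.Hom.hom (R.map_comp g.op g'.op)) (a i j)).symm
    have e₂ (j : Fin q) : ∑ i, (R.map (g' ≫ g).op).hom (a i j) •
        (N.map (g' ≫ g).op (n i) : N.obj (op W)) = 0 := by
      refine Eq.trans ?_ ((congr_arg (N.map (g' ≫ g).op) (h₂ j)).trans (map_zero (N.map (g' ≫ g).op).hom))
      refine Eq.trans ?_ (map_sum (N.map (g' ≫ g).op).hom _ _).symm
      exact Finset.sum_congr rfl fun i _ => (N.map_smul (g' ≫ g).op _ _).symm
    exact sum_tmul_eq_zero_of_relations (R := R.obj (op W)) _ _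
      (fun i j => (R.map (g' ≫ g).op).hom (a i j)) _ e₁ e₂

variable [J.WEqualsLocallyBijective AddCommGrpCat.{u}]

variable (R) in
theorem isMonoidal_W : ((J.W (A := AddCommGrpCat.{u})).inverseImage
    (toPresheaf (R ⋙ forget₂ CommRingCat RingCat))).IsMonoidal := by
  have h (N : PresheafOfModules.{u} (R ⋙ forget₂ CommRingCat RingCat)) {M₁ M₂}
      (f : M₁ ⟶ M₂) (hf : ((J.W (A := AddCommGrpCat.{u})).inverseImage (toPresheaf _)) f) :
      ((J.W (A := AddCommGrpCat.{u})).inverseImage (toPresheaf _)) (N ◁ f) := by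
    obtain ⟨_, _⟩ := (J.W_iff_isLocallyBijective _).1 hf
    exact (J.W_iff_isLocallyBijective _).2
      ⟨isLocallyInjective_whiskerLeft N f, isLocallySurjective_whiskerLeft N f⟩
  exact
    { whiskerLeft := fun N _ _ f hf => h N f hf
      whiskerRight := fun f hf N =>
        (MorphismProperty.arrow_mk_iso_iff _ (Arrow.isoMk (β_ _ N) (β_ _ N))).2 (h N f hf) }

end PresheafOfModules

end

namespace AlgebraicGeometry.Scheme.Modules
variable (X : Scheme.{u})

/-- Presheaves of `𝒪_X`-modules. -/
abbrev PreMod := _root_.PresheafOfModules.{u} (X.presheaf ⋙ forget₂ CommRingCat RingCat)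

/-- Morphisms of presheaves of modules which become isomorphisms after sheafification. -/
abbrev tensorW : MorphismProperty (PreMod X) :=
  ((Opens.grothendieckTopology X).W (A := AddCommGrpCat.{u})).inverseImage
    (PresheafOfModules.toPresheaf _)

/-- Sheafification of presheaves of `𝒪_X`-modules. -/
noncomputable def sheafify : PreMod X ⥤ X.Modules :=
  (PresheafOfModules.sheafification (𝟙 X.ringCatSheaf.obj) :
    _root_.PresheafOfModules.{u} X.ringCatSheaf.obj ⥤ SheafOfModules.{u} X.ringCatSheaf)

instance : (tensorW X).IsMonoidal := PresheafOfModules.isMonoidal_W _ _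

theorem isLocalization_sheafify : (sheafify X).IsLocalization (tensorW X) := by
  have h : (PresheafOfModules.sheafification (𝟙 X.ringCatSheaf.obj)).IsLocalization
    (((Opens.grothendieckTopology X).W (A := AddCommGrpCat.{u})).inverseImage
    (PresheafOfModules.toPresheaf X.ringCatSheaf.obj)) := inferInstance
  exact h

instance : (sheafify X).IsLocalization (tensorW X) := isLocalization_sheafify X

/-- The structure sheaf `𝒪_X` as an `𝒪_X`-module. -/
noncomputable def structureSheaf : X.Modules := SheafOfModules.unit X.ringCatSheaf

/-- The tensor unit of presheaves of modules sheafifies to `𝒪_X`. -/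
noncomputable def sheafifyUnitIso : (sheafify X).obj (𝟙_ (PreMod X)) ≅ structureSheaf X :=
  (asIso (PresheafOfModules.sheafificationAdjunction (𝟙 X.ringCatSheaf.obj)).counit).app
    (SheafOfModules.unit X.ringCatSheaf)

/-- The restriction of `𝒪_X` to an open subscheme is its structure sheaf. -/
noncomputable def restrictStructureSheaf (U : X.Opens) :
    (structureSheaf X).restrict U.ι ≅ structureSheaf U.toScheme :=
  restrictUnitIso U.ι

/-- The section of `𝒪_X` over `U` given by the function `1`. -/
noncomputable def oneSection (U : X.Opens) : Γ(structureSheaf X, U) := (1 : Γ(X, U))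

/-- A section of `𝒪_X` over `U`, as a function on `U`. -/
noncomputable def sectionToFunction (U : X.Opens) (f : Γ(structureSheaf X, U)) : Γ(X, U) := f

/-- The tensor product of `𝒪_X`-modules: the sheafification of the tensor product of presheaves
of modules, with unit `𝒪_X`. -/
noncomputable instance : MonoidalCategory X.Modules :=
  inferInstanceAs (MonoidalCategory
    (LocalizedMonoidal (sheafify X) (tensorW X) (sheafifyUnitIso X)))

/-- The symmetry `M ⊗ N ≅ N ⊗ M` of the tensor product of `𝒪_X`-modules. -/
noncomputable instance : SymmetricCategory X.Modules :=
  inferInstanceAs (SymmetricCategory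
    (LocalizedMonoidal (sheafify X) (tensorW X) (sheafifyUnitIso X)))

/-- Coherent sheaves (on a locally noetherian scheme): quasi-coherent sheaves of finite type. -/
def coherent : ObjectProperty X.Modules := fun M =>
  SheafOfModules.IsQuasicoherent (R := X.ringCatSheaf) M ∧
    SheafOfModules.IsFiniteType (R := X.ringCatSheaf) M

/-- The category of coherent sheaves. -/
abbrev Coh := (coherent X).FullSubcategory

end AlgebraicGeometry.Scheme.Modules

/-- A line bundle on `X` with a global section: an object of `Div X`. -/
structure LineBundleWithSection (X : Scheme.{u}) where
  /-- the line bundle -/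
  L : X.Modules
  locallyTrivial : ∀ x : X, ∃ U : X.Opens, x ∈ U ∧
    Nonempty (L.restrict U.ι ≅ Scheme.Modules.structureSheaf U.toScheme)
  /-- the global section, as a morphism `𝒪_X ⟶ L` -/
  s : Scheme.Modules.structureSheaf X ⟶ L

namespace LineBundleWithSection
variable {X : Scheme.{u}} (D : LineBundleWithSection X)

/-- Multiplication by the section, `F ⟶ L ⊗ F`. -/
noncomputable def mulSection (F : X.Modules) : F ⟶ D.L ⊗ F :=
  (λ_ F).inv ≫ (show 𝟙_ X.Modules ⟶ D.L from D.s) ▷ F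

/-- The function `φ(s)` on `U`, for a morphism `φ : L|_U ⟶ 𝒪_U`. -/
noncomputable def evalSection (U : X.Opens)
    (φ : D.L.restrict U.ι ⟶ Scheme.Modules.structureSheaf U.toScheme) : Γ(X, U) :=
  U.topIso.hom (Scheme.Modules.sectionToFunction U.toScheme ⊤
    (((Scheme.Modules.restrictStructureSheaf X U).inv ≫
      (Scheme.Modules.restrictFunctor U.ι).map D.s ≫ φ).app ⊤
        (Scheme.Modules.oneSection U.toScheme ⊤)))

/-- The ideal sheaf of the zero scheme `div(s)`: the image of `s^∨ : L^∨ ⟶ 𝒪_X`. It is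
`⊥`, i.e. `div(s) = X`, if `s = 0`. -/
noncomputable def zeroIdeal : X.IdealSheafData :=
  Scheme.IdealSheafData.ofIdeals fun U => Ideal.span (Set.range (D.evalSection U.1))

end LineBundleWithSection

/-! ### Boxes of indices -/

/-- The poset `∏ i, [0, r i]`. -/
abbrev Box {ι : Type} (r : ι → ℕ) := {u : ι → ℕ // ∀ i, u i ≤ r i}

/-- The poset `∏ i, [1, r i - 1]`. -/
abbrev InteriorBox {ι : Type} (r : ι → ℕ) := {v : ι → ℕ // ∀ i, 1 ≤ v i ∧ v i + 1 ≤ r i}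

/-- `α` lies on the face `α i = r i`, and `β = α - r i • e i`. -/
structure IsTranslate {ι : Type} {r : ι → ℕ} (i : ι) (α β : Box r) : Prop where
  top : α.1 i = r i
  bot : β.1 i = 0
  eq : ∀ j, j ≠ i → α.1 j = β.1 j

/-! ### Coherent extendable pairs -/

/-- Coherent extendable pairs for line bundles with sections `D i` and multiplicities `r i`.
The pseudo-period isomorphisms `F_α ≅ L_i ⊗ F_{α - r_i e_i}` (for `α_i = r_i`)
are indexed by pairs `(α, β)` with `β = α - r_i e_i`. -/
structure ExtendablePair {X : Scheme.{u}} {ι : Type} (D : ι → LineBundleWithSection X)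
    (r : ι → ℕ) where
  /-- the diagram of sheaves -/
  F : Box r ⥤ X.Modules
  coherent : ∀ α, Scheme.Modules.coherent X (F.obj α)
  /-- the pseudo-period isomorphisms -/
  ρ : ∀ (i : ι) (α β : Box r), IsTranslate i α β → (F.obj α ≅ (D i).L ⊗ F.obj β)
  /-- the composite
  `F_α ⟶ F_{α + (r_i - α_i) e_i} ≅ L_i ⊗ F_{α - α_i e_i} ⟶ L_i ⊗ F_α`
  is multiplication by the section `s_i` -/
  ex1 : ∀ (i : ι) (β α γ : Box r) (h : IsTranslate i γ β) (hβα : β ≤ α) (hαγ : α ≤ γ),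
    F.map (homOfLE hαγ) ≫ (ρ i γ β h).hom ≫ (D i).L ◁ F.map (homOfLE hβα) =
      (D i).mulSection (F.obj α)
  /-- `ρ` is compatible with the transition maps inside the face `α_i = r_i` -/
  ex2 : ∀ (i : ι) (α β α' β' : Box r) (h : IsTranslate i α β) (h' : IsTranslate i α' β')
    (hα : α ≤ α') (hβ : β ≤ β'),
    F.map (homOfLE hα) ≫ (ρ i α' β' h').hom =
      (ρ i α β h).hom ≫ (D i).L ◁ F.map (homOfLE hβ)
  /-- the pseudo-period isomorphisms in two directions `i ≠ j` commute, up to the symmetry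
  `L_i ⊗ L_j ≅ L_j ⊗ L_i` -/
  ex3 : ∀ (i j : ι) (_ : i ≠ j) (α β γ δ : Box r)
    (hαβ : IsTranslate i α β) (hαγ : IsTranslate j α γ)
    (hβδ : IsTranslate j β δ) (hγδ : IsTranslate i γ δ),
    (ρ i α β hαβ).hom ≫ (D i).L ◁ (ρ j β δ hβδ).hom =
      (ρ j α γ hαγ).hom ≫ (D j).L ◁ (ρ i γ δ hγδ).hom ≫
        (α_ (D j).L (D i).L (F.obj δ)).inv ≫ (β_ (D j).L (D i).L).hom ▷ F.obj δ ≫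
          (α_ (D i).L (D j).L (F.obj δ)).hom

namespace ExtendablePair

section
variable {X : Scheme.{u}} {ι : Type} {D : ι → LineBundleWithSection X} {r : ι → ℕ}

/-- Morphisms of extendable pairs: natural transformations compatible with the pseudo-period
isomorphisms. -/
@[ext]
structure Hom (E E' : ExtendablePair D r) where
  app : E.F ⟶ E'.F
  comm : ∀ (i : ι) (α β : Box r) (h : IsTranslate i α β),
    (E.ρ i α β h).hom ≫ (D i).L ◁ app.app β = app.app α ≫ (E'.ρ i α β h).hom

instance : Category (ExtendablePair D r) where
  Hom := Hom
  id E := { app := 𝟙 E.F, comm := by simp }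
  comp f g :=
    { app := f.app ≫ g.app
      comm := by
        intro i α β h
        rw [NatTrans.comp_app, NatTrans.comp_app, MonoidalCategory.whiskerLeft_comp,
          ← Category.assoc, f.comm, Category.assoc, g.comm, Category.assoc] }
  id_comp f := Hom.ext (Category.id_comp f.app)
  comp_id f := Hom.ext (Category.comp_id f.app)
  assoc f g h := Hom.ext (Category.assoc f.app g.app h.app)

variable (D r) in
/-- The underlying diagram of sheaves. -/
def toDiagram : ExtendablePair D r ⥤ (Box r ⥤ X.Modules) where
  obj E := E.F
  map f := Hom.app f
  map_id _ := rfl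
  map_comp _ _ := rfl

variable (D r) in
/-- The functor `F ↦ F_0`. -/
def piStar : ExtendablePair D r ⥤ Scheme.Modules.Coh X :=
  (Scheme.Modules.coherent X).lift
    (toDiagram D r ⋙ (evaluation (Box r) X.Modules).obj ⟨fun _ => 0, fun _ => Nat.zero_le _⟩)
    (fun E => E.coherent _)

end

/-! ### Restriction to faces -/

section
variable {X : Scheme.{u}} {n : ℕ} (D : Fin n → LineBundleWithSection X) (r : Fin n → ℕ)

/-- Extension by zero `∏_{i ∈ T} [0, r_i] → ∏_i [0, r_i]`. -/
def extendBox (T : Finset (Fin n)) (v : Box (fun i : T => r i)) : Box r :=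
  ⟨fun i => if h : i ∈ T then v.1 ⟨i, h⟩ else 0, fun i => by
    dsimp only
    split_ifs with h
    · exact v.2 ⟨i, h⟩
    · exact Nat.zero_le _⟩

theorem extendBox_monotone (T : Finset (Fin n)) : Monotone (extendBox r T) := by
  intro v w hvw i
  dsimp only [extendBox]
  split_ifs with h
  · exact hvw ⟨i, h⟩
  · exact le_rfl

theorem isTranslate_extendBox (T : Finset (Fin n)) (i : T) (α β : Box (fun i : T => r i))
    (h : IsTranslate i α β) : IsTranslate i.1 (extendBox r T α) (extendBox r T β) where
  top := by simpa [extendBox] using! h.top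
  bot := by simpa [extendBox] using h.bot
  eq j hj := by
    dsimp only [extendBox]
    split_ifs with hT
    · exact h.eq ⟨j, hT⟩ (fun e => hj (congrArg Subtype.val e))
    · rfl

/-- Restriction of extendable pairs along `∏_{i ∈ T} [0, r_i] → ∏_i [0, r_i]`. -/
def restrict (T : Finset (Fin n)) :
    ExtendablePair D r ⥤ ExtendablePair (fun i : T => D i) (fun i : T => r i) where
  obj E :=
    { F := (extendBox_monotone r T).functor ⋙ E.F
      coherent := fun _ => E.coherent _
      ρ := fun i α β h => E.ρ i _ _ (isTranslate_extendBox r T i α β h)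
      ex1 := fun i β _ γ h hβα hαγ => E.ex1 i _ _ _ (isTranslate_extendBox r T i γ β h)
        (extendBox_monotone r T hβα) (extendBox_monotone r T hαγ)
      ex2 := fun i α β α' β' h h' hα hβ => E.ex2 i _ _ _ _ (isTranslate_extendBox r T i α β h)
        (isTranslate_extendBox r T i α' β' h') (extendBox_monotone r T hα)
        (extendBox_monotone r T hβ)
      ex3 := fun i j hij α β γ δ hαβ hαγ hβδ hγδ =>
        E.ex3 i j (fun e => hij (Subtype.ext e)) _ _ _ _
          (isTranslate_extendBox r T i α β hαβ) (isTranslate_extendBox r T j α γ hαγ)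
          (isTranslate_extendBox r T j β δ hβδ) (isTranslate_extendBox r T i γ δ hγδ) }
  map f :=
    { app := Functor.whiskerLeft _ (Hom.app f)
      comm := fun i _ _ h => Hom.comm f i _ _ (isTranslate_extendBox r T i _ _ h) }
  map_id _ := rfl
  map_comp _ _ := rfl

/-- The subsets of `{1, …, n}` with `k` elements. -/
abbrev SubsetsOfCard (n k : ℕ) := {T : Finset (Fin n) // T.card = k}

/-- The restriction to all faces of dimension `k`, with values in extendable pairs. -/
def face (k : ℕ) : ExtendablePair D r ⥤
    ∀ T : SubsetsOfCard n k, ExtendablePair (fun i : T.1 => D i) (fun i : T.1 => r i) :=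
  Functor.pi' fun T => restrict D r T.1

/-- `ker^k`: the kernel of the restriction to the faces of dimension `k` if `k ≥ 1`, and
the kernel of `F ↦ F_0` if `k = 0`. -/
def ker : ℕ → ObjectProperty (ExtendablePair D r)
  | 0 => (piStar D r).kernel
  | k + 1 => (face D r (k + 1)).kernel

/-! ### Functors on the interiors of faces, supported on zero loci -/

/-- The inclusion `∏_{i ∈ T} [1, r_i - 1] → ∏_i [0, r_i]`. -/
def interiorInclusion (T : Finset (Fin n)) (v : InteriorBox (fun i : T => r i)) : Box r :=
  extendBox r T ⟨v.1, fun i => (Nat.le_succ _).trans (v.2 i).2⟩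

theorem interiorInclusion_monotone (T : Finset (Fin n)) : Monotone (interiorInclusion r T) :=
  fun _ _ h => extendBox_monotone r T h

/-- The restriction of an extendable pair to the interior of the face `T`. -/
def restrictInterior (T : Finset (Fin n)) :
    ExtendablePair D r ⥤ (InteriorBox (fun i : T => r i) ⥤ X.Modules) :=
  toDiagram D r ⋙ (Functor.whiskeringLeft _ _ _).obj (interiorInclusion_monotone r T).functor

/-- The closed subscheme `⋂_{i ∈ T} div(s_i)` of `X`. -/
noncomputable abbrev zeroLocus (T : Finset (Fin n)) : Scheme.{u} :=
  (⨆ i ∈ T, (D i).zeroIdeal).subscheme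

/-- The closed immersion of `⋂_{i ∈ T} div(s_i)` into `X`. -/
noncomputable abbrev zeroLocusι (T : Finset (Fin n)) : zeroLocus D T ⟶ X :=
  (⨆ i ∈ T, (D i).zeroIdeal).subschemeι

/-- `Func(∏_{i ∈ T} [1, r_i - 1], Coh(⋂_{i ∈ T} div(s_i)))`. -/
abbrev FaceCat (T : Finset (Fin n)) :=
  InteriorBox (fun i : T => r i) ⥤ Scheme.Modules.Coh (zeroLocus D T)

/-- Pushforward of diagrams from `⋂_{i ∈ T} div(s_i)` to `X`. -/
noncomputable def pushFace (T : Finset (Fin n)) :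
    FaceCat D r T ⥤ (InteriorBox (fun i : T => r i) ⥤ X.Modules) :=
  (Functor.whiskeringRight _ _ _).obj
    ((Scheme.Modules.coherent _).ι ⋙ Scheme.Modules.pushforward (zeroLocusι D T))

/-- The projection to the face `T` of an index `u` with `1 ≤ u i ≤ r i - 1` for `i ∈ T`. -/
def interiorProj (T : Finset (Fin n)) (u : Box r) (hu : ∀ i ∈ T, 1 ≤ u.1 i ∧ u.1 i + 1 ≤ r i) :
    InteriorBox (fun i : T => r i) :=
  ⟨fun i => u.1 i, fun i => hu i i.2⟩

theorem interiorInclusion_interiorProj_le (T : Finset (Fin n)) (u : Box r)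
    (hu : ∀ i ∈ T, 1 ≤ u.1 i ∧ u.1 i + 1 ≤ r i) :
    interiorInclusion r T (interiorProj r T u hu) ≤ u := by
  intro i
  dsimp only [interiorInclusion, extendBox, interiorProj]
  split_ifs with h
  · exact le_rfl
  · exact Nat.zero_le _

/-- For a morphism `m` from the pushforward of `G` to the restriction of `E` to the interior of
the face `T`, the composite `G_{π_T u} ⟶ E_{ι_T π_T u} ⟶ E_u`. -/
noncomputable def fromFace (T : Finset (Fin n)) {G : FaceCat D r T} {E : ExtendablePair D r}
    (m : (pushFace D r T).obj G ⟶ (restrictInterior D r T).obj E) (u : Box r)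
    (hu : ∀ i ∈ T, 1 ≤ u.1 i ∧ u.1 i + 1 ≤ r i) :
    ((pushFace D r T).obj G).obj (interiorProj r T u hu) ⟶ E.F.obj u :=
  m.app (interiorProj r T u hu) ≫
    E.F.map (homOfLE (interiorInclusion_interiorProj_le r T u hu))

/-- The `k`-element subsets `T` such that `1 ≤ u i ≤ r i - 1` for all `i ∈ T`. -/
abbrev FacesAt (k : ℕ) (u : Box r) :=
  {T : SubsetsOfCard n k // ∀ i ∈ T.1, 1 ≤ u.1 i ∧ u.1 i + 1 ≤ r i}

/-- `∏_{T ∈ S(k)} Func(∏_{i ∈ T} [1, r_i - 1], Coh(⋂_{i ∈ T} div(s_i)))`. -/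
abbrev FaceTarget (k : ℕ) := ∀ T : SubsetsOfCard n k, FaceCat D r T.1

end

end ExtendablePair

/-! Call a coordinate `i` of an index `u` interior if `0 < u i < r i`. The isomorphisms `ρ` express
the value at an index with `u i = r i` as a twist of the value at the index with that coordinate set
to zero, and this does not change the interior coordinates. Every index on a `k`-face has at most
`k` interior coordinates, and an index without maximal coordinates lies on the face spanned by its
interior coordinates. Hence `ker^k` consists of the pairs vanishing at all indices with at most `k`
interior coordinates (`ker_eq_zeroOn`). The inclusion of kernels, and the description of `ker^k` as
the kernel of `Face^k`, follow from this.

Let `F` lie in `ker^{k-1}` and let `v` be in the interior of a `k`-face `T`. By EX1, multiplication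
by `s_i` on the value at `v` factors through a twist of the value at the index with coordinate `i`
set to zero, which has only `k - 1` interior coordinates and so vanishes. The value at `v` is
therefore killed by all `s_i` with `i ∈ T` (`mulSection_eq_zero_of_zeroOn`). Coherent sheaves on `X`
with this property are the same as coherent sheaves on the intersection of the `div(s_i)`:
pushforward along a closed immersion is an equivalence onto the coherent sheaves killed by its ideal
(`pushforwardCoh`, `isKilledBy_zeroLocusι_iff`). This gives `Face^k`. It is exact because kernels
and cokernels of extendable pairs are computed pointwise, which rests on the exactness of tensoring
with a line bundle.

For the left adjoint, a diagram on the interior of one face `T` is extended by zero in the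
directions of `T` and constantly in the other directions, with a twist by `L_j` where coordinate `j`
is maximal. The twisted directions are adjoined one at a time (`PartialPair.insert`). Maps from the
result into a pair of `ker^{k-1}` correspond to maps of diagrams on the interior of `T`: a
transition map leaving that interior passes through an index with fewer than `k` interior
coordinates, hence is zero (`faceMap_map_eq_zero`, `exists_isFaceExtension`). The left adjoint is
the coproduct over all `T`. In the interior of the face `T` no other summand contributes, so the
unit is invertible (`exists_universal`).

The rest is formal. A functor with a left adjoint and invertible unit is a localization at the
morphisms it inverts; for an exact functor these are the morphisms whose kernel and cokernel lie in
its kernel. For `k = n` the kernel is zero, so `Face^n` reflects isomorphisms and the counit is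
invertible as well. -/

namespace AlgebraicGeometry.Scheme.Modules
variable {X : Scheme.{u}}

/-! ### Sections of tensor products of sheaves of modules -/

variable (X) in
/-- The forgetful functor to presheaves of modules. -/
noncomputable def toPreMod : X.Modules ⥤ PreMod X := toPresheafOfModules X

variable (X) in
/-- Sheafification is left adjoint to the forgetful functor. -/
noncomputable def sheafifyAdj : sheafify X ⊣ toPreMod X :=
  PresheafOfModules.sheafificationAdjunction (𝟙 X.ringCatSheaf.obj)

instance : (toPreMod X).Full := inferInstanceAs (toPresheafOfModules X).Full
instance : (toPreMod X).Faithful := inferInstanceAs (toPresheafOfModules X).Faithful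

noncomputable instance : (sheafify X).Monoidal :=
  inferInstanceAs (Localization.Monoidal.toMonoidalCategory (sheafify X) (tensorW X)
    (sheafifyUnitIso X)).Monoidal

noncomputable instance : (sheafify X).Braided :=
  inferInstanceAs (Localization.Monoidal.toMonoidalCategory (sheafify X) (tensorW X)
    (sheafifyUnitIso X)).Braided

noncomputable instance : (toPreMod X).LaxMonoidal := (sheafifyAdj X).rightAdjointLaxMonoidal

open Functor.LaxMonoidal Functor.Monoidal TensorProduct

/-- A morphism of sheaves of modules as a linear map on sections. -/
noncomputable def Hom.appₗ {M N : X.Modules} (f : M ⟶ N) (U : X.Opens) :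
    Γ(M, U) →ₗ[Γ(X, U)] Γ(N, U) where
  toFun := f.app U
  map_add' _ _ := map_add _ _ _
  map_smul' _ _ := Hom.app_smul _ _ _

/-- The canonical map from the tensor product of sections to sections of the tensor product. -/
noncomputable def tensorSections (M N : X.Modules) (U : X.Opens) :
    Γ(M, U) ⊗[Γ(X, U)] Γ(N, U) →ₗ[Γ(X, U)] Γ(M ⊗ N, U) :=
  ((μ (toPreMod X) M N).app (op U)).hom

/-- The section `m ⊗ n` of `M ⊗ N`. -/
noncomputable def tmul {M N : X.Modules} {U : X.Opens} (m : Γ(M, U)) (n : Γ(N, U)) : Γ(M ⊗ N, U) :=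
  tensorSections M N U (m ⊗ₜ n)

section
variable {M N P : X.Modules} {U V : X.Opens} 
theorem tmul_add  (m : Γ(M, U)) (n n' : Γ(N, U)) : tmul m (n + n') = tmul m n + tmul m n' := by
  simp [tmul, TensorProduct.tmul_add]

theorem smul_tmul (a : Γ(X, U)) (m : Γ(M, U)) (n : Γ(N, U)) :
    tmul (a • m) n = a • tmul m n := by
  rw [tmul, tmul, ← TensorProduct.smul_tmul', LinearMap.map_smul]

theorem tmul_smul (a : Γ(X, U)) (m : Γ(M, U)) (n : Γ(N, U)) :
    tmul m (a • n) = a • tmul m n := by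
  simp [tmul]

@[simp] theorem tmul_zero (m : Γ(M, U)) : tmul m (0 : Γ(N, U)) = 0 := by simp [tmul]

theorem map_tmul (i : U ⟶ V) (m : Γ(M, V)) (n : Γ(N, V)) :
    (M ⊗ N).presheaf.map i.op (tmul m n) = tmul (M.presheaf.map i.op m) (N.presheaf.map i.op n) :=
  (PresheafOfModules.naturality_apply (μ (toPreMod X) M N) i.op
    (show (((toPreMod X).obj M ⊗ (toPreMod X).obj N).obj (op V)) from
      TensorProduct.tmul Γ(X, V) m n)).symm

theorem whiskerLeft_app_tmul (f : N ⟶ P) (m : Γ(M, U)) (n : Γ(N, U)) :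
    (M ◁ f).app U (tmul m n) = tmul m (f.app U n) := by
  have := congrArg (fun φ => (φ.app (op U)).hom (TensorProduct.tmul Γ(X, U) m n)) (μ_natural_right (toPreMod X) M f)
  exact this.symm

theorem whiskerRight_app_tmul (f : M ⟶ P) (m : Γ(M, U)) (n : Γ(N, U)) :
    (f ▷ N).app U (tmul m n) = tmul (f.app U m) n := by
  have := congrArg (fun φ => (φ.app (op U)).hom (TensorProduct.tmul Γ(X, U) m n)) (μ_natural_left (toPreMod X) f N)
  exact this.symm

/-- The chosen isomorphism from the sheafified unit to `𝒪_X` is the counit of sheafification, so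
this is a triangle identity. -/
theorem epsilon_toPreMod : ε (toPreMod X) = 𝟙 (𝟙_ (PreMod X)) := by
  have h : (sheafifyAdj X).homEquiv ((toPreMod X).obj (structureSheaf X)) (structureSheaf X)
      ((sheafifyAdj X).counit.app (structureSheaf X)) = 𝟙 _ := by
    rw [Adjunction.homEquiv_unit, Adjunction.right_triangle_components]
  exact h

theorem leftUnitor_hom_app_tmul (a : Γ(X, U)) (m : Γ(M, U)) :
    (λ_ M).hom.app U (tmul (M := 𝟙_ X.Modules) (show Γ(X, U) from a) m) = a • m := by
  have := congrArg (fun φ => (φ.app (op U)).hom (TensorProduct.tmul Γ(X, U) a m)) (left_unitality (toPreMod X) M)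
  rw [epsilon_toPreMod] at this
  exact this.symm

/-- Transposing along `sheafifyAdj` reduces the formula to the fact that sheafification is a braided
functor. -/
theorem braiding_hom_app_tmul (m : Γ(M, U)) (n : Γ(N, U)) :
    (β_ M N).hom.app U (tmul m n) = tmul n m := by
  have h : μ (toPreMod X) M N ≫ (toPreMod X).map (β_ M N).hom =
    (β_ _ _).hom ≫ μ (toPreMod X) N M := by
    change (sheafifyAdj X).homEquiv _ _ _ ≫ _ = _ ≫ (sheafifyAdj X).homEquiv _ _ _
    rw [← Adjunction.homEquiv_naturality_right, ← Adjunction.homEquiv_naturality_left]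
    congr 1
    rw [Category.assoc, BraidedCategory.braiding_naturality]
    rw [← Category.assoc, ← Category.assoc]
    congr 1
    rw [← cancel_epi (μ (sheafify X) _ _), ← Category.assoc, μ_δ, Category.id_comp,
      ← Category.assoc, Functor.LaxBraided.braided, Category.assoc, μ_δ, Category.comp_id]
  have := congrArg (fun φ => (φ.app (op U)).hom (TensorProduct.tmul Γ(X, U) m n)) h
  exact this

/-- `μ` is the unit of sheafification followed by an isomorphism built from `δ` and the counits.
Thus sections of `M ⊗ N` are locally those of the presheaf tensor product, with equality also tested
locally. -/
theorem tensorW_mu : tensorW X (μ (toPreMod X) M N) := by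
  have h : μ (toPreMod X) M N = (sheafifyAdj X).unit.app _ ≫ (toPreMod X).map
    (Functor.OplaxMonoidal.δ (sheafify X) _ _ ≫ ((sheafifyAdj X).counit.app M ⊗ₘ (sheafifyAdj X).counit.app N)) := 
     (sheafifyAdj X).homEquiv_unit _ _ _
  rw [h]
  refine MorphismProperty.comp_mem _ _ _ ?_ ?_
  · exact (Opens.grothendieckTopology X).W_toSheafify
      ((toPreMod X).obj M ⊗ (toPreMod X).obj N).presheaf
  · exact MorphismProperty.of_isIso _ _

/-- By the sheafification adjunction a morphism out of `M ⊗ N` is determined by its composite with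
`μ`, and presheaf tensor products are spanned by pure tensors. -/
theorem tensor_hom_ext {f g : M ⊗ N ⟶ P}
    (h : ∀ (U : X.Opens) (m : Γ(M, U)) (n : Γ(N, U)), f.app U (tmul m n) = g.app U (tmul m n)) :
    f = g := by
  have h₁ : μ (toPreMod X) M N ≫ (toPreMod X).map f = μ (toPreMod X) M N ≫ (toPreMod X).map g := by
    ext U x
    have h₂ : Hom.appₗ f U.unop ∘ₗ tensorSections M N U.unop =
        Hom.appₗ g U.unop ∘ₗ tensorSections M N U.unop :=
      TensorProduct.ext' fun m n => h U.unop m n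
    exact LinearMap.congr_fun h₂ x
  change (sheafifyAdj X).homEquiv _ _ _ ≫ _ = (sheafifyAdj X).homEquiv _ _ _ ≫ _ at h₁
  rw [← Adjunction.homEquiv_naturality_right, ← Adjunction.homEquiv_naturality_right] at h₁
  exact (cancel_epi _).1 (((sheafifyAdj X).homEquiv _ _).injective h₁)

theorem exists_tensorSections_eq (t : Γ(M ⊗ N, U)) (x : X) (hx : x ∈ U) :
    ∃ (V : X.Opens) (i : V ⟶ U), x ∈ V ∧ ∃ y, tensorSections M N V y = (M ⊗ N).presheaf.map i.op t := by
  obtain ⟨_, _⟩ := ((Opens.grothendieckTopology X).W_iff_isLocallyBijective _).1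
    (tensorW_mu (M := M) (N := N))
  obtain ⟨V, i, ⟨y, hy⟩, hx⟩ := Presheaf.imageSieve_mem (Opens.grothendieckTopology X)
    ((PresheafOfModules.toPresheaf _).map (μ (toPreMod X) M N)) (U := op U) t x hx
  exact ⟨V, i, hx, y, hy⟩

theorem exists_tensorSections_inj (m : Γ(M, U)) (n : Γ(N, U)) (h : tmul m n = 0) (x : X) (hx : x ∈ U) :
    ∃ (V : X.Opens) (i : V ⟶ U), x ∈ V ∧
      (M.presheaf.map i.op m) ⊗ₜ[Γ(X, V)] (N.presheaf.map i.op n) = 0 := by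
  obtain ⟨_, _⟩ := ((Opens.grothendieckTopology X).W_iff_isLocallyBijective _).1
    (tensorW_mu (M := M) (N := N))
  obtain ⟨V, i, h, hx⟩ := Presheaf.equalizerSieve_mem (Opens.grothendieckTopology X)
    ((PresheafOfModules.toPresheaf _).map (μ (toPreMod X) M N)) (X := op U) 
     (m ⊗ₜ[Γ(X, U)] n) (0 : Γ(M, U) ⊗[Γ(X, U)] Γ(N, U)) (h.trans (map_zero (tensorSections M N U)).symm) x hx
  exact ⟨V, i, hx, h.trans (map_zero (((PresheafOfModules.toPresheaf _).obj
    ((toPreMod X).obj M ⊗ (toPreMod X).obj N)).map i.op).hom)⟩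

end

section
variable {M : X.Modules} {U : X.Opens}

theorem section_ext {s t : Γ(M, U)} (h : ∀ x ∈ U, ∃ (V : X.Opens) (i : V ⟶ U), x ∈ V ∧
    M.presheaf.map i.op s = M.presheaf.map i.op t) : s = t := by
  choose V i hx h using fun x : U => h x.1 x.2
  refine TopCat.Sheaf.eq_of_locally_eq' ⟨M.presheaf, M.isSheaf⟩ V U i ?_ s t h
  intro x hxU
  exact TopologicalSpace.Opens.mem_iSup.2 ⟨⟨x, hxU⟩, hx _⟩

theorem exists_glue {ι : Type u} (V : ι → X.Opens) (i : ∀ a, V a ⟶ U) (hV : U ≤ iSup V) (s : ∀ a, Γ(M, V a))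
    (h : ∀ a b (W : X.Opens) (f : W ⟶ V a) (g : W ⟶ V b), M.presheaf.map f.op (s a) = M.presheaf.map g.op (s b)) :
    ∃ t : Γ(M, U), ∀ a, M.presheaf.map (i a).op t = s a :=
  (TopCat.Sheaf.existsUnique_gluing' ⟨M.presheaf, M.isSheaf⟩ V U i hV s
    (fun _ _ => h _ _ _ _ _)).exists
end

/-- A section freely generating an invertible module. -/
def IsGenerator {L : X.Modules} {U : X.Opens} (l : Γ(L, U)) : Prop :=
  ∀ ⦃V : X.Opens⦄ (i : V ⟶ U), Function.Bijective fun a : Γ(X, V) => a • L.presheaf.map i.op l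

end AlgebraicGeometry.Scheme.Modules

/-! ### Local generators of line bundles -/

namespace AlgebraicGeometry.Scheme.Modules
variable {X : Scheme.{u}}
open Functor.LaxMonoidal Functor.Monoidal TensorProduct

theorem map_map (M : X.Modules) {U V W : X.Opens} (i : U ⟶ V) (j : V ⟶ W) (s : Γ(M, W)) :
    M.presheaf.map i.op (M.presheaf.map j.op s) = M.presheaf.map (i ≫ j).op s := by
  rw [op_comp, Functor.map_comp]; rfl

theorem map_self (M : X.Modules) {U : X.Opens} (i : U ⟶ U) (s : Γ(M, U)) :
    M.presheaf.map i.op s = s := by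
  rw [Subsingleton.elim i (𝟙 U), op_id, CategoryTheory.Functor.map_id]; rfl

theorem app_map {M N : X.Modules} (f : M ⟶ N) {U V : X.Opens} (i : U ⟶ V) (s : Γ(M, V)) :
    f.app U (M.presheaf.map i.op s) = N.presheaf.map i.op (f.app V s) :=
  ConcreteCategory.congr_hom (f.mapPresheaf.naturality i.op) s

section
variable {L M N : X.Modules} {U V : X.Opens} {l : Γ(L, U)}

theorem IsGenerator.map (h : IsGenerator l) (i : V ⟶ U) : IsGenerator (L.presheaf.map i.op l) := by
  intro W j
  simpa only [map_map] using h (j ≫ i)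

/-- Multiplication of a generator by functions, as a linear equivalence. -/
noncomputable def IsGenerator.equiv (h : IsGenerator l) : Γ(X, U) ≃ₗ[Γ(X, U)] Γ(L, U) :=
  LinearEquiv.ofBijective (LinearMap.toSpanSingleton _ _ l) (by
    have := h (𝟙 U)
    simp only [map_self] at this
    exact this)

theorem IsGenerator.equiv_one (h : IsGenerator l) : h.equiv 1 = l := 
  one_smul _ _

/-- Tensoring sections with a generator. -/
noncomputable def IsGenerator.tensorEquiv (h : IsGenerator l) (M : X.Modules) :
    Γ(M, U) ≃ₗ[Γ(X, U)] Γ(L, U) ⊗[Γ(X, U)] Γ(M, U) :=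
  (TensorProduct.lid _ _).symm ≪≫ₗ TensorProduct.congr h.equiv (LinearEquiv.refl _ _)

theorem IsGenerator.tensorEquiv_apply (h : IsGenerator l) (m : Γ(M, U)) :
    h.tensorEquiv M m = l ⊗ₜ m := by
  simp [IsGenerator.tensorEquiv, h.equiv_one]

/-- A section killed by `l ⊗ -` is killed locally in the presheaf tensor product, where
`tensorEquiv` makes tensoring with `l` bijective. -/
theorem IsGenerator.tmul_injective (h : IsGenerator l) :
    Function.Injective fun m : Γ(M, U) => tmul l m := by
  intro m m' hm
  rw [← sub_eq_zero]
  have hm : tmul l (m - m') = 0 := by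
    rw [sub_eq_add_neg, tmul_add, ← neg_one_smul Γ(X, U) m', tmul_smul]
    dsimp only at hm
    simp [hm]
  refine section_ext fun x hx => ?_
  obtain ⟨V, i, hxV, h0⟩ := exists_tensorSections_inj _ _ hm x hx
  refine ⟨V, i, hxV, ?_⟩
  rw [← (h.map i).tensorEquiv_apply] at h0
  rw [map_zero]
  exact (LinearEquiv.map_eq_zero_iff _).1 h0

/-- Preimages exist locally by `tensorEquiv`; injectivity makes them agree on overlaps, so they
glue. -/
theorem IsGenerator.tmul_surjective (h : IsGenerator l) :
    Function.Surjective fun m : Γ(M, U) => tmul l m := by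
  intro t
  choose V i hx y hy using fun x : U => exists_tensorSections_eq t x.1 x.2
  let m (x : U) := ((h.map (i x)).tensorEquiv M).symm (y x)
  have hm (x : U) : tmul (L.presheaf.map (i x).op l) (m x) = (L ⊗ M).presheaf.map (i x).op t := by
    rw [← hy, tmul, ← (h.map (i x)).tensorEquiv_apply]
    simp [m]
  obtain ⟨s, hs⟩ := exists_glue V i (fun x hx' => TopologicalSpace.Opens.mem_iSup.2 ⟨⟨x, hx'⟩, hx _⟩) m
    (fun a b W f g => (h.map (f ≫ i a)).tmul_injective (by
      dsimp only
      have h₁ := congrArg ((L ⊗ M).presheaf.map f.op) (hm a)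
      have h₂ := congrArg ((L ⊗ M).presheaf.map g.op) (hm b)
      rw [map_tmul, map_map, map_map] at h₁ h₂
      rw [h₁, Subsingleton.elim (f ≫ i a) (g ≫ i b), h₂]))
  refine ⟨s, section_ext fun x hx' => ⟨V ⟨x, hx'⟩, i ⟨x, hx'⟩, hx ⟨x, hx'⟩, ?_⟩⟩
  rw [map_tmul, hs, hm]

theorem IsGenerator.tmul_bijective (h : IsGenerator l) :
    Function.Bijective fun m : Γ(M, U) => tmul l m :=
  ⟨h.tmul_injective, h.tmul_surjective⟩

end

theorem restrict_ι_smul (M : X.Modules) (U : X.Opens) (W : U.toScheme.Opens)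
    (a : Γ(U.toScheme, W)) (m : Γ(M.restrict U.ι, W)) :
    a • m = (show Γ(M.restrict U.ι, W) from (show Γ(X, U.ι ''ᵁ W) from a) • (show Γ(M, U.ι ''ᵁ W) from m)) := by
  have h : a • m = (show Γ(M.restrict U.ι, W) from
    (U.ι.appIso W).inv a • (show Γ(M, U.ι ''ᵁ W) from m)) := rfl
  rw [h, U.ι_appIso]
  rfl

/-- The generator is the image of the function `1` under a local trivialisation. -/
theorem exists_generator (D : LineBundleWithSection X) (x : X) :
    ∃ (U : X.Opens) (l : Γ(D.L, U)), x ∈ U ∧ IsGenerator l := by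
  obtain ⟨U, hx, ⟨φ⟩⟩ := D.locallyTrivial x
  let ψ : (structureSheaf X).restrict U.ι ≅ D.L.restrict U.ι := restrictStructureSheaf X U ≪≫ φ.symm
  refine ⟨U.ι ''ᵁ ⊤, ψ.hom.app ⊤ (show Γ(X, U.ι ''ᵁ ⊤) from 1), by simpa using hx, ?_⟩
  intro V i
  obtain ⟨W, rfl⟩ : ∃ W : U.toScheme.Opens, V = U.ι ''ᵁ W := ⟨U.ι ⁻¹ᵁ V, by
    have := i.le
    rw [U.ι.image_preimage_eq_opensRange_inf]
    simp at this ⊢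
    exact this⟩
  have i' : W ⟶ ⊤ := homOfLE le_top
  have h1 : D.L.presheaf.map i.op (ψ.hom.app ⊤ (show Γ(X, U.ι ''ᵁ ⊤) from 1)) =
      ψ.hom.app W (show Γ(X, U.ι ''ᵁ W) from 1) := by
    have h := app_map ψ.hom i' (show Γ(X, U.ι ''ᵁ ⊤) from 1)
    refine (h.symm.trans ?_)
    refine congrArg (ψ.hom.app W) ?_
    exact map_one (X.presheaf.map (U.ι.opensFunctor.map i').op).hom
  have h2 (a : Γ(X, U.ι ''ᵁ W)) : a • (show Γ(D.L, U.ι ''ᵁ W) from ψ.hom.app W (show Γ(X, U.ι ''ᵁ W) from 1)) =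
      ψ.hom.app W (show Γ(X, U.ι ''ᵁ W) from a) := by
    have h := Hom.app_smul ψ.hom (show Γ(U.toScheme, W) from a) (show Γ(X, U.ι ''ᵁ W) from 1)
    refine (restrict_ι_smul D.L U W a _).symm.trans ?_
    refine h.symm.trans (congrArg (ψ.hom.app W) ?_)
    refine (restrict_ι_smul (structureSheaf X) U W a _).trans ?_
    exact mul_one (show Γ(X, U.ι ''ᵁ W) from a)
  rw [h1]
  refine Eq.mp (congrArg Function.Bijective (funext fun a => (h2 a).symm)) ?_
  have := (ConcreteCategory.isIso_iff_bijective (ψ.hom.app W)).1 inferInstance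
  exact this

theorem mulSection_app (D : LineBundleWithSection X) (M : X.Modules) {U : X.Opens} (m : Γ(M, U)) :
    (D.mulSection M).app U m = tmul (D.s.app U (oneSection X U)) m := by
  have h : (λ_ M).inv.app U m = tmul (M := 𝟙_ X.Modules) (oneSection X U) m := by
    apply ((ConcreteCategory.isIso_iff_bijective ((λ_ M).hom.app U)).1 inferInstance).1
    refine Eq.trans ?_ (leftUnitor_hom_app_tmul (1 : Γ(X, U)) m).symm
    rw [one_smul, ← ConcreteCategory.comp_apply, ← Hom.comp_app, Iso.inv_hom_id]
    rfl
  rw [LineBundleWithSection.mulSection, Hom.comp_app, ConcreteCategory.comp_apply, h]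
  exact whiskerRight_app_tmul _ _ _

end AlgebraicGeometry.Scheme.Modules

/-! ### Exactness in terms of local sections -/

namespace AlgebraicGeometry.Scheme.Modules
variable {X : Scheme.{u}}

/-- Sections over an open subset, as a functor. -/
noncomputable def sectionsFunctor (U : X.Opens) : X.Modules ⥤ AddCommGrpCat.{u} :=
  toPresheaf X ⋙ (CategoryTheory.evaluation _ _).obj (op U)

noncomputable instance (U : X.Opens) : PreservesLimitsOfSize.{u, u} (sectionsFunctor U) :=
  have : PreservesLimitsOfSize.{u, u}
      ((CategoryTheory.evaluation X.Opensᵒᵖ AddCommGrpCat.{u}).obj (op U)) := ⟨inferInstance⟩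
  comp_preservesLimits (toPresheaf X) _

instance (U : X.Opens) : (sectionsFunctor U).Additive where
  map_add := rfl

variable {M N P : X.Modules}

theorem exists_kernel_section (f : M ⟶ N) {U : X.Opens} (s : Γ(M, U)) (hs : f.app U s = 0) :
    ∃ k : Γ(kernel f, U), (kernel.ι f).app U k = s := by
  have h := (ShortComplex.exact_kernel f).map_of_mono_of_preservesKernel (sectionsFunctor U)
    inferInstance inferInstance
  exact (ShortComplex.ab_exact_iff _).1 h s hs

theorem mono_iff_app_injective (f : M ⟶ N) :
    Mono f ↔ ∀ U, Function.Injective (f.app U) := by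
  constructor
  · intro _ U
    exact (AddCommGrpCat.mono_iff_injective ((sectionsFunctor U).map f)).1 inferInstance
  · refine fun h => ⟨fun a b hab => hom_ext _ _ fun U => ?_⟩
    ext s
    exact h U (ConcreteCategory.congr_hom (congrArg (fun φ => Hom.app φ U) hab) s)

/-- Surjectivity of a morphism of sheaves of modules on local sections. -/
def IsLocSurj (f : M ⟶ N) : Prop :=
  ∀ (U : X.Opens) (s : Γ(N, U)), ∀ x ∈ U, ∃ (V : X.Opens) (i : V ⟶ U), x ∈ V ∧
    ∃ t, f.app V t = N.presheaf.map i.op s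

theorem IsLocSurj.epi {f : M ⟶ N} (h : IsLocSurj f) : Epi f := by
  refine ⟨fun {Z} a b hab => hom_ext _ _ fun U => ?_⟩
  ext s
  refine section_ext fun x hx => ?_
  obtain ⟨V, i, hV, t, ht⟩ := h U s x hx
  refine ⟨V, i, hV, ?_⟩
  rw [← app_map, ← app_map, ← ht]
  exact (ConcreteCategory.congr_hom (congrArg (fun φ => Hom.app φ V) hab) t)

/-- The map from `N` to the sheafified presheaf cokernel of `f` vanishes because `f` is an
epimorphism of sheaves. Since the unit of sheafification is locally injective, every section of the
presheaf cokernel coming from `N` dies locally, that is, lifts locally along `f`. -/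
theorem isLocSurj_of_epi (f : M ⟶ N) [Epi f] : IsLocSurj f := by
  intro U s x hx
  let π := cokernel.π ((toPreMod X).map f)
  let a : N ⟶ (sheafify X).obj (cokernel ((toPreMod X).map f)) :=
    (toPreMod X).preimage (π ≫ (sheafifyAdj X).unit.app _)
  have ha : a = 0 := by
    rw [← cancel_epi f, comp_zero]
    apply (toPreMod X).map_injective
    simp [a, π]
  have hu : tensorW X ((sheafifyAdj X).unit.app (cokernel ((toPreMod X).map f))) :=
    (Opens.grothendieckTopology X).W_toSheafify (cokernel ((toPreMod X).map f)).presheaf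
  obtain ⟨_, _⟩ := ((Opens.grothendieckTopology X).W_iff_isLocallyBijective _).1 hu
  have h0 : ((sheafifyAdj X).unit.app (cokernel ((toPreMod X).map f))).app (op U) (π.app (op U) s) = 0 := by
    have h1 : π ≫ (sheafifyAdj X).unit.app _ = 0 := by
      rw [← (toPreMod X).map_preimage (π ≫ (sheafifyAdj X).unit.app _)]
      exact (congrArg _ ha).trans (Functor.map_zero _ _ _)
    exact congrArg (fun φ => (φ.app (op U)).hom s) h1
  obtain ⟨V, i, h, hx⟩ := Presheaf.equalizerSieve_mem (Opens.grothendieckTopology X)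
    ((PresheafOfModules.toPresheaf _).map ((sheafifyAdj X).unit.app (cokernel ((toPreMod X).map f)))) (X := op U) 
     (π.app (op U) s) 0 (h0.trans (map_zero _).symm) x hx
  refine ⟨V, i, hx, ?_⟩
  have h2 : π.app (op V) (N.presheaf.map i.op s) = 0 :=
    (PresheafOfModules.naturality_apply π i.op s).trans (h.trans (map_zero
      (((PresheafOfModules.toPresheaf _).obj (cokernel ((toPreMod X).map f))).map i.op).hom))
  have hex := (ShortComplex.exact_cokernel ((toPreMod X).map f)).map_of_epi_of_preservesCokernel
    (PresheafOfModules.evaluation _ (op V)) inferInstance inferInstance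
  exact (ShortComplex.moduleCat_exact_iff _).1 hex (N.presheaf.map i.op s) h2

theorem exact_iff (S : ShortComplex X.Modules) :
    S.Exact ↔ ∀ (U : X.Opens) (s : Γ(S.X₂, U)), S.g.app U s = 0 → 
      ∀ x ∈ U, ∃ (V : X.Opens) (i : V ⟶ U), x ∈ V ∧
      ∃ t, S.f.app V t = S.X₂.presheaf.map i.op s := by
  rw [S.exact_iff_epi_kernel_lift]
  constructor
  · intro _ U s hs x hx
    obtain ⟨k, rfl⟩ := exists_kernel_section S.g s hs
    obtain ⟨V, i, hV, t, ht⟩ := isLocSurj_of_epi (kernel.lift S.g S.f S.zero) U k x hx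
    refine ⟨V, i, hV, t, ?_⟩
    rw [← app_map, ← ht, ← ConcreteCategory.comp_apply, ← Hom.comp_app, kernel.lift_ι]
  · intro h
    refine IsLocSurj.epi fun U k x hx => ?_
    obtain ⟨V, i, hV, t, ht⟩ := h U ((kernel.ι S.g).app U k) (by
      rw [← ConcreteCategory.comp_apply, ← Hom.comp_app, kernel.condition]; rfl) x hx
    refine ⟨V, i, hV, t, (mono_iff_app_injective (kernel.ι S.g)).1 inferInstance V ?_⟩
    rw [app_map, ← ht, ← ConcreteCategory.comp_apply, ← Hom.comp_app, kernel.lift_ι]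

end AlgebraicGeometry.Scheme.Modules

/-! ### Tensoring with a line bundle -/

namespace AlgebraicGeometry.Scheme.Modules
variable {X : Scheme.{u}} (D : LineBundleWithSection X) {M N : X.Modules}

theorem exists_generator_le {U : X.Opens} (x : X) (hx : x ∈ U) :
    ∃ (V : X.Opens) (_ : V ⟶ U) (l : Γ(D.L, V)), x ∈ V ∧ IsGenerator l := by
  obtain ⟨V, l, hV, hl⟩ := exists_generator D x
  exact ⟨V ⊓ U, homOfLE inf_le_right, D.L.presheaf.map (homOfLE inf_le_left).op l, ⟨hV, hx⟩,
    hl.map _⟩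

theorem exists_eq_tmul {U : X.Opens} (t : Γ(D.L ⊗ M, U)) (x : X) (hx : x ∈ U) :
    ∃ (V : X.Opens) (i : V ⟶ U) (l : Γ(D.L, V)) (m : Γ(M, V)), x ∈ V ∧ IsGenerator l ∧
      (D.L ⊗ M).presheaf.map i.op t = tmul l m := by
  obtain ⟨V, i, l, hV, hl⟩ := exists_generator_le D x hx
  obtain ⟨m, hm⟩ := hl.tmul_surjective (M := M) ((D.L ⊗ M).presheaf.map i.op t)
  exact ⟨V, i, l, m, hV, hl, hm.symm⟩

theorem zero_of_tmul_eq_zero {U : X.Opens} {l : Γ(D.L, U)} (hl : IsGenerator l) {m : Γ(M, U)}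
    (h : tmul l m = 0) : m = 0 :=
  hl.tmul_injective (h.trans (tmul_zero l).symm)

instance : (tensorLeft D.L).Additive where
  map_add {M N f g} := tensor_hom_ext fun U l m => by
    change (D.L ◁ (f + g)).app U _ = (D.L ◁ f + D.L ◁ g).app U _
    rw [Hom.add_app, AddCommGrpCat.hom_add_apply, whiskerLeft_app_tmul, whiskerLeft_app_tmul,
      whiskerLeft_app_tmul, Hom.add_app, AddCommGrpCat.hom_add_apply, tmul_add]

/-- Locally every section of `L ⊗ M` is `l ⊗ m` for a generator `l` and a unique `m`, so exactness
is inherited from the second factors. -/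
theorem exact_map_tensorLeft (S : ShortComplex X.Modules) (hS : S.Exact) :
    (S.map (tensorLeft D.L)).Exact := by
  rw [exact_iff] at hS ⊢
  intro U (t : Γ(D.L ⊗ S.X₂, U)) (ht : (D.L ◁ S.g).app U t = 0) x hx
  obtain ⟨V, i, l, m, hV, hl, hm⟩ := exists_eq_tmul D t x hx
  have h0 : S.g.app V m = 0 := by
    refine zero_of_tmul_eq_zero D hl ?_
    rw [← whiskerLeft_app_tmul, ← hm, app_map, ht, map_zero]
  obtain ⟨W, j, hW, n, hn⟩ := hS V m h0 x hV
  refine ⟨W, j ≫ i, hW, tmul (D.L.presheaf.map j.op l) n, ?_⟩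
  refine (whiskerLeft_app_tmul S.f _ _).trans ?_
  rw [hn, ← map_tmul, ← hm]
  exact map_map (D.L ⊗ S.X₂) j i t

instance : PreservesFiniteLimits (tensorLeft D.L) :=
  (((Functor.exact_tfae (tensorLeft D.L)).out 1 3).1 (exact_map_tensorLeft D) :
    PreservesFiniteLimits _ ∧ PreservesFiniteColimits _).1

instance : PreservesFiniteColimits (tensorLeft D.L) :=
  (((Functor.exact_tfae (tensorLeft D.L)).out 1 3).1 (exact_map_tensorLeft D) :
    PreservesFiniteLimits _ ∧ PreservesFiniteColimits _).2

/-- Two local sections of a line bundle are multiples `a' • l`, `b' • l` of one generator, and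
functions commute. This is what makes EX1 hold on the twisted faces of `twistDiagram`. -/
theorem braiding_self : (β_ D.L D.L).hom = 𝟙 _ := by
  refine tensor_hom_ext fun U a b => ?_
  rw [braiding_hom_app_tmul]
  change tmul b a = tmul a b
  refine section_ext fun x hx => ?_
  obtain ⟨V, i, l, hV, hl⟩ := exists_generator_le D x hx
  refine ⟨V, i, hV, ?_⟩
  rw [map_tmul, map_tmul]
  obtain ⟨a', ha⟩ := hl.equiv.surjective (D.L.presheaf.map i.op a)
  obtain ⟨b', hb⟩ := hl.equiv.surjective (D.L.presheaf.map i.op b)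
  rw [← ha, ← hb, ← mul_one a', ← mul_one b', ← smul_eq_mul, ← smul_eq_mul, LinearEquiv.map_smul,
    LinearEquiv.map_smul, hl.equiv_one]
  simp only [smul_tmul, tmul_smul]
  rw [smul_comm]

theorem mulSection_naturality (f : M ⟶ N) : f ≫ D.mulSection N = D.mulSection M ≫ D.L ◁ f := by
  rw [LineBundleWithSection.mulSection, LineBundleWithSection.mulSection,
    leftUnitor_inv_naturality_assoc, Category.assoc, whisker_exchange]

end AlgebraicGeometry.Scheme.Modules

/-! ### Quasi-coherence tested on sections over affine opens -/

namespace AlgebraicGeometry.Scheme.Modules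

/-- The quasi-coherence condition for the sections of `M` over an (affine) open subset `U`. -/
structure IsQCohOn {X : Scheme.{u}} (M : X.Modules) (U : X.Opens) : Prop where
  exists_eq_pow_smul : ∀ (f : Γ(X, U)) (t : Γ(M, X.basicOpen f)), ∃ (n : ℕ) (s : Γ(M, U)),
    M.presheaf.map (homOfLE (X.basicOpen_le f)).op s =
      X.presheaf.map (homOfLE (X.basicOpen_le f)).op f ^ n • t
  exists_pow_smul_eq_zero : ∀ (f : Γ(X, U)) (s : Γ(M, U)),
    M.presheaf.map (homOfLE (X.basicOpen_le f)).op s = 0 → ∃ n : ℕ, f ^ n • s = 0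

/-- The basic open subset `D(f)` of the spectrum of `R`. -/
def specBasicOpen {R : CommRingCat.{u}} (f : R) : (Spec R).Opens := PrimeSpectrum.basicOpen f

theorem isLocalizing_iff {R : CommRingCat.{u}} (N : (Spec R).Modules) :
    IsLocalizing (modulesSpecToSheaf.obj N) ↔
      (∀ (f : R) (t : Γ(N, specBasicOpen f)), ∃ (n : ℕ) (s : Γ(N, ⊤)),
        N.presheaf.map (homOfLE le_top).op s = f ^ n • t) ∧
      ∀ (f : R) (s : Γ(N, ⊤)), N.presheaf.map (homOfLE (le_top (a := specBasicOpen f))).op s = 0 →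
        ∃ n : ℕ, f ^ n • s = 0 := by
  let φ (f : R) := ((modulesSpecToSheaf.obj N).obj.map (PrimeSpectrum.basicOpen f).leTop.op).hom
  refine ⟨fun h ↦ ?_, fun h f ↦ IsLocalizedModule.Away.mk_of_addCommGroup ?_ ?_ ?_⟩
  · have hf (f : R) : IsLocalizedModule.Away f (φ f) := h f
    refine ⟨fun f s ↦ ?_, fun f s hs ↦ ?_⟩
    · obtain ⟨n, y, hy⟩ := (hf f).surj _ _ s
      exact ⟨n, y, hy.symm⟩
    · obtain ⟨⟨_, n, rfl⟩, hn⟩ := (IsLocalizedModule.eq_zero_iff (.powers f) (φ f)).mp hs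
      exact ⟨n, hn⟩
  · exact Scheme.Modules.isUnit_algebraMap_end_of_le_basicOpen f le_rfl
  · intro x
    obtain ⟨n, t, ht⟩ := h.1 _ x
    exact ⟨n, t, ht.symm⟩
  · intro x hx
    obtain ⟨n, hn⟩ := h.2 _ _ hx
    exact ⟨n, hn⟩

variable {X : Scheme.{u}} {M : X.Modules} {U : X.Opens} 

theorem fromSpec_image_le (hU : IsAffineOpen U) (V : (Spec Γ(X, U)).Opens) : hU.fromSpec ''ᵁ V ≤ U := by
  conv_rhs => rw [← hU.opensRange_fromSpec]
  exact Hom.image_le_opensRange _ _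

theorem restrict_fromSpec_smul (hU : IsAffineOpen U) {V : (Spec Γ(X, U)).Opens} (r : Γ(X, U))
    (x : Γ(M.restrict hU.fromSpec, V)) :
    r • x = (show Γ(M.restrict hU.fromSpec, V) from
      X.presheaf.map (homOfLE (fromSpec_image_le hU V)).op r •
        (show Γ(M, hU.fromSpec ''ᵁ V) from x)) := by
  have h : X.presheaf.map (homOfLE (fromSpec_image_le hU V)).op r =
      (hU.fromSpec.appIso V).inv ((Spec Γ(X, U)).presheaf.map V.leTop.op ((Scheme.ΓSpecIso Γ(X, U)).inv r)) := by
    apply (ConcreteCategory.bijective_of_isIso (hU.fromSpec.appIso V).hom).1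
    simp only [← ConcreteCategory.comp_apply]
    congr 2
    simp [Scheme.Hom.appIso_hom', Scheme.Hom.appLE, hU.fromSpec_app_self]
    simp only [← Functor.map_comp]
    rfl
  rw [h]
  rfl

/-- Sections of `M` over `B` are obtained from sections over `W` by inverting `f`. -/
def IsLocAt (M : X.Modules) {U W B : X.Opens} (f : Γ(X, U)) (hBW : B ≤ W) (hW : W ≤ U) : Prop :=
  (∀ t : Γ(M, B), ∃ (n : ℕ) (s : Γ(M, W)), M.presheaf.map (homOfLE hBW).op s =
      X.presheaf.map (homOfLE (hBW.trans hW)).op (f ^ n) • t) ∧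
    ∀ s : Γ(M, W), M.presheaf.map (homOfLE hBW).op s = 0 →
      ∃ n : ℕ, X.presheaf.map (homOfLE hW).op (f ^ n) • s = 0

theorem isQCohOn_iff_isLocAt :
    M.IsQCohOn U ↔ ∀ f : Γ(X, U), M.IsLocAt f (X.basicOpen_le f) (le_refl U) := by
  have h (a : Γ(X, U)) : X.presheaf.map (homOfLE (le_refl U)).op a = a := by
    rw [Subsingleton.elim (homOfLE (le_refl U)) (𝟙 U), op_id, CategoryTheory.Functor.map_id]; rfl
  simp only [IsLocAt, h, map_pow, forall_and]
  exact ⟨fun h => ⟨h.1, h.2⟩, fun h => ⟨h.1, h.2⟩⟩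

/-- Transported to the spectrum along `fromSpec`, the condition says that restriction to each basic
open set is the localization of the global sections, which is the criterion for being the sheaf of a
module. -/
theorem isQCohOn_iff_isIso_fromTildeΓ (hU : IsAffineOpen U) :
    M.IsQCohOn U ↔ IsIso (M.restrict hU.fromSpec).fromTildeΓ := by
  rw [isIso_fromTildeΓ_iff_isLocalizing, isLocalizing_iff, isQCohOn_iff_isLocAt]
  have htop : hU.fromSpec ''ᵁ ⊤ = U := by simp
  have hb (f : Γ(X, U)) : hU.fromSpec ''ᵁ (specBasicOpen f) = X.basicOpen f :=
    hU.fromSpec_image_basicOpen f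
  -- The images of the whole spectrum and of a basic open set equal `U` and `X.basicOpen f` only
  -- propositionally; with variable opens the equalities can be substituted.
  have key (f : Γ(X, U)) (W B : X.Opens) (hW : W = U) (hB : B = X.basicOpen f) :
      M.IsLocAt f (X.basicOpen_le f) le_rfl ↔
        M.IsLocAt f (hB.trans_le ((X.basicOpen_le f).trans hW.ge)) hW.le := by
    subst hW hB
    rfl
  rw [forall_congr' fun f => key f _ _ htop (hb f), ← forall_and]
  refine forall_congr' fun f => and_congr ?_ ?_
  · refine forall_congr' fun t => exists_congr fun n => exists_congr fun s => ?_
    exact Eq.congr_right (restrict_fromSpec_smul hU (f ^ n) t).symm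
  · refine forall_congr' fun s => imp_congr Iff.rfl (exists_congr fun n => ?_)
    exact Eq.congr_left (restrict_fromSpec_smul hU (f ^ n) s).symm

end AlgebraicGeometry.Scheme.Modules

namespace AlgebraicGeometry.Scheme.Modules
variable {X : Scheme.{u}} {M : X.Modules} {U : X.Opens} 

theorem isQCohOn_of_isQuasicoherent (hM : SheafOfModules.IsQuasicoherent (R := X.ringCatSheaf) M)
    (hU : IsAffineOpen U) : M.IsQCohOn U := by
  rw [isQCohOn_iff_isIso_fromTildeΓ hU]
  have : M.IsQuasicoherent := hM
  have : ((restrictFunctor hU.fromSpec).obj M).IsQuasicoherent := inferInstance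
  exact isIso_fromTildeΓ_of_isQuasicoherent _

/-- `overEquiv` is compatible with the structure sheaves -/
noncomputable def overInverseUnitIso (U : X.Opens) :
    (overEquiv U).inverse.obj (SheafOfModules.unit U.toScheme.ringCatSheaf) ≅ SheafOfModules.unit (X.ringCatSheaf.over U) :=
  (overEquiv U).inverse.mapIso ((restrictUnitIso U.ι).symm ≪≫
    ((overFunctorEquiv U).app (SheafOfModules.unit X.ringCatSheaf)).symm) ≪≫
    ((overEquiv U).unitIso.app (SheafOfModules.unit (X.ringCatSheaf.over U))).symm

noncomputable def overIso (hU : IsAffineOpen U) (M : X.Modules) :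
    (overEquiv U).inverse.obj ((restrictFunctor hU.isoSpec.hom).obj (M.restrict hU.fromSpec)) ≅
      (SheafOfModules.overFunctor X.ringCatSheaf U).obj M :=
  (overEquiv U).inverse.mapIso (((restrictFunctorComp _ _).symm ≪≫
    (restrictFunctorCongr hU.isoSpec_hom_fromSpec)).app M ≪≫
    ((overFunctorEquiv U).app M).symm) ≪≫
    ((overEquiv U).unitIso.app _).symm

theorem isIso_sheafOfModules {M N : X.Modules} (e : M ≅ N) :
    IsIso (C := SheafOfModules X.ringCatSheaf) (X := M) (Y := N) e.hom :=
  e.isIso_hom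

theorem exists_presentation_spec {R : CommRingCat.{u}} (N : (Spec R).Modules)
    (h : IsIso N.fromTildeΓ) (hf : Module.Finite R Γ(N, ⊤)) :
    ∃ p : SheafOfModules.Presentation N, p.generators.IsFiniteType := by
  obtain ⟨s, hs⟩ := Module.Finite.fg_top (R := R) (M := Γ(N, ⊤))
  have e := @asIso _ _ _ _ _ h
  have := isIso_sheafOfModules e
  -- Only the generators have to be finite in number, so the whole module of relations serves as the
  -- set of relations.
  exact ⟨SheafOfModules.Presentation.ofIsIso (R := (Spec R).ringCatSheaf) e.hom (presentationTilde (moduleSpecΓFunctor.obj N) (s : Set Γ(N, ⊤)) hs _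
    (Submodule.span_eq _)), ⟨inferInstanceAs (Finite s)⟩⟩

/-- Transport of modules from the spectrum of the ring of functions on an affine open subset. -/
noncomputable abbrev specToOver (hU : IsAffineOpen U) :
    (Spec Γ(X, U)).Modules ⥤ SheafOfModules (X.ringCatSheaf.over U) :=
  restrictFunctor hU.isoSpec.hom ⋙ (overEquiv U).inverse

/-- The same functor, on sheaves of modules. -/
noncomputable def specToOver' (hU : IsAffineOpen U) :
    SheafOfModules (Spec Γ(X, U)).ringCatSheaf ⥤ SheafOfModules (X.ringCatSheaf.over U) :=
  specToOver hU

instance (hU : IsAffineOpen U) : PreservesColimitsOfSize.{u, u} (specToOver' hU) := by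
  have : PreservesColimitsOfSize.{u, u} (restrictFunctor hU.isoSpec.hom) := inferInstance
  have : PreservesColimitsOfSize.{u, u} (overEquiv U).inverse := inferInstance
  have : PreservesColimitsOfSize.{u, u} (specToOver hU) := comp_preservesColimits _ _
  exact this

theorem exists_presentation_over (hU : IsAffineOpen U) (p : SheafOfModules.Presentation (M.restrict hU.fromSpec))
    (hp : p.generators.IsFiniteType) :
    ∃ p : SheafOfModules.Presentation ((SheafOfModules.overFunctor X.ringCatSheaf U).obj M),
      p.generators.IsFiniteType :=
  ⟨(SheafOfModules.Presentation.map p (specToOver' hU) ((overEquiv U).inverse.mapIso (restrictUnitIso hU.isoSpec.hom) ≪≫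
      overInverseUnitIso U).symm).ofIsIso (overIso hU M).hom, ⟨hp.finite⟩⟩

theorem exists_presentation (hU : IsAffineOpen U) (h : M.IsQCohOn U)
    (hf : Module.Finite Γ(X, U) Γ(M, U)) :
    ∃ p : SheafOfModules.Presentation (M.restrict hU.fromSpec), p.generators.IsFiniteType := by
  have hf' : Module.Finite Γ(X, U) Γ(M.restrict hU.fromSpec, ⊤) := by
    let φ : Γ(M, U) →ₗ[Γ(X, U)] Γ(M.restrict hU.fromSpec, ⊤) :=
      { toFun x := M.presheaf.map (homOfLE (fromSpec_image_le hU ⊤)).op x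
        map_add' x y := map_add _ _ _
        map_smul' r x := (map_smul M _ _ _).trans (restrict_fromSpec_smul hU r _).symm }
    refine Module.Finite.of_surjective φ fun y => ?_
    refine ⟨M.presheaf.map (homOfLE (show U ≤ hU.fromSpec ''ᵁ ⊤ by simp)).op y, ?_⟩
    exact (map_map M _ _ _).trans (map_self M _ _)
  exact exists_presentation_spec _ ((isQCohOn_iff_isIso_fromTildeΓ hU).1 h) hf'

theorem coherent_of_forall (h : ∀ x : X, ∃ U : X.Opens, x ∈ U ∧ IsAffineOpen U ∧ M.IsQCohOn U ∧
    Module.Finite Γ(X, U) Γ(M, U)) : coherent X M := by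
  choose U hx hU hq hf using h
  choose p hp using fun x => exists_presentation (hU x) (hq x) (hf x)
  choose p' hp' using fun x => exists_presentation_over (hU x) (p x) (hp x)
  let q : SheafOfModules.QuasicoherentData.{u} (R := X.ringCatSheaf) M :=
    { I := X
      X := U
      coversTop := (Opens.coversTop_iff _ _).2 (by
        rw [TopologicalSpace.IsOpenCover, eq_top_iff]
        exact fun x _ => TopologicalSpace.Opens.mem_iSup.2 ⟨x, hx x⟩)
      presentation := p' }
  have : SheafOfModules.IsFiniteType.{u} (R := X.ringCatSheaf) M :=
     { exists_localGeneratorsData := ⟨q.localGeneratorsData, SheafOfModules.LocalGeneratorsData.IsFiniteType.mk (p := q.localGeneratorsData) hp'⟩ }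
  exact ⟨q.isQuasicoherent, this⟩

end AlgebraicGeometry.Scheme.Modules

/-! ### Finite generation: from local generators to finiteness over affine opens -/

namespace AlgebraicGeometry.Scheme.Modules
variable {X : Scheme.{u}} {M : X.Modules} {U : X.Opens} 

/-- The sections `T i` over `U` generate `M|_U` locally. -/
def LocallyGenerates {I : Type*} (T : I → Γ(M, U)) : Prop :=
  ∀ ⦃W : X.Opens⦄ (i : W ⟶ U) (s : Γ(M, W)), ∀ x ∈ W, ∃ (V : X.Opens) (j : V ⟶ W), x ∈ V ∧
    M.presheaf.map j.op s ∈ Submodule.span Γ(X, V) (Set.range fun a => M.presheaf.map (j ≫ i).op (T a))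

theorem app_structureSheaf (q : structureSheaf X ⟶ M) (i : U ⟶ ⊤) (b : Γ(structureSheaf X, U)) :
    q.app U b = sectionToFunction X U b • M.presheaf.map i.op (q.app ⊤ (oneSection X ⊤)) := by
  rw [← app_map, ← Hom.app_smul]
  congr 1
  have h : (structureSheaf X).presheaf.map i.op (oneSection X ⊤) = oneSection X U :=
    map_one (X.presheaf.map i.op).hom
  rw [h]
  exact (mul_one (show Γ(X, U) from b)).symm

/-- A finite coproduct is a biproduct, so `desc q` is the sum of the `π a ≫ q a`; a local lift of a
section then shows it as a combination of the images of `1`, with the coordinates of the lift as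
coefficients. -/
theorem locallyGenerates_of_epi {I : Type u} [Finite I] (q : I → (structureSheaf X ⟶ M))
    (h : Epi (Sigma.desc q)) : LocallyGenerates (U := ⊤) fun i => (q i).app ⊤ (oneSection X ⊤) := by
  have := Fintype.ofFinite I
  have : HasFiniteBiproducts X.Modules := Abelian.hasFiniteBiproducts
  intro W i s x hx
  have h' : Epi (biproduct.desc q) := by
    have h₁ : biproduct.desc q = (biproduct.isoCoproduct _).hom ≫ Sigma.desc q := by
      refine biproduct.hom_ext' _ _ fun a => ?_
      simp
    rw [h₁]
    infer_instance
  obtain ⟨V, j, hV, t, ht⟩ := isLocSurj_of_epi (biproduct.desc q) W s x hx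
  refine ⟨V, j, hV, ?_⟩
  rw [← ht]
  have key : biproduct.desc q = ∑ a, biproduct.π _ a ≫ q a := by
    classical
    refine biproduct.hom_ext' _ _ fun a => ?_
    simp [Preadditive.comp_sum, biproduct.ι_π_assoc, ite_comp]
  have hadd : ∀ (S : Finset I) (f : I → ((⨁ fun _ : I => structureSheaf X) ⟶ M)),
      (∑ a ∈ S, f a).app V t = ∑ a ∈ S, (f a).app V t := by
    intro S f
    classical
    induction S using Finset.induction_on with
    | empty => simp
    | insert a S ha ih => rw [Finset.sum_insert ha, Finset.sum_insert ha, Hom.add_app, AddCommGrpCat.hom_add_apply, ih]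
  rw [key, hadd]
  refine Submodule.sum_mem _ fun a _ => ?_
  rw [Hom.comp_app, ConcreteCategory.comp_apply, app_structureSheaf (q a) (j ≫ i)]
  exact Submodule.smul_mem _ _ (Submodule.subset_span ⟨a, rfl⟩)

theorem exists_locallyGenerates_of_generatingSections (G : SheafOfModules.GeneratingSections (R := X.ringCatSheaf) M) (hG : G.IsFiniteType) :
    ∃ (I : Type u) (_ : Finite I) (T : I → Γ(M, ⊤)), LocallyGenerates T := by
  have := hG.finite
  refine ⟨G.I, hG.finite, _, locallyGenerates_of_epi (fun i : G.I => (Sigma.ι (fun _ : G.I => structureSheaf X) i ≫ (show ∐ (fun _ : G.I => structureSheaf X) ⟶ M from G.π))) ?_⟩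
  have h2 : Sigma.desc (fun i : G.I => (Sigma.ι (fun _ : G.I => structureSheaf X) i ≫ (show ∐ (fun _ : G.I => structureSheaf X) ⟶ M from G.π))) = (show ∐ (fun _ : G.I => structureSheaf X) ⟶ M from G.π) := by
    refine Sigma.hom_ext _ _ fun a => ?_
    simp
  rw [h2]
  exact G.epi

/-- `overEquiv` on sheaves of modules. -/
noncomputable def overToRestrict (U : X.Opens) :
    SheafOfModules (X.ringCatSheaf.over U) ⥤ SheafOfModules U.toScheme.ringCatSheaf :=
  (overEquiv U).functor

instance (U : X.Opens) : PreservesColimitsOfSize.{u, u} (overToRestrict U) := by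
  have : PreservesColimitsOfSize.{u, u} (overEquiv U).functor := inferInstance
  exact this

theorem exists_generatingSections_restrict (U : X.Opens)
    (G : SheafOfModules.GeneratingSections ((SheafOfModules.overFunctor X.ringCatSheaf U).obj M))
    (hG : G.IsFiniteType) :
    ∃ G : SheafOfModules.GeneratingSections (R := U.toScheme.ringCatSheaf) (M.restrict U.ι),
      G.IsFiniteType := by
  have e := (overFunctorEquiv U).app M
  have he := isIso_sheafOfModules e
  have : Epi (C := SheafOfModules U.toScheme.ringCatSheaf) (X := (overToRestrict U).obj _)
    (Y := M.restrict U.ι) e.hom := he.epi_of_iso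
  exact ⟨SheafOfModules.GeneratingSections.ofEpi (R := U.toScheme.ringCatSheaf)
    (G.map (overToRestrict U) ((restrictUnitIso U.ι).symm ≪≫
    ((overFunctorEquiv U).app (SheafOfModules.unit X.ringCatSheaf)).symm)) e.hom, ⟨hG.finite⟩⟩

theorem exists_eq_image (U : X.Opens) {V : X.Opens} (h : V ≤ U.ι ''ᵁ ⊤) :
    ∃ W : U.toScheme.Opens, V = U.ι ''ᵁ W :=
  ⟨U.ι ⁻¹ᵁ V, by
    rw [U.ι.image_preimage_eq_opensRange_inf]
    simp only [Opens.opensRange_ι, Opens.ι_image_top] at h ⊢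
    simpa using h⟩

theorem locallyGenerates_of_restrict (U : X.Opens) {I : Type*} (T : I → Γ(M.restrict U.ι, ⊤))
    (hT : LocallyGenerates T) :
    LocallyGenerates (U := U.ι ''ᵁ ⊤) (show I → Γ(M, U.ι ''ᵁ ⊤) from T) := by
  intro W i s x hx
  obtain ⟨W, rfl⟩ := exists_eq_image U i.le
  obtain ⟨y, hy, rfl⟩ := hx
  obtain ⟨V, j, hV, h⟩ := hT (homOfLE le_top) s y hy
  refine ⟨U.ι ''ᵁ V, U.ι.opensFunctor.map j, ⟨y, hV, rfl⟩, ?_⟩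
  change (show Γ(M, U.ι ''ᵁ V) from (M.restrict U.ι).presheaf.map j.op s) ∈ _
  generalize (M.restrict U.ι).presheaf.map j.op s = t at h
  induction h using Submodule.span_induction with
  | mem y hy => 
    obtain ⟨a, rfl⟩ := hy
    exact Submodule.subset_span ⟨a, rfl⟩
  | zero => exact Submodule.zero_mem _
  | add y z _ _ hy hz => exact Submodule.add_mem _ hy hz
  | smul a y _ hy =>
    have := restrict_ι_smul M U V a y
    rw [this]
    exact Submodule.smul_mem _ _ hy

theorem exists_locallyGenerates (hM : SheafOfModules.IsFiniteType.{u} (R := X.ringCatSheaf) M) (x : X) :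
    ∃ (U : X.Opens) (_ : x ∈ U) (I : Type u) (_ : Finite I) (T : I → Γ(M, U)), LocallyGenerates T := by
  obtain ⟨σ, hσ⟩ := SheafOfModules.IsFiniteType.exists_localGeneratorsData.{u} (R := X.ringCatSheaf) M
  have hc := (Opens.coversTop_iff _ _).1 σ.coversTop
  obtain ⟨i, hx⟩ := TopologicalSpace.Opens.mem_iSup.1 (hc.ge (TopologicalSpace.Opens.mem_top x))
  obtain ⟨G, hG⟩ := exists_generatingSections_restrict (σ.X i) (σ.generators i) (hσ.isFiniteType i)
  obtain ⟨I, hI, T, hT⟩ := exists_locallyGenerates_of_generatingSections G hG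
  exact ⟨(show X.Opens from σ.X i).ι ''ᵁ ⊤, ⟨⟨x, hx⟩, TopologicalSpace.Opens.mem_top _, rfl⟩, I, hI, _, locallyGenerates_of_restrict _ T hT⟩

end AlgebraicGeometry.Scheme.Modules

namespace AlgebraicGeometry.Scheme.Modules
variable {X : Scheme.{u}} {M : X.Modules} {U : X.Opens} 

theorem map_mem_span {V W : X.Opens} (i : W ⟶ V) {T : Set Γ(M, V)} {s : Γ(M, V)}
    (h : s ∈ Submodule.span Γ(X, V) T) :
    M.presheaf.map i.op s ∈ Submodule.span Γ(X, W) (M.presheaf.map i.op '' T) := by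
  induction h using Submodule.span_induction with
  | mem y hy => exact Submodule.subset_span ⟨y, hy, rfl⟩
  | zero => rw [map_zero]; exact Submodule.zero_mem _
  | add y z _ _ hy hz => rw [map_add]; exact Submodule.add_mem _ hy hz
  | smul a y _ hy => rw [map_smul]; exact Submodule.smul_mem _ _ hy

/-- Clearing denominators: the coefficients over `D(f)` are fractions with powers of `f` as
denominators. -/
theorem exists_pow_smul_eq_map (hU : IsAffineOpen U) (f : Γ(X, U)) (N : Submodule Γ(X, U) Γ(M, U))
    (y : Γ(M, X.basicOpen f)) (hy : y ∈ Submodule.span Γ(X, X.basicOpen f)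
      (M.presheaf.map (homOfLE (X.basicOpen_le f)).op '' N)) :
    ∃ n : ℕ, ∃ z ∈ N, M.presheaf.map (homOfLE (X.basicOpen_le f)).op z =
      X.presheaf.map (homOfLE (X.basicOpen_le f)).op (f ^ n) • y := by
  induction hy using Submodule.span_induction with
  | mem y hy =>
    obtain ⟨z, hz, rfl⟩ := hy
    exact ⟨0, z, hz, by simp⟩
  | zero => exact ⟨0, 0, N.zero_mem, by simp⟩
  | add y y' _ _ hy hy' =>
    obtain ⟨n, z, hz, h⟩ := hy
    obtain ⟨n', z', hz', h'⟩ := hy'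
    refine ⟨n + n', f ^ n' • z + f ^ n • z', N.add_mem (N.smul_mem _ hz) (N.smul_mem _ hz'), ?_⟩
    rw [map_add, map_smul, map_smul, h, h', smul_smul, smul_smul, smul_add, ← map_mul, ← map_mul,
      ← pow_add, ← pow_add, add_comm n' n]
  | smul b y _ hy =>
    obtain ⟨n, z, hz, h⟩ := hy
    have := hU.isLocalization_basicOpen f
    obtain ⟨⟨a, _, k, rfl⟩, hb⟩ := IsLocalization.surj (Submonoid.powers f) b
    replace hb : b * X.presheaf.map (homOfLE (X.basicOpen_le f)).op (f ^ k) =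
      X.presheaf.map (homOfLE (X.basicOpen_le f)).op a := hb
    refine ⟨k + n, a • z, N.smul_mem _ hz, ?_⟩
    rw [map_smul, h, ← hb, smul_smul, smul_smul, pow_add, map_mul]
    congr 1
    ring

theorem span_eq_top_of_locally (hU : IsAffineOpen U) (hM : M.IsQCohOn U) (N : Submodule Γ(X, U) Γ(M, U))
    (h : ∀ s : Γ(M, U), ∀ x ∈ U, ∃ (V : X.Opens) (j : V ⟶ U), x ∈ V ∧
      M.presheaf.map j.op s ∈ Submodule.span Γ(X, V) (M.presheaf.map j.op '' N)) : N = ⊤ := by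
  rw [eq_top_iff]
  intro s _
  -- The functions carrying `s` into `N`. It is enough that their non-vanishing loci cover `U`.
  let I : Ideal Γ(X, U) := N.comap (LinearMap.toSpanSingleton _ _ s)
  suffices hI : I = ⊤ by
    have h1 : (1 : Γ(X, U)) ∈ I := by rw [hI]; trivial
    have h2 : (1 : Γ(X, U)) • s ∈ N := h1
    rwa [one_smul] at h2
  have key : Ideal.span (I : Set Γ(X, U)) = ⊤ := by
    rw [← hU.iSup_basicOpen_eq_self_iff]
    refine le_antisymm (iSup_le fun f => X.basicOpen_le _) fun x hx => ?_
    obtain ⟨V, j, hV, hs⟩ := h s x hx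
    obtain ⟨g, hg, hxg⟩ := hU.exists_basicOpen_le (V := V) ⟨x, hV⟩ hx
    have hs' := map_mem_span (homOfLE hg) hs
    rw [map_map, ← Set.image_comp] at hs'
    have himg : (M.presheaf.map (homOfLE hg).op ∘ M.presheaf.map j.op) '' (N : Set Γ(M, U)) =
        M.presheaf.map (homOfLE (X.basicOpen_le g)).op '' N := by
      refine Set.image_congr fun a _ => ?_
      exact map_map M _ _ _
    rw [himg] at hs'
    obtain ⟨n, z, hz, h1⟩ := exists_pow_smul_eq_map hU g N _ hs'
    obtain ⟨k, hk⟩ := hM.exists_pow_smul_eq_zero g (g ^ n • s - z) (by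
      rw [map_sub, map_smul, h1, sub_eq_zero]; rfl)
    -- The additional factor keeps the exponent nonzero, so that `g` and this power have the same
    -- basic open set.
    have hmem : g ^ (k + n + 1) ∈ I := by
      rw [pow_succ]
      refine I.mul_mem_right g ?_
      change g ^ (k + n) • s ∈ N
      rw [smul_sub, smul_smul, ← pow_add, sub_eq_zero] at hk
      rw [hk]
      exact N.smul_mem _ hz
    refine TopologicalSpace.Opens.mem_iSup.2 ⟨⟨_, hmem⟩, ?_⟩
    rw [X.basicOpen_pow _ (by omega)]
    exact hxg
  rwa [Ideal.span_eq] at key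

/-- Every point has a neighbourhood over which `M` is generated by finitely many sections. -/
def IsLocallyFinitelyGenerated (M : X.Modules) : Prop :=
  ∀ x : X, ∃ (U : X.Opens) (_ : x ∈ U) (I : Type u) (_ : Finite I) (T : I → Γ(M, U)),
    LocallyGenerates T

/-- Near each point the local generators, multiplied by powers of some `f`, extend to sections over
`U`. Finitely many of the sets `D(f)` cover `U`, and the extended sections belonging to them
generate, by `span_eq_top_of_locally`. -/
theorem IsLocallyFinitelyGenerated.finite (hM : M.IsLocallyFinitelyGenerated)
    (hU : IsAffineOpen U) (hQ : M.IsQCohOn U) : Module.Finite Γ(X, U) Γ(M, U) := by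
  have key (x : U) : ∃ (f : Γ(X, U)) (S : Set Γ(M, U)), S.Finite ∧ x.1 ∈ X.basicOpen f ∧ 
      ∀ s : Γ(M, U), ∀ y ∈ X.basicOpen f, ∃ (V : X.Opens) (j : V ⟶ U), y ∈ V ∧
      M.presheaf.map j.op s ∈ Submodule.span Γ(X, V) (M.presheaf.map j.op '' S) := by
    obtain ⟨V, hV, I, hI, T, hT⟩ := hM x.1
    obtain ⟨f, hf, hxf⟩ := hU.exists_basicOpen_le (V := V) ⟨x.1, hV⟩ x.2
    choose n t ht using fun i => hQ.exists_eq_pow_smul f (M.presheaf.map (homOfLE hf).op (T i))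
    refine ⟨f, Set.range t, Set.finite_range t, hxf, fun s y hy => ?_⟩
    obtain ⟨W, j, hW, h⟩ := hT (homOfLE hf) (M.presheaf.map (homOfLE (X.basicOpen_le f)).op s) y hy
    refine ⟨W, j ≫ homOfLE (X.basicOpen_le f), hW, ?_⟩
    rw [map_map] at h
    refine Submodule.span_le.2 ?_ h
    rintro _ ⟨i, rfl⟩
    -- On opens inside `D(f)` the powers of `f` are units, so the original generators are multiples
    -- of the extended ones.
    have hu : IsUnit (X.presheaf.map j.op (X.presheaf.map (homOfLE (X.basicOpen_le f)).op f ^ n i)) := by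
      rw [map_pow]
      exact ((RingedSpace.isUnit_res_basicOpen _ f).map _).pow _
    have h2 := congrArg (M.presheaf.map j.op) (ht i)
    rw [map_map, map_smul, map_map] at h2
    have h3 := congrArg (fun z => ((hu.unit⁻¹ : Γ(X, W)ˣ) : Γ(X, W)) • z) h2
    dsimp only at h3
    rw [smul_smul, IsUnit.val_inv_mul, one_smul] at h3
    dsimp only [SetLike.mem_coe]
    rw [← h3]
    exact Submodule.smul_mem _ _ (Submodule.subset_span ⟨_, ⟨i, rfl⟩, rfl⟩)
  choose f S hS hx h using key
  have h1 : Ideal.span (Set.range f) = ⊤ := by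
    rw [← hU.iSup_basicOpen_eq_self_iff]
    refine le_antisymm (iSup_le fun f => X.basicOpen_le _) fun x hxU => ?_
    exact TopologicalSpace.Opens.mem_iSup.2 ⟨⟨_, ⟨x, hxU⟩, rfl⟩, hx _⟩
  obtain ⟨s', hs', h2⟩ := (Ideal.span_eq_top_iff_finite _).1 h1
  rw [← hU.iSup_basicOpen_eq_self_iff] at h2
  choose g hg using fun a : s' => hs' a.2
  refine Module.Finite.of_fg_top ?_
  have hfin : (⋃ a : s', S (g a)).Finite := Set.finite_iUnion fun a => hS _
  refine ⟨hfin.toFinset, span_eq_top_of_locally hU hQ _ fun s x hxU => ?_⟩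
  rw [← h2] at hxU
  obtain ⟨a, ha⟩ := TopologicalSpace.Opens.mem_iSup.1 hxU
  obtain ⟨V, j, hV, h3⟩ := h (g a) s x (by rw [hg]; exact ha)
  refine ⟨V, j, hV, Submodule.span_mono (Set.image_mono ?_) h3⟩
  refine Set.Subset.trans ?_ Submodule.subset_span
  rw [Set.Finite.coe_toFinset]
  exact Set.subset_iUnion (fun a : s' => S (g a)) a

/-- Coherence in terms of sections over affine open subsets. -/
theorem coherent.isQCohOn (hM : coherent X M) (hU : IsAffineOpen U) : M.IsQCohOn U :=
  isQCohOn_of_isQuasicoherent hM.1 hU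

theorem coherent.isLocallyFinitelyGenerated (hM : coherent X M) : M.IsLocallyFinitelyGenerated :=
  exists_locallyGenerates hM.2

theorem coherent.finite (hM : coherent X M) (hU : IsAffineOpen U) : Module.Finite Γ(X, U) Γ(M, U) :=
  IsLocallyFinitelyGenerated.finite (exists_locallyGenerates hM.2) hU (hM.isQCohOn hU)

end AlgebraicGeometry.Scheme.Modules

/-! ### Stability of coherent sheaves under the abelian operations and line-bundle twists -/

namespace AlgebraicGeometry.Scheme.Modules
variable {X : Scheme.{u}} {M N : X.Modules} {U : X.Opens} 

/-- Quasi-coherence and finiteness over `U` only depend on the sections over open subsets of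
`U`. -/
theorem isQCohOn_and_finite_of_bijective (hM : M.IsQCohOn U) (hf : Module.Finite Γ(X, U) Γ(M, U))
    (e : ∀ V : X.Opens, V ≤ U → (Γ(M, V) →ₗ[Γ(X, V)] Γ(N, V)))
    (he : ∀ V hV, Function.Bijective (e V hV))
    (hres : ∀ (V W : X.Opens) (hV : V ≤ U) (i : W ⟶ V) (m : Γ(M, V)),
      N.presheaf.map i.op (e V hV m) = e W (i.le.trans hV) (M.presheaf.map i.op m)) :
    N.IsQCohOn U ∧ Module.Finite Γ(X, U) Γ(N, U) := by
  refine ⟨⟨fun f t => ?_, fun f s hs => ?_⟩, .of_surjective (e U le_rfl) (he U le_rfl).2⟩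
  · obtain ⟨t, rfl⟩ := (he _ (X.basicOpen_le f)).2 t
    obtain ⟨n, s, hs⟩ := hM.exists_eq_pow_smul f t
    exact ⟨n, e U le_rfl s, by rw [hres, hs, LinearMap.map_smul]⟩
  · obtain ⟨s, rfl⟩ := (he _ le_rfl).2 s
    rw [hres] at hs
    obtain ⟨n, hn⟩ := hM.exists_pow_smul_eq_zero f s
      ((he _ (X.basicOpen_le f)).1 (hs.trans (map_zero _).symm))
    exact ⟨n, by rw [← LinearMap.map_smul, hn, map_zero]⟩

theorem appₗ_bijective (f : M ⟶ N) [IsIso f] (V : X.Opens) : Function.Bijective (Hom.appₗ f V) :=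
  (ConcreteCategory.isIso_iff_bijective (f.app V)).1 inferInstance

theorem exists_affine (x : X) (V : X.Opens) (hx : x ∈ V) : ∃ U : X.Opens, x ∈ U ∧ IsAffineOpen U ∧ U ≤ V := by
  obtain ⟨U, hU, hxU, h⟩ := TopologicalSpace.Opens.isBasis_iff_nbhd.1 X.isBasis_affineOpens hx
  exact ⟨U, hxU, hU, h⟩

theorem coherent_of_forall_isAffineOpen (h : ∀ U : X.Opens, IsAffineOpen U → M.IsQCohOn U ∧
    Module.Finite Γ(X, U) Γ(M, U)) : coherent X M :=
  coherent_of_forall fun x => by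
    obtain ⟨U, hxU, hU, -⟩ := exists_affine x ⊤ trivial
    exact ⟨U, hxU, hU, h U hU⟩

instance : (coherent X).IsClosedUnderIsomorphisms where
  of_iso e hM := coherent_of_forall_isAffineOpen fun _ hU =>
    isQCohOn_and_finite_of_bijective (hM.isQCohOn hU) (hM.finite hU)
      (fun V _ => Hom.appₗ e.hom V) (fun V _ => appₗ_bijective e.hom V)
      (fun _ _ _ i m => (app_map e.hom i m).symm)

/-- Tensoring with a generator identifies `M` with `L ⊗ M` over a small affine open set. -/
theorem coherent_tensor (D : LineBundleWithSection X) (hM : coherent X M) :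
    coherent X (D.L ⊗ M) := by
  refine coherent_of_forall fun x => ?_
  obtain ⟨V, l, hxV, hl⟩ := exists_generator D x
  obtain ⟨U, hxU, hU, hUV⟩ := exists_affine x V hxV
  replace hl := hl.map (homOfLE hUV)
  refine ⟨U, hxU, hU, isQCohOn_and_finite_of_bijective (hM.isQCohOn hU) (hM.finite hU)
    (fun V hV => tensorSections D.L M V ∘ₗ TensorProduct.mk _ _ _
      (D.L.presheaf.map (homOfLE hV).op (D.L.presheaf.map (homOfLE hUV).op l)))
    (fun V hV => (hl.map (homOfLE hV)).tmul_bijective) (fun V W hV i m => ?_)⟩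
  refine (map_tmul i _ _).trans ?_
  rw [map_map D.L i]
  rfl

open scoped ZeroObject in
instance : (coherent X).ContainsZero where
  exists_zero := by
    refine ⟨0, isZero_zero _, coherent_of_forall_isAffineOpen fun U _ => ?_⟩
    have h (V : X.Opens) (s : Γ((0 : X.Modules), V)) : s = 0 := by
      have : 𝟙 (0 : X.Modules) = 0 := (isZero_zero _).eq_of_src _ _
      exact ConcreteCategory.congr_hom (congrArg (fun φ => Hom.app φ V) this) s
    have : Subsingleton Γ((0 : X.Modules), U) := ⟨fun a b => (h U a).trans (h U b).symm⟩
    exact ⟨⟨fun f t => ⟨0, 0, by rw [h _ t, map_zero, smul_zero]⟩, fun f s _ => ⟨0, h _ _⟩⟩, inferInstance⟩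

theorem isQCohOn_kernel (f : M ⟶ N) (hM : M.IsQCohOn U) (hN : N.IsQCohOn U) :
    (kernel f).IsQCohOn U := by
  have hι (V : X.Opens) := (mono_iff_app_injective (kernel.ι f)).1 inferInstance V
  refine ⟨fun a t => ?_, fun a s hs => ?_⟩
  · obtain ⟨n, m, hm⟩ := hM.exists_eq_pow_smul a ((kernel.ι f).app _ t)
    -- The extension `m` need not lie in the kernel, but its image dies on `D(a)`, so a further
    -- power of `a` moves it there.
    obtain ⟨k, hk⟩ := hN.exists_pow_smul_eq_zero a (f.app U m) (by
      rw [← app_map, hm, Hom.app_smul, ← ConcreteCategory.comp_apply, ← Hom.comp_app,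
        kernel.condition]
      exact smul_zero (A := Γ(N, _)) _)
    obtain ⟨s, hs⟩ := exists_kernel_section f (a ^ k • m) (by rw [Hom.app_smul, hk])
    refine ⟨k + n, s, hι _ ?_⟩
    rw [app_map, hs, map_smul, hm, Hom.app_smul, map_pow, smul_smul, pow_add]
  · obtain ⟨n, hn⟩ := hM.exists_pow_smul_eq_zero a ((kernel.ι f).app _ s) (by
      rw [← app_map, hs, map_zero])
    exact ⟨n, hι _ (by rw [Hom.app_smul, hn, map_zero])⟩

/-- Finite generation passes to submodules because the rings of functions on affine opens are
noetherian. -/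
theorem coherent_kernel [IsLocallyNoetherian X] (f : M ⟶ N) (hM : coherent X M)
    (hN : coherent X N) : coherent X (kernel f) := by
  refine coherent_of_forall_isAffineOpen fun U hU => ⟨isQCohOn_kernel f (hM.isQCohOn hU) (hN.isQCohOn hU), ?_⟩
  have : IsNoetherianRing Γ(X, U) := IsLocallyNoetherian.component_noetherian ⟨U, hU⟩
  have := hM.finite hU
  exact Module.Finite.of_injective (Hom.appₗ (kernel.ι f) U)
    ((mono_iff_app_injective (kernel.ι f)).1 inferInstance U)

instance [IsLocallyNoetherian X] : (coherent X).IsClosedUnderKernels where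
  kernels_le := by
    rintro _ ⟨f, k, hk, hf⟩
    exact (coherent X).prop_of_iso ((kernelIsKernel f).conePointUniqueUpToIso hk)
      (coherent_kernel f hf.1 hf.2)

theorem coherent_biprod (hM : coherent X M) (hN : coherent X N) : coherent X (M ⊞ N) := by
  refine coherent_of_forall_isAffineOpen fun U hU => ?_
  have hM' := hM.isQCohOn hU
  have hN' := hN.isQCohOn hU
  have := hM.finite hU
  have := hN.finite hU
  have key (V : X.Opens) (t : Γ(M ⊞ N, V)) : t = (biprod.inl : M ⟶ M ⊞ N).app V ((biprod.fst : M ⊞ N ⟶ M).app V t) +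
      (biprod.inr : N ⟶ M ⊞ N).app V ((biprod.snd : M ⊞ N ⟶ N).app V t) :=
    ConcreteCategory.congr_hom (congrArg (fun φ => Hom.app φ V) (biprod.total (X := M) (Y := N)).symm) t
  refine ⟨⟨fun f t => ?_, fun f s hs => ?_⟩, .of_surjective ((Hom.appₗ biprod.inl U).coprod (Hom.appₗ biprod.inr U))
    fun t => ⟨(_, _), (key U t).symm⟩⟩
  · obtain ⟨n, a, ha⟩ := hM'.exists_eq_pow_smul f ((biprod.fst : M ⊞ N ⟶ M).app _ t)
    obtain ⟨m, b, hb⟩ := hN'.exists_eq_pow_smul f ((biprod.snd : M ⊞ N ⟶ N).app _ t)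
    refine ⟨m + n, f ^ m • (biprod.inl : M ⟶ M ⊞ N).app U a + f ^ n • (biprod.inr : N ⟶ M ⊞ N).app U b, ?_⟩
    conv_rhs => rw [key _ t]
    rw [map_add, map_smul, map_smul, ← app_map, ← app_map, ha, hb, Hom.app_smul, Hom.app_smul,
      smul_smul, smul_smul, map_pow, map_pow, ← pow_add, ← pow_add, add_comm n m, smul_add]
  · obtain ⟨n, hn⟩ := hM'.exists_pow_smul_eq_zero f ((biprod.fst : M ⊞ N ⟶ M).app _ s) (by
      rw [← app_map, hs, map_zero])
    obtain ⟨m, hm⟩ := hN'.exists_pow_smul_eq_zero f ((biprod.snd : M ⊞ N ⟶ N).app _ s) (by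
      rw [← app_map, hs, map_zero])
    refine ⟨m + n, ?_⟩
    have h₁ : f ^ (m + n) • (biprod.fst : M ⊞ N ⟶ M).app U s = 0 := by
      rw [pow_add, mul_smul, hn, smul_zero]
    have h₂ : f ^ (m + n) • (biprod.snd : M ⊞ N ⟶ N).app U s = 0 := by
      rw [add_comm, pow_add, mul_smul, hm, smul_zero]
    rw [key _ (f ^ (m + n) • s), (biprod.fst : M ⊞ N ⟶ M).app_smul,
      (biprod.snd : M ⊞ N ⟶ N).app_smul, h₁, h₂, map_zero, map_zero, add_zero]

instance : (coherent X).IsClosedUnderBinaryProducts where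
  limitsOfShape_le := by
    rintro P ⟨p⟩
    have hl := (BinaryBiproduct.isLimit (p.diag.obj ⟨.left⟩) (p.diag.obj ⟨.right⟩))
    let e : pair (p.diag.obj ⟨.left⟩) (p.diag.obj ⟨.right⟩) ≅ p.diag := (diagramIsoPair _).symm
    exact (coherent X).prop_of_iso ((IsLimit.postcomposeHomEquiv e _).symm hl |>.conePointUniqueUpToIso p.isLimit)
      (coherent_biprod (p.prop_diag_obj _) (p.prop_diag_obj _))

instance : (coherent X).IsClosedUnderFiniteProducts := .mk'

/-- Over an affine open set `f` comes from a homomorphism `g` of modules, since the tilde functor is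
full; both the tilde functor and restriction preserve cokernels. -/
theorem isQCohOn_cokernel (hU : IsAffineOpen U) (f : M ⟶ N) (hM : M.IsQCohOn U)
    (hN : N.IsQCohOn U) : (cokernel f).IsQCohOn U := by
  rw [isQCohOn_iff_isIso_fromTildeΓ hU] at hM hN ⊢
  rw [isIso_fromTildeΓ_iff]
  let eM := asIso (M.restrict hU.fromSpec).fromTildeΓ
  let eN := asIso (N.restrict hU.fromSpec).fromTildeΓ
  let g := (tilde.functor _).preimage (eM.hom ≫ (restrictFunctor hU.fromSpec).map f ≫ eN.inv)
  have hg : (tilde.functor _).map g = eM.hom ≫ (restrictFunctor hU.fromSpec).map f ≫ eN.inv :=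
    (tilde.functor _).map_preimage _
  exact ⟨cokernel g, ⟨PreservesCokernel.iso (tilde.functor _) g ≪≫
    cokernel.mapIso _ ((restrictFunctor hU.fromSpec).map f) eM eN (by
      rw [hg]
      exact (Category.assoc _ _ _).trans (congrArg (eM.hom ≫ ·) ((Category.assoc _ _ _).trans
        ((congrArg _ eN.inv_hom_id).trans (Category.comp_id _))))) ≪≫
    (PreservesCokernel.iso (restrictFunctor hU.fromSpec) f).symm⟩⟩

theorem IsLocallyFinitelyGenerated.of_epi (f : M ⟶ N) [Epi f]
    (hM : M.IsLocallyFinitelyGenerated) : N.IsLocallyFinitelyGenerated := by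
  intro x
  obtain ⟨U, hx, I, hI, T, hT⟩ := hM x
  refine ⟨U, hx, I, hI, fun a => f.app U (T a), fun W i s y hy => ?_⟩
  obtain ⟨V, j, hyV, t, ht⟩ := isLocSurj_of_epi f W s y hy
  obtain ⟨V', j', hyV', h⟩ := hT (j ≫ i) t y hyV
  refine ⟨V', j' ≫ j, hyV', ?_⟩
  have h' := Submodule.mem_map_of_mem (f := Hom.appₗ f V') h
  rw [Submodule.map_span, ← Set.range_comp] at h'
  have e₁ : Hom.appₗ f V' (M.presheaf.map j'.op t) = N.presheaf.map (j' ≫ j).op s := by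
    refine (app_map f j' t).trans ?_
    rw [ht, map_map]
  rw [e₁] at h'
  convert h' using 3
  ext a
  exact (app_map f _ _).symm

theorem coherent_cokernel (f : M ⟶ N) (hM : coherent X M) (hN : coherent X N) :
    coherent X (cokernel f) := by
  refine coherent_of_forall_isAffineOpen fun U hU => ?_
  have h := isQCohOn_cokernel hU f (hM.isQCohOn hU) (hN.isQCohOn hU)
  exact ⟨h, (hN.isLocallyFinitelyGenerated.of_epi (cokernel.π f)).finite hU h⟩

instance : (coherent X).IsClosedUnderCokernels where
  cokernels_le := by
    rintro _ ⟨f, k, hk, hf⟩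
    exact (coherent X).prop_of_iso ((cokernelIsCokernel f).coconePointUniqueUpToIso hk)
      (coherent_cokernel f hf.1 hf.2)

end AlgebraicGeometry.Scheme.Modules

/-! ### Closed immersions: modules killed by the ideal descend -/

namespace AlgebraicGeometry.Scheme.Modules

/-- A morphism of modules from a compatible family of linear maps on sections. -/
noncomputable def homMk {X : Scheme.{u}} {M N : X.Modules} (φ : M.presheaf ⟶ N.presheaf)
    (h : ∀ (U : X.Opens) (a : Γ(X, U)) (m : Γ(M, U)), φ.app (op U) (a • m) = a • φ.app (op U) m) :
    M ⟶ N :=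
  ⟨PresheafOfModules.homMk φ fun U r m => h U.unop r m⟩

section
variable {X Z : Scheme.{u}} (i : Z ⟶ X) [IsClosedImmersion i]

theorem exists_local_lift {V : Z.Opens} (a : Γ(Z, V)) {U : X.Opens} (hU : i ⁻¹ᵁ U ≤ V) {x : X} (hx : x ∈ U) :
    ∃ (W : X.Opens) (j : W ⟶ U) (b : Γ(X, W)), x ∈ W ∧
      i.app W b = Z.presheaf.map (homOfLE ((i.preimage_mono j.le).trans hU)).op a := by
  obtain ⟨W, hxW, hW, hWU⟩ := exists_affine x U hx
  obtain ⟨b, hb⟩ := i.app_surjective W hW (Z.presheaf.map (homOfLE ((i.preimage_mono hWU).trans hU)).op a)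
  exact ⟨W, homOfLE hWU, b, hxW, hb⟩

/-- The largest open subset with a given intersection with a closed subscheme. -/
def extendOpen (V : Z.Opens) : X.Opens :=
  ⟨(i '' (V : Set Z)ᶜ)ᶜ, (i.isClosedEmbedding.isClosedMap _ V.2.isClosed_compl).isOpen_compl⟩

theorem le_extendOpen {V : Z.Opens} {U : X.Opens} : U ≤ extendOpen i V ↔ i ⁻¹ᵁ U ≤ V := by
  constructor
  · intro h z hz
    by_contra hzV
    exact h hz ⟨z, hzV, rfl⟩
  · rintro h _ hx ⟨z, hz, rfl⟩
    exact hz (h hx)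

@[simp]
theorem preimage_extendOpen (V : Z.Opens) : i ⁻¹ᵁ extendOpen i V = V := by
  apply le_antisymm ((le_extendOpen i).1 le_rfl)
  rintro z hz ⟨z', hz', h⟩
  exact hz' (i.isClosedEmbedding.injective h ▸ hz)

theorem extendOpen_mono {V W : Z.Opens} (h : V ≤ W) : extendOpen i V ≤ extendOpen i W :=
  (le_extendOpen i).2 ((preimage_extendOpen i V).trans_le h)

theorem le_extendOpen_preimage (U : X.Opens) : U ≤ extendOpen i (i ⁻¹ᵁ U) :=
  (le_extendOpen i).2 le_rfl

/-- Linearity over `X` implies linearity over `Z`, because functions on `Z` lift locally to `X`. -/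
theorem pushforward_hom_smul {M N : Z.Modules} (φ : (pushforward i).obj M ⟶ (pushforward i).obj N)
    (U : X.Opens) (a : Γ(Z, i ⁻¹ᵁ U)) (m : Γ(M, i ⁻¹ᵁ U)) :
    (show Γ(N, i ⁻¹ᵁ U) from φ.app U (a • m)) = a • (show Γ(N, i ⁻¹ᵁ U) from φ.app U m) := by
  refine section_ext (M := (pushforward i).obj N) fun x hx => ?_
  obtain ⟨W, j, b, hxW, hb⟩ := exists_local_lift i a le_rfl hx
  refine ⟨W, j, hxW, ?_⟩
  refine (app_map φ j (a • m : Γ(M, i ⁻¹ᵁ U))).symm.trans ?_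
  have e₁ : ((pushforward i).obj M).presheaf.map j.op (a • m : Γ(M, i ⁻¹ᵁ U)) =
      b • ((pushforward i).obj M).presheaf.map j.op m := by
    refine (map_smul M ((TopologicalSpace.Opens.map i.base).map j) a m).trans ?_
    exact congrArg (· • M.presheaf.map ((TopologicalSpace.Opens.map i.base).map j).op m) hb.symm
  have e₂ : ((pushforward i).obj N).presheaf.map j.op (a • (show Γ(N, i ⁻¹ᵁ U) from φ.app U m) : Γ(N, i ⁻¹ᵁ U)) =
      b • ((pushforward i).obj N).presheaf.map j.op (φ.app U m) := by
    refine (map_smul N ((TopologicalSpace.Opens.map i.base).map j) a _).trans ?_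
    exact congrArg (· • N.presheaf.map ((TopologicalSpace.Opens.map i.base).map j).op (φ.app U m)) hb.symm
  rw [e₁, e₂, Hom.app_smul]
  exact congrArg (b • ·) (app_map φ j m)

/-- Every open `V` of `Z` is the trace of `extendOpen i V`, so the components of `φ` at these opens
define a morphism on `Z`. -/
theorem exists_pushforward_map_eq {M N : Z.Modules} (φ : (pushforward i).obj M ⟶ (pushforward i).obj N) :
    ∃ ψ, (pushforward i).map ψ = φ := by
  let l (V : Z.Opens) : i ⁻¹ᵁ extendOpen i V ⟶ V := homOfLE (preimage_extendOpen i V).le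
  let l' (V : Z.Opens) : V ⟶ i ⁻¹ᵁ extendOpen i V := homOfLE (preimage_extendOpen i V).ge
  have nat {U V : X.Opens} (j : U ⟶ V) (m : Γ(M, i ⁻¹ᵁ V)) := app_map φ j m
  let ψ : M.presheaf ⟶ N.presheaf :=
    { app V := M.presheaf.map (l V.unop).op ≫ φ.app (extendOpen i V.unop) ≫ N.presheaf.map (l' V.unop).op
      naturality V W f := by
        ext m
        have h := nat (homOfLE (extendOpen_mono i f.unop.le)) (M.presheaf.map (l V.unop).op m)
        have h' := congrArg (N.presheaf.map (l' W.unop).op) h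
        refine Eq.trans ?_ (h'.trans ?_)
        · refine congrArg (fun t : Γ(M, i ⁻¹ᵁ extendOpen i W.unop) => N.presheaf.map (l' W.unop).op (φ.app _ t)) ?_
          exact (map_map M _ f.unop m).trans
            (map_map M ((TopologicalSpace.Opens.map i.base).map
              (homOfLE (extendOpen_mono i f.unop.le))) (l V.unop) m).symm
        · exact (map_map N _ _ _).trans (map_map N f.unop _ _).symm }
  refine ⟨homMk ψ fun V a m => ?_, ?_⟩
  · refine (congrArg (fun t : Γ(M, i ⁻¹ᵁ extendOpen i V) => N.presheaf.map (l' V).op (φ.app _ t)) (map_smul M (l V) a m)).trans ?_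
    refine (congrArg (N.presheaf.map (l' V).op) (pushforward_hom_smul i φ _ _ _)).trans ?_
    refine (map_smul N (l' V) _ _).trans ?_
    refine congrArg (fun b : Γ(Z, V) => b • ψ.app (op V) m) ?_
    have := ConcreteCategory.congr_hom (Z.presheaf.map_comp (l V).op (l' V).op) a
    refine this.symm.trans ?_
    rw [Subsingleton.elim ((l V).op ≫ (l' V).op) (𝟙 _), CategoryTheory.Functor.map_id]
    rfl
  · refine hom_ext _ _ fun U => ?_
    ext m
    refine (congrArg (N.presheaf.map (l' (i ⁻¹ᵁ U)).op) (rfl : φ.app (extendOpen i (i ⁻¹ᵁ U)) (M.presheaf.map (l _).op m) = _)).trans ?_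
    refine (nat (homOfLE (le_extendOpen_preimage i U)) (M.presheaf.map (l _).op m)).symm.trans ?_
    exact congrArg (φ.app U) ((map_map M _ _ m).trans (map_self M _ m))

instance : (pushforward i).Full := ⟨exists_pushforward_map_eq i⟩

instance : (pushforward i).Faithful where
  map_injective {M N f g} h := by
    refine hom_ext _ _ fun V => ?_
    obtain ⟨U, rfl⟩ : ∃ U, i ⁻¹ᵁ U = V := ⟨_, preimage_extendOpen i V⟩
    exact congrArg (fun φ => Hom.app φ U) h

/-- The kernel of `𝒪_X ⟶ i_* 𝒪_Z` annihilates `M`. -/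
def IsKilledBy (M : X.Modules) : Prop :=
  ∀ (U : X.Opens) (a : Γ(X, U)) (m : Γ(M, U)), i.app U a = 0 → a • m = 0

section
variable {i} {M : X.Modules} (hM : IsKilledBy i M)
include hM

omit [IsClosedImmersion i] in
theorem IsKilledBy.eq_of_preimage_eq_bot {U : X.Opens} (hU : i ⁻¹ᵁ U = ⊥) (s t : Γ(M, U)) : s = t := by
  have : Subsingleton Γ(Z, i ⁻¹ᵁ U) := by rw [hU]; infer_instance
  rw [← one_smul Γ(X, U) s, ← one_smul Γ(X, U) t, hM U 1 s (Subsingleton.elim _ _),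
    hM U 1 t (Subsingleton.elim _ _)]

/-- `M` has the same sections over opens with the same intersection with `Z`. -/
theorem IsKilledBy.map_bijective {U V : X.Opens} (j : U ⟶ V) (h : i ⁻¹ᵁ V ≤ i ⁻¹ᵁ U) :
    Function.Bijective (M.presheaf.map j.op) := by
  -- `V` is covered by `U` and by the part of `V` away from `Z`; over the latter `M` has only one
  -- section. The lift of `Bool` meets the universe of `exists_glue`.
  let W (b : ULift.{u} Bool) : X.Opens := if b.down then U else V ⊓ extendOpen i ⊥
  have hW (b) : W b ≤ V := by
    dsimp only [W]; split_ifs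
    exacts [j.le, inf_le_left]
  have hbot {U' : X.Opens} (hU' : U' ≤ V ⊓ extendOpen i ⊥) : i ⁻¹ᵁ U' = ⊥ :=
    le_bot_iff.1 ((le_extendOpen i).1 (hU'.trans inf_le_right))
  have hcov : V ≤ iSup W := by
    intro x hx
    by_cases hxU : x ∈ U
    · exact TopologicalSpace.Opens.mem_iSup.2 ⟨⟨true⟩, hxU⟩
    · refine TopologicalSpace.Opens.mem_iSup.2 ⟨⟨false⟩, hx, ?_⟩
      rintro ⟨z, -, rfl⟩
      exact hxU (h hx)
  constructor
  · intro s t hst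
    refine section_ext fun x hx => ?_
    obtain ⟨⟨b⟩, hb⟩ := TopologicalSpace.Opens.mem_iSup.1 (hcov hx)
    refine ⟨_, homOfLE (hW ⟨b⟩), hb, ?_⟩
    cases b
    · exact hM.eq_of_preimage_eq_bot (hbot le_rfl) _ _
    · exact hst
  · intro s
    obtain ⟨t, ht⟩ := exists_glue (M := M) W (fun b => homOfLE (hW b)) hcov
      (fun b => match b with | ⟨true⟩ => s | ⟨false⟩ => (0 : Γ(M, V ⊓ extendOpen i ⊥))) (by
        rintro ⟨_ | _⟩ ⟨_ | _⟩ U' f g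
        · exact hM.eq_of_preimage_eq_bot (hbot f.le) _ _
        · exact hM.eq_of_preimage_eq_bot (hbot f.le) _ _
        · exact hM.eq_of_preimage_eq_bot (hbot g.le) _ _
        · rw [Subsingleton.elim f g])
    exact ⟨t, ht ⟨true⟩⟩

/-- The product `a m` is glued from the products `b m` for local lifts `b` of `a`. Two lifts differ
by a function vanishing on `Z`, which kills `M`. -/
theorem IsKilledBy.existsUnique_smul {V : Z.Opens} (a : Γ(Z, V)) (m : Γ(M, extendOpen i V)) :
    ∃! t : Γ(M, extendOpen i V), ∀ (W : X.Opens) (j : W ⟶ extendOpen i V) (b : Γ(X, W)),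
      i.app W b = Z.presheaf.map (homOfLE ((le_extendOpen i).1 j.le)).op a →
        M.presheaf.map j.op t = b • M.presheaf.map j.op m := by
  have hl (x : extendOpen i V) := exists_local_lift i a ((le_extendOpen i).1 le_rfl) x.2
  choose W j b hxW hb using hl
  have key {W' W'' U' : X.Opens} (f : U' ⟶ W') (g : U' ⟶ W'') (j' : W' ⟶ extendOpen i V)
      (j'' : W'' ⟶ extendOpen i V) (b' : Γ(X, W')) (b'' : Γ(X, W''))
      (hb' : i.app W' b' = Z.presheaf.map (homOfLE ((le_extendOpen i).1 j'.le)).op a)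
      (hb'' : i.app W'' b'' = Z.presheaf.map (homOfLE ((le_extendOpen i).1 j''.le)).op a) :
      M.presheaf.map f.op (b' • M.presheaf.map j'.op m) =
        M.presheaf.map g.op (b'' • M.presheaf.map j''.op m) := by
    rw [map_smul, map_smul, map_map, map_map, Subsingleton.elim (g ≫ j'') (f ≫ j'), ← sub_eq_zero,
      ← sub_smul]
    apply hM
    have e {W' : X.Opens} (f : U' ⟶ W') (j' : W' ⟶ extendOpen i V) (b' : Γ(X, W'))
        (hb' : i.app W' b' = Z.presheaf.map (homOfLE ((le_extendOpen i).1 j'.le)).op a) :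
        i.app U' (X.presheaf.map f.op b') =
          Z.presheaf.map (homOfLE ((le_extendOpen i).1 (f ≫ j').le)).op a := by
      have := ConcreteCategory.congr_hom (i.naturality f.op) b'
      refine this.trans ((congrArg _ hb').trans ?_)
      exact (ConcreteCategory.congr_hom (Z.presheaf.map_comp _ _) a).symm
    rw [map_sub, e f j' b' hb', e g j'' b'' hb'', sub_self]
  obtain ⟨t, ht⟩ := exists_glue (M := M) W j (fun x hx => TopologicalSpace.Opens.mem_iSup.2 ⟨⟨x, hx⟩, hxW _⟩)
    (fun x => b x • M.presheaf.map (j x).op m) (fun x y U' f g => key f g _ _ _ _ (hb x) (hb y))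
  refine ⟨t, fun W' j' b' hb' => section_ext fun x hx => ?_, fun t' ht' => section_ext fun x hx => ?_⟩
  · let x' : extendOpen i V := ⟨x, j'.le hx⟩
    let U' := W x' ⊓ W'
    refine ⟨U', homOfLE inf_le_right, ⟨hxW x', hx⟩, ?_⟩
    rw [← key (homOfLE (inf_le_left : U' ≤ W x')) (homOfLE inf_le_right) (j x') j' _ _ (hb x') hb',
      ← ht, map_map, map_map]
    rfl
  · exact ⟨W ⟨x, hx⟩, j _, hxW _, (ht' _ _ _ (hb _)).trans (ht _).symm⟩

/-- The action of functions on `Z` on a module killed by the ideal of `Z`. -/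
noncomputable def IsKilledBy.act {V : Z.Opens} (a : Γ(Z, V)) (m : Γ(M, extendOpen i V)) :
    Γ(M, extendOpen i V) := (hM.existsUnique_smul a m).choose

theorem IsKilledBy.map_act {V : Z.Opens} (a : Γ(Z, V)) (m : Γ(M, extendOpen i V)) {W : X.Opens}
    (j : W ⟶ extendOpen i V) (b : Γ(X, W))
    (h : i.app W b = Z.presheaf.map (homOfLE ((le_extendOpen i).1 j.le)).op a) :
    M.presheaf.map j.op (hM.act a m) = b • M.presheaf.map j.op m :=
  (hM.existsUnique_smul a m).choose_spec.1 W j b h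

theorem IsKilledBy.eq_act {V : Z.Opens} (a : Γ(Z, V)) (m t : Γ(M, extendOpen i V))
    (h : ∀ (W : X.Opens) (j : W ⟶ extendOpen i V) (b : Γ(X, W)),
      i.app W b = Z.presheaf.map (homOfLE ((le_extendOpen i).1 j.le)).op a →
        M.presheaf.map j.op t = b • M.presheaf.map j.op m) : hM.act a m = t :=
  ((hM.existsUnique_smul a m).choose_spec.2 t h).symm

omit hM in
-- Locally two functions on `Z` can be lifted at the same time; this serves the module axioms that
-- involve two scalars.
theorem act_ext {V : Z.Opens} (s t : Γ(M, extendOpen i V)) (a a' : Γ(Z, V))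
    (h : ∀ (W : X.Opens) (j : W ⟶ extendOpen i V) (b b' : Γ(X, W)),
      i.app W b = Z.presheaf.map (homOfLE ((le_extendOpen i).1 j.le)).op a →
      i.app W b' = Z.presheaf.map (homOfLE ((le_extendOpen i).1 j.le)).op a' →
        M.presheaf.map j.op s = M.presheaf.map j.op t) : s = t := by
  refine section_ext fun x hx => ?_
  obtain ⟨W, j, b, hxW, hb⟩ := exists_local_lift i a ((le_extendOpen i).1 le_rfl) hx
  obtain ⟨W', j', b', hxW', hb'⟩ := exists_local_lift i a' ((le_extendOpen i).1 (j.le)) hxW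
  refine ⟨W', j' ≫ j, hxW', h W' (j' ≫ j) (X.presheaf.map j'.op b) b' ?_ hb'⟩
  refine (ConcreteCategory.congr_hom (i.naturality j'.op) b).trans ((congrArg _ hb).trans ?_)
  exact (ConcreteCategory.congr_hom (Z.presheaf.map_comp _ _) a).symm

/-- Sections of a module killed by the ideal of `Z` as a module over the functions of `Z`. -/
noncomputable abbrev IsKilledBy.module (V : Z.Opens) : Module Γ(Z, V) Γ(M, extendOpen i V) where
  smul a m := hM.act a m
  one_smul m := hM.eq_act _ _ _ fun W j b hb => by
    have e : i.app W b = i.app W 1 := by rw [hb, map_one, map_one]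
    rw [← sub_eq_zero]
    nth_rw 1 [← one_smul Γ(X, W) (M.presheaf.map j.op m)]
    rw [← sub_smul]
    exact hM _ _ _ (by rw [map_sub, e, sub_self])
  mul_smul a a' m := act_ext _ _ a a' fun W j b b' hb hb' => by
    refine (hM.map_act (a * a') m j (b * b') (by rw [map_mul, hb, hb', map_mul])).trans ?_
    refine Eq.trans ?_ (hM.map_act a (hM.act a' m) j b hb).symm
    rw [hM.map_act a' m j b' hb', mul_smul]
  smul_zero a := hM.eq_act _ _ _ fun W j b hb => by rw [map_zero, smul_zero]
  smul_add a m m' := hM.eq_act _ _ _ fun W j b hb => by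
    rw [map_add, map_add, smul_add]
    exact congrArg₂ (· + ·) (hM.map_act a m j b hb) (hM.map_act a m' j b hb)
  add_smul a a' m := act_ext _ _ a a' fun W j b b' hb hb' => by
    refine (hM.map_act (a + a') m j (b + b') (by rw [map_add, hb, hb', map_add])).trans ?_
    rw [add_smul, map_add]
    exact congrArg₂ (· + ·) (hM.map_act a m j b hb).symm (hM.map_act a' m j b' hb').symm
  zero_smul m := hM.eq_act _ _ _ fun W j b hb => by
    rw [map_zero]
    exact (hM _ _ _ (by rw [hb, map_zero])).symm

variable (M) in
omit hM in
/-- The presheaf underlying the restriction to `Z` of a module killed by its ideal. -/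
noncomputable def descendPresheaf (i : Z ⟶ X) [IsClosedImmersion i] : TopCat.Presheaf AddCommGrpCat.{u} Z :=
  (show Monotone (extendOpen i) from fun _ _ h => extendOpen_mono i h).functor.op ⋙ M.presheaf

/-- The union of the opens `extendOpen i (V a)` can be smaller than `extendOpen i (iSup V)`, but
both have the same trace on `Z`, hence the same sections by `map_bijective`. Gluing then takes place
on `X`. -/
theorem IsKilledBy.isSheaf_descendPresheaf : (descendPresheaf M i).IsSheaf := by
  rw [TopCat.Presheaf.isSheaf_iff_isSheafUniqueGluing]
  intro ι V s hs
  let U := ⨆ a, extendOpen i (V a)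
  have hU : U ≤ extendOpen i (iSup V) := iSup_le fun a => extendOpen_mono i (le_iSup V a)
  have hU' : i ⁻¹ᵁ extendOpen i (iSup V) ≤ i ⁻¹ᵁ U := by
    rw [preimage_extendOpen]
    refine iSup_le fun a => ?_
    exact (preimage_extendOpen i (V a)).ge.trans (i.preimage_mono (le_iSup (fun a => extendOpen i (V a)) a))
  have hb := hM.map_bijective (homOfLE hU) hU'
  obtain ⟨t, ht⟩ := exists_glue (M := M) (fun a => extendOpen i (V a))
    (fun a => homOfLE (le_iSup (fun a => extendOpen i (V a)) a)) le_rfl s (by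
      intro a b W f g
      have h := congrArg (M.presheaf.map (homOfLE (show W ≤ extendOpen i (V a ⊓ V b) from
        (le_extendOpen i).2 (le_inf ((le_extendOpen i).1 f.le) ((le_extendOpen i).1 g.le)))).op) (hs a b)
      exact (map_map M _ (homOfLE (extendOpen_mono i inf_le_left)) (s a)).symm.trans (h.trans
        (map_map M _ (homOfLE (extendOpen_mono i inf_le_right)) (s b))))
  obtain ⟨t, rfl⟩ := hb.2 t
  refine ⟨t, fun a => ?_, fun t' ht' => hb.1 (section_ext fun x hx => ?_)⟩
  · exact (map_map M (homOfLE (le_iSup (fun a => extendOpen i (V a)) a)) (homOfLE hU) t).symm.trans (ht a)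
  · obtain ⟨a, ha⟩ := TopologicalSpace.Opens.mem_iSup.1 hx
    refine ⟨_, homOfLE (le_iSup (fun a => extendOpen i (V a)) a), ha, ?_⟩
    refine Eq.trans ?_ (ht a).symm
    exact (map_map M (homOfLE (le_iSup (fun a => extendOpen i (V a)) a)) (homOfLE hU) t').trans (ht' a)

/-- A module killed by the ideal of `Z` as a module on `Z`. -/
noncomputable def IsKilledBy.descend : Z.Modules :=
  letI (V : Z.Opensᵒᵖ) : Module (Z.ringCatSheaf.obj.obj V) ((descendPresheaf M i).obj V) :=
    hM.module V.unop
  { val := PresheafOfModules.ofPresheaf (R := Z.ringCatSheaf.obj) (descendPresheaf M i) (by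
      intro V V' f a m
      refine (hM.eq_act _ _ _ fun W j b hb => ?_).symm
      refine (map_map M j (homOfLE (extendOpen_mono i f.unop.le)) _).trans ?_
      refine (hM.map_act _ _ (j ≫ homOfLE (extendOpen_mono i f.unop.le)) b ?_).trans ?_
      · refine hb.trans ?_
        exact (ConcreteCategory.congr_hom (Z.presheaf.map_comp _ _) a).symm
      · exact congrArg (b • ·) (map_map M j (homOfLE (extendOpen_mono i f.unop.le)) _).symm)
    isSheaf := hM.isSheaf_descendPresheaf }

/-- The isomorphism restricts sections from `extendOpen i (i ⁻¹ᵁ U)` to `U`, two opens with the same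
trace on `Z`. -/
theorem IsKilledBy.nonempty_pushforward_descend_iso :
    Nonempty ((pushforward i).obj hM.descend ≅ M) := by
  let φ : ((pushforward i).obj hM.descend).presheaf ⟶ M.presheaf :=
    { app U := M.presheaf.map (homOfLE (le_extendOpen_preimage i U.unop)).op
      naturality U V f := by
        ext m
        exact (map_map M (homOfLE (le_extendOpen_preimage i V.unop))
          (homOfLE (extendOpen_mono i (i.preimage_mono f.unop.le))) m).trans
          (map_map M f.unop (homOfLE (le_extendOpen_preimage i U.unop)) m).symm }
  let ψ : (pushforward i).obj hM.descend ⟶ M := homMk φ fun U a m =>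
    hM.map_act (i.app U a) m (homOfLE (le_extendOpen_preimage i U)) a (by
      rw [Subsingleton.elim (homOfLE _) (𝟙 _), op_id, CategoryTheory.Functor.map_id]
      rfl)
  have : IsIso ψ := Hom.isIso_iff_isIso_app.2 fun U =>
    (ConcreteCategory.isIso_iff_bijective _).2
      (hM.map_bijective (homOfLE (le_extendOpen_preimage i U)) (by rw [preimage_extendOpen]))
  exact ⟨asIso ψ⟩

end
end
end AlgebraicGeometry.Scheme.Modules

/-! ### Coherent sheaves on a closed subscheme as coherent sheaves killed by its ideal -/

namespace AlgebraicGeometry.Scheme.Modules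

theorem isQCohOn_iff {X : Scheme.{u}} (M : X.Modules) (U : X.Opens) : M.IsQCohOn U ↔
    ∀ (f : Γ(X, U)) (W : X.Opens) (j : W ⟶ U), W = X.basicOpen f →
      (∀ t : Γ(M, W), ∃ (n : ℕ) (s : Γ(M, U)), M.presheaf.map j.op s =
        X.presheaf.map j.op f ^ n • t) ∧
      ∀ s : Γ(M, U), M.presheaf.map j.op s = 0 → ∃ n : ℕ, f ^ n • s = 0 := by
  constructor
  · rintro h f _ j rfl
    exact ⟨h.exists_eq_pow_smul f, h.exists_pow_smul_eq_zero f⟩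
  · exact fun h => ⟨fun f => (h f _ (homOfLE (X.basicOpen_le f)) rfl).1,
      fun f => (h f _ (homOfLE (X.basicOpen_le f)) rfl).2⟩

section
variable {X Z : Scheme.{u}} (i : Z ⟶ X) [IsClosedImmersion i]

omit [IsClosedImmersion i] in
theorem isKilledBy_pushforward (N : Z.Modules) : IsKilledBy i ((pushforward i).obj N) :=
  fun _ _ m h => (congrArg (fun b : Γ(Z, _) => b • (show Γ(N, _) from m)) h).trans (zero_smul _ (show Γ(N, _) from m))

/-- Over an affine `U` all functions on `i ⁻¹ᵁ U` lift to `U`, and preimages of basic opens are the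
basic opens of the restricted functions, so the two conditions coincide function by function. -/
theorem isQCohOn_pushforward_iff (N : Z.Modules) {U : X.Opens} (hU : IsAffineOpen U) :
    ((pushforward i).obj N).IsQCohOn U ↔ N.IsQCohOn (i ⁻¹ᵁ U) := by
  have hs := i.app_surjective U hU
  have nat {W : X.Opens} (j : W ⟶ U) (f : Γ(X, U)) : i.app W (X.presheaf.map j.op f) =
      Z.presheaf.map ((TopologicalSpace.Opens.map i.base).map j).op (i.app U f) :=
    ConcreteCategory.congr_hom (i.naturality j.op) f
  rw [isQCohOn_iff, isQCohOn_iff]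
  constructor
  · intro h f W j hW
    obtain ⟨f, rfl⟩ := hs f
    rw [← preimage_basicOpen] at hW
    subst hW
    obtain ⟨h₁, h₂⟩ := h f _ (homOfLE (X.basicOpen_le f)) rfl
    refine ⟨fun t => ?_, fun s hs => ?_⟩
    · obtain ⟨n, s, hs⟩ := h₁ t
      refine ⟨n, s, hs.trans ?_⟩
      refine congrArg (fun b : Γ(Z, i ⁻¹ᵁ X.basicOpen f) => b • (show Γ(N, i ⁻¹ᵁ X.basicOpen f) from t)) ?_
      refine (map_pow (i.app _).hom _ _).trans (congrArg (· ^ n) (nat _ f))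
    · obtain ⟨n, hn⟩ := h₂ s hs
      refine ⟨n, Eq.trans ?_ hn⟩
      exact congrArg (fun b : Γ(Z, _) => b • (show Γ(N, _) from s)) (map_pow (i.app U).hom f n).symm
  · rintro h f _ j rfl
    obtain ⟨h₁, h₂⟩ := h (i.app U f) _ ((TopologicalSpace.Opens.map i.base).map j) (preimage_basicOpen i f)
    refine ⟨fun t => ?_, fun s hs => ?_⟩
    · obtain ⟨n, s, hs⟩ := h₁ t
      refine ⟨n, s, hs.trans ?_⟩
      refine congrArg (fun b : Γ(Z, i ⁻¹ᵁ X.basicOpen f) => b • (show Γ(N, i ⁻¹ᵁ X.basicOpen f) from t)) ?_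
      exact ((map_pow (i.app _).hom _ _).trans (congrArg (· ^ n) (nat _ f))).symm
    · obtain ⟨n, hn⟩ := h₂ s hs
      refine ⟨n, Eq.trans ?_ hn⟩
      exact congrArg (fun b : Γ(Z, _) => b • (show Γ(N, _) from s)) (map_pow (i.app U).hom f n)

theorem finite_pushforward_iff (N : Z.Modules) {U : X.Opens} (hU : IsAffineOpen U) :
    Module.Finite Γ(X, U) Γ((pushforward i).obj N, U) ↔ Module.Finite Γ(Z, i ⁻¹ᵁ U) Γ(N, i ⁻¹ᵁ U) := by
  have hs := i.app_surjective U hU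
  let σ : Γ(X, U) →+* Γ(Z, i ⁻¹ᵁ U) := (i.app U).hom
  have : RingHomSurjective σ := ⟨hs⟩
  let e : Γ((pushforward i).obj N, U) →ₛₗ[σ] Γ(N, i ⁻¹ᵁ U) :=
    { toFun := fun m => m
      map_add' := fun _ _ => rfl
      map_smul' := fun _ _ => rfl }
  constructor
  · intro h
    exact Module.Finite.of_surjective e (fun m => ⟨m, rfl⟩)
  · rintro ⟨S, hS⟩
    refine ⟨S, ?_⟩
    rw [eq_top_iff]
    rintro (m : Γ(N, i ⁻¹ᵁ U)) -
    have hm : (m : Γ(N, i ⁻¹ᵁ U)) ∈ Submodule.span Γ(Z, i ⁻¹ᵁ U) (S : Set Γ(N, i ⁻¹ᵁ U)) := hS ▸ trivial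
    induction hm using Submodule.span_induction with
    | mem y hy => exact Submodule.subset_span hy
    | zero => exact Submodule.zero_mem _
    | add y z _ _ h₁ h₂ => exact Submodule.add_mem _ h₁ h₂
    | smul a y _ h =>
      obtain ⟨a, rfl⟩ := hs a
      exact Submodule.smul_mem _ a h

theorem coherent_pushforward_iff (N : Z.Modules) :
    coherent X ((pushforward i).obj N) ↔ coherent Z N := by
  constructor
  · intro h
    refine coherent_of_forall fun z => ?_
    obtain ⟨U, hzU, hU, -⟩ := exists_affine (i z) ⊤ trivial
    exact ⟨i ⁻¹ᵁ U, hzU, hU.preimage i, (isQCohOn_pushforward_iff i N hU).1 (h.isQCohOn hU),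
      (finite_pushforward_iff i N hU).1 (h.finite hU)⟩
  · exact fun h => coherent_of_forall_isAffineOpen fun U hU =>
      ⟨(isQCohOn_pushforward_iff i N hU).2 (h.isQCohOn (hU.preimage i)),
        (finite_pushforward_iff i N hU).2 (h.finite (hU.preimage i))⟩

/-- Coherent modules killed by the ideal of `Z`. -/
def cohKilledBy : ObjectProperty X.Modules := fun M => coherent X M ∧ IsKilledBy i M

/-- Pushforward of coherent modules along a closed immersion. -/
noncomputable def pushforwardCoh : Coh Z ⥤ (cohKilledBy i).FullSubcategory :=
  (cohKilledBy i).lift ((coherent Z).ι ⋙ pushforward i) fun N =>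
    ⟨(coherent_pushforward_iff i N.obj).2 N.property, isKilledBy_pushforward i N.obj⟩

instance : (pushforwardCoh i).Faithful where
  map_injective h := (coherent Z).ι.map_injective
    ((pushforward i).map_injective (congrArg (cohKilledBy i).ι.map h))

instance : (pushforwardCoh i).Full where
  map_surjective f := by
    obtain ⟨g, hg⟩ := (pushforward i).map_surjective ((cohKilledBy i).ι.map f)
    exact ⟨⟨g⟩, (cohKilledBy i).ι.map_injective hg⟩

instance : (pushforwardCoh i).EssSurj where
  mem_essImage M := by
    obtain ⟨e⟩ := M.property.2.nonempty_pushforward_descend_iso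
    refine ⟨⟨M.property.2.descend, ?_⟩, ⟨(cohKilledBy i).isoMk e⟩⟩
    exact (coherent_pushforward_iff i _).1 ((coherent X).prop_of_iso e.symm M.property.1)

instance : (pushforwardCoh i).IsEquivalence where

end
end AlgebraicGeometry.Scheme.Modules

/-! ### The dual of a line bundle and the ideal of the zero scheme -/

namespace AlgebraicGeometry.Scheme.Modules

section
variable {X : Scheme.{u}} (L : X.Modules)

/-- Compatible families of linear forms on the sections of `L` over the open subsets of `U`. -/
def dualSections (U : X.Opens) :
    AddSubgroup (∀ V : {V : X.Opens // V ≤ U}, Γ(L, V.1) →ₗ[Γ(X, V.1)] Γ(X, V.1)) where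
  carrier := {h | ∀ (V W : {V : X.Opens // V ≤ U}) (i : W.1 ⟶ V.1) (l : Γ(L, V.1)),
    h W (L.presheaf.map i.op l) = X.presheaf.map i.op (h V l)}
  add_mem' h h' V W i l := by
    rw [Pi.add_apply, Pi.add_apply, LinearMap.add_apply, LinearMap.add_apply, h, h', map_add]
  zero_mem' V W i l := by
    rw [Pi.zero_apply, Pi.zero_apply, LinearMap.zero_apply, LinearMap.zero_apply, map_zero]
  neg_mem' h V W i l := by
    rw [Pi.neg_apply, Pi.neg_apply, LinearMap.neg_apply, LinearMap.neg_apply, h, map_neg]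

variable {L} {U : X.Opens}

theorem dualSections_map (h : dualSections L U) {V W : X.Opens} (hV : V ≤ U) (i : W ⟶ V)
    (l : Γ(L, V)) : h.1 ⟨W, i.le.trans hV⟩ (L.presheaf.map i.op l) =
      X.presheaf.map i.op (h.1 ⟨V, hV⟩ l) := h.2 ⟨V, hV⟩ ⟨W, i.le.trans hV⟩ i l

theorem dualSections_ext {h h' : dualSections L U}
    (H : ∀ (V : X.Opens) (hV : V ≤ U) (l : Γ(L, V)), h.1 ⟨V, hV⟩ l = h'.1 ⟨V, hV⟩ l) : h = h' :=
  Subtype.ext (funext fun V => LinearMap.ext fun l => H V.1 V.2 l)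

theorem function_ext {a b : Γ(X, U)} (h : ∀ x ∈ U, ∃ (V : X.Opens) (i : V ⟶ U), x ∈ V ∧
    X.presheaf.map i.op a = X.presheaf.map i.op b) : a = b :=
  section_ext (M := structureSheaf X) h

theorem presheaf_map_map {V W : X.Opens} (i : U ⟶ V) (j : V ⟶ W) (s : Γ(X, W)) :
    X.presheaf.map i.op (X.presheaf.map j.op s) = X.presheaf.map (i ≫ j).op s :=
  map_map (structureSheaf X) i j s

variable (L) in
/-- The presheaf of linear forms on `L`. -/
noncomputable def dualPresheaf : TopCat.Presheaf AddCommGrpCat.{u} X where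
  obj U := AddCommGrpCat.of (dualSections L U.unop)
  map i := AddCommGrpCat.ofHom
    { toFun := fun h => ⟨fun W => h.1 ⟨W.1, W.2.trans i.unop.le⟩, fun V W j l =>
        h.2 ⟨V.1, V.2.trans i.unop.le⟩ ⟨W.1, W.2.trans i.unop.le⟩ j l⟩
      map_zero' := rfl
      map_add' := fun _ _ => rfl }
  map_id _ := rfl
  map_comp _ _ := rfl

/-- The value of the glued form at a section `l` is glued from the values of the given forms at the
restrictions of `l`; additivity and linearity are then checked locally. -/
theorem isSheaf_dualPresheaf : (dualPresheaf L).IsSheaf := by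
  rw [TopCat.Presheaf.isSheaf_iff_isSheafUniqueGluing]
  intro ι V s hs
  change ∀ a, dualSections L (V a) at s
  have hs' (a b) (W : X.Opens) (ha : W ≤ V a) (hb : W ≤ V b) (l : Γ(L, W)) :
      (s a).1 ⟨W, ha⟩ l = (s b).1 ⟨W, hb⟩ l :=
    LinearMap.congr_fun (congrFun (congrArg Subtype.val (hs a b)) ⟨W, le_inf ha hb⟩) l
  have uniq {W : X.Opens} (hW : W ≤ iSup V) (l : Γ(L, W)) (t t' : Γ(X, W))
      (h : ∀ a (W' : X.Opens) (i : W' ⟶ W) (_ : W' ≤ V a),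
        X.presheaf.map i.op t = X.presheaf.map i.op t') : t = t' :=
    function_ext fun x hx => by
      obtain ⟨a, ha⟩ := TopologicalSpace.Opens.mem_iSup.1 (hW hx)
      exact ⟨W ⊓ V a, homOfLE inf_le_left, ⟨hx, ha⟩, h a _ _ inf_le_right⟩
  have ex {W : X.Opens} (hW : W ≤ iSup V) (l : Γ(L, W)) : ∃ t : Γ(X, W),
      ∀ a (W' : X.Opens) (i : W' ⟶ W) (h : W' ≤ V a),
        X.presheaf.map i.op t = (s a).1 ⟨W', h⟩ (L.presheaf.map i.op l) := by
    obtain ⟨t, ht⟩ := exists_glue (M := structureSheaf X) (fun a => W ⊓ V a)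
      (fun a => homOfLE inf_le_left) (fun x hx => by
        obtain ⟨a, ha⟩ := TopologicalSpace.Opens.mem_iSup.1 (hW hx)
        exact TopologicalSpace.Opens.mem_iSup.2 ⟨a, hx, ha⟩)
      (fun a => (s a).1 ⟨W ⊓ V a, inf_le_right⟩ (L.presheaf.map (homOfLE inf_le_left).op l)) (by
        intro a b W' f g
        refine (dualSections_map (s a) inf_le_right f _).symm.trans
          (Eq.trans ?_ (dualSections_map (s b) inf_le_right g _))
        rw [map_map, map_map]
        exact hs' _ _ _ _ _ _)
    refine ⟨t, fun a W' i h => ?_⟩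
    have h₁ := congrArg (X.presheaf.map (homOfLE (le_inf i.le h)).op) (ht a)
    refine (presheaf_map_map _ (homOfLE inf_le_left) t).symm.trans (h₁.trans ?_)
    refine (dualSections_map (s a) inf_le_right (homOfLE (le_inf i.le h)) _).symm.trans ?_
    rw [map_map]
    rfl
  choose t ht using @ex
  refine ⟨⟨fun W =>
    { toFun := t W.2
      map_add' := fun l l' => uniq W.2 l _ _ fun a W' i h => by
        rw [ht W.2 _ a W' i h, map_add, map_add, map_add, ht W.2 l a W' i h, ht W.2 l' a W' i h]
      map_smul' := fun b l => uniq W.2 l _ _ fun a W' i h => by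
        rw [ht W.2 _ a W' i h, map_smul, LinearMap.map_smul, RingHom.id_apply, smul_eq_mul, smul_eq_mul,
          map_mul, ht W.2 l a W' i h] }, fun W W' i l => uniq W'.2 (L.presheaf.map i.op l) _ _ fun a U i' h => ?_⟩,
    fun a => ?_, fun h' hh' => ?_⟩
  · refine (ht _ _ a U i' h).trans ?_
    rw [map_map, presheaf_map_map]
    exact (ht _ _ a U _ h).symm
  · refine dualSections_ext fun W hW l => ?_
    refine (map_self (structureSheaf X) (𝟙 W) _).symm.trans ((ht _ _ a W (𝟙 W) hW).trans ?_)
    rw [map_self]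
  · refine dualSections_ext fun W hW l => uniq hW l _ _ fun a W' i h => ?_
    refine Eq.trans ?_ (ht hW l a W' i h).symm
    rw [← hh' a]
    exact (dualSections_map h' hW i l).symm

variable (L) in
/-- The dual of a sheaf of modules. -/
noncomputable def dual : X.Modules :=
  letI (V : X.Opensᵒᵖ) : Module (X.ringCatSheaf.obj.obj V) ((dualPresheaf L).obj V) :=
    show Module Γ(X, V.unop) (dualSections L V.unop) from
    { smul := fun a h => ⟨fun W => X.presheaf.map (homOfLE W.2).op a • h.1 W, fun W W' i l => by
        rw [LinearMap.smul_apply, LinearMap.smul_apply, h.2, smul_eq_mul, smul_eq_mul, map_mul,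
          presheaf_map_map]
        rfl⟩
      one_smul := fun h => dualSections_ext fun W hW l => by
        change X.presheaf.map _ 1 * h.1 ⟨W, hW⟩ l = _
        rw [map_one, one_mul]
      mul_smul := fun a b h => dualSections_ext fun W hW l => by
        change X.presheaf.map _ (a * b) * h.1 ⟨W, hW⟩ l = X.presheaf.map _ a * (X.presheaf.map _ b * h.1 ⟨W, hW⟩ l)
        rw [map_mul, mul_assoc]
      smul_zero := fun a => dualSections_ext fun W hW l => mul_zero _
      smul_add := fun a h h' => dualSections_ext fun W hW l => mul_add _ _ _
      add_smul := fun a b h => dualSections_ext fun W hW l => by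
        change X.presheaf.map _ (a + b) * h.1 ⟨W, hW⟩ l = X.presheaf.map _ a * h.1 ⟨W, hW⟩ l + X.presheaf.map _ b * h.1 ⟨W, hW⟩ l
        rw [map_add, add_mul]
      zero_smul := fun h => dualSections_ext fun W hW l => by
        change X.presheaf.map _ 0 * h.1 ⟨W, hW⟩ l = 0
        rw [map_zero, zero_mul] }
  { val := PresheafOfModules.ofPresheaf (R := X.ringCatSheaf.obj) (dualPresheaf L) (by
      intro V V' f a h
      refine dualSections_ext fun W hW l => ?_
      refine congrArg (fun b : Γ(X, W) => b * h.1 ⟨W, hW.trans f.unop.le⟩ l) ?_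
      exact (presheaf_map_map (homOfLE hW) f.unop a).symm)
    isSheaf := isSheaf_dualPresheaf }

/-- The value of a linear form at a section. -/
noncomputable def dualEval (h : Γ(dual L, U)) {V : X.Opens} (hV : V ≤ U) : Γ(L, V) →ₗ[Γ(X, V)] Γ(X, V) :=
  (show dualSections L U from h).1 ⟨V, hV⟩

theorem dualEval_smul (a : Γ(X, U)) (h : Γ(dual L, U)) {V : X.Opens} (i : V ⟶ U) (l : Γ(L, V)) :
    dualEval (a • h) i.le l = X.presheaf.map i.op a * dualEval h i.le l := rfl

theorem dualEval_map (h : Γ(dual L, U)) {V W : X.Opens} (hV : V ≤ U) (i : W ⟶ V) (l : Γ(L, V)) :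
    dualEval h (i.le.trans hV) (L.presheaf.map i.op l) = X.presheaf.map i.op (dualEval h hV l) :=
  dualSections_map h hV i l

theorem dualEval_ext {h h' : Γ(dual L, U)} (H : ∀ (V : X.Opens) (hV : V ≤ U) (l : Γ(L, V)),
    dualEval h hV l = dualEval h' hV l) : h = h' := dualSections_ext H

theorem exists_dualEval_eq (h : ∀ V : X.Opens, V ≤ U → (Γ(L, V) →ₗ[Γ(X, V)] Γ(X, V)))
    (hh : ∀ (V W : X.Opens) (hV : V ≤ U) (i : W ⟶ V) (l : Γ(L, V)),
      h W (i.le.trans hV) (L.presheaf.map i.op l) = X.presheaf.map i.op (h V hV l)) :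
    ∃ h' : Γ(dual L, U), ∀ (V : X.Opens) (hV : V ≤ U), dualEval h' hV = h V hV :=
  ⟨(⟨fun V => h V.1 V.2, fun V W i l => hh V.1 W.1 V.2 i l⟩ : dualSections L U), fun _ _ => rfl⟩

end
end AlgebraicGeometry.Scheme.Modules

namespace AlgebraicGeometry.Scheme.Modules

section
variable {X : Scheme.{u}} (D : LineBundleWithSection X) {U : X.Opens}

/-- The section of a line bundle over an open subset. -/
noncomputable def sectionOn (U : X.Opens) : Γ(D.L, U) := D.s.app U (oneSection X U)

theorem map_sectionOn {V : X.Opens} (i : V ⟶ U) : D.L.presheaf.map i.op (sectionOn D U) = sectionOn D V := by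
  refine (app_map D.s i (oneSection X U)).symm.trans (congrArg (D.s.app V) ?_)
  exact map_one (X.presheaf.map i.op).hom

theorem evalSection_eq (φ : D.L.restrict U.ι ⟶ structureSheaf U.toScheme) :
    D.evalSection U φ = U.topIso.hom (sectionToFunction U.toScheme ⊤ (φ.app ⊤ (sectionOn D (U.ι ''ᵁ ⊤)))) := by
  have h : ((restrictStructureSheaf X U).inv.app ⊤ (oneSection U.toScheme ⊤)) =
      (show Γ((structureSheaf X).restrict U.ι, ⊤) from oneSection X (U.ι ''ᵁ ⊤)) :=
    map_one (U.ι.appIso ⊤).inv.hom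
  exact congrArg (fun t => U.topIso.hom (sectionToFunction U.toScheme ⊤ (φ.app ⊤ (D.s.app (U.ι ''ᵁ ⊤) t)))) h

theorem exists_evalSection_eq (h : Γ(dual D.L, U)) :
    ∃ φ, D.evalSection U φ = dualEval h le_rfl (sectionOn D U) := by
  have hle (W : U.toScheme.Opens) : U.ι ''ᵁ W ≤ U := U.ι_image_le W
  let φ : (D.L.restrict U.ι).presheaf ⟶ (structureSheaf U.toScheme).presheaf :=
    { app := fun W => AddCommGrpCat.ofHom (dualEval h (hle W.unop)).toAddMonoidHom
      naturality := fun W W' j => by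
        ext l
        exact dualEval_map h (hle W.unop) (U.ι.opensFunctor.map j.unop) l }
  refine ⟨homMk φ fun W a m => ?_, ?_⟩
  · rw [restrict_ι_smul]
    exact LinearMap.map_smul (dualEval h (hle W)) _ _
  · rw [evalSection_eq]
    refine (dualEval_map h (hle ⊤) (eqToHom U.ι_image_top.symm) (sectionOn D (U.ι ''ᵁ ⊤))).symm.trans ?_
    rw [map_sectionOn]

/-- Write `s = g l` locally with a generator `l`. Then `l ⊗ g m = s ⊗ m = 0` forces `g m = 0`, and
`φ(s) = g φ(l)`. -/
theorem evalSection_smul_eq_zero {M : X.Modules} (hM : D.mulSection M = 0)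
    (φ : D.L.restrict U.ι ⟶ structureSheaf U.toScheme) (m : Γ(M, U)) : D.evalSection U φ • m = 0 := by
  refine section_ext fun x hx => ?_
  obtain ⟨V, i, l, hxV, hl⟩ := exists_generator_le D x hx
  refine ⟨V, i, hxV, ?_⟩
  rw [map_smul, map_zero]
  obtain ⟨W, rfl⟩ := exists_eq_image U (V := V) (i.le.trans U.ι_image_top.ge)
  obtain ⟨g, hg⟩ := (hl (𝟙 _)).2 (sectionOn D (U.ι ''ᵁ W))
  dsimp only at hg
  rw [map_self] at hg
  have h₁ : X.presheaf.map i.op (D.evalSection U φ) =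
      sectionToFunction U.toScheme W (φ.app W (sectionOn D (U.ι ''ᵁ W))) := by
    rw [evalSection_eq]
    refine (presheaf_map_map i (eqToHom U.ι_image_top.symm) _).trans ?_
    refine (app_map φ (homOfLE le_top : W ⟶ ⊤) (sectionOn D (U.ι ''ᵁ ⊤))).symm.trans ?_
    refine congrArg (φ.app W) ?_
    exact map_sectionOn D (U.ι.opensFunctor.map (homOfLE le_top : W ⟶ ⊤))
  have h₂ : X.presheaf.map i.op (D.evalSection U φ) = g *
      (show Γ(X, U.ι ''ᵁ W) from sectionToFunction U.toScheme W (φ.app W l)) := by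
    rw [h₁, ← hg]
    have := restrict_ι_smul D.L U W g l
    refine (congrArg (φ.app W) this.symm).trans (Hom.app_smul φ _ _)
  have h₃ : g • M.presheaf.map i.op m = 0 := by
    refine hl.tmul_injective (Eq.trans ?_ (tmul_zero l).symm)
    have h := ConcreteCategory.congr_hom (congrArg (fun f => Hom.app f (U.ι ''ᵁ W)) hM) (M.presheaf.map i.op m)
    dsimp only at h
    rw [mulSection_app] at h
    refine Eq.trans ?_ h
    dsimp only
    rw [tmul_smul, ← smul_tmul, hg]
    rfl
  rw [h₂, mul_comm, mul_smul, h₃, smul_zero]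

theorem isQCohOn_structureSheaf (hU : IsAffineOpen U) : (structureSheaf X).IsQCohOn U := by
  refine ⟨fun f t => ?_, fun f s hs => ?_⟩
  · have := hU.isLocalization_basicOpen f
    obtain ⟨⟨a, ⟨_, n, rfl⟩⟩, h⟩ := IsLocalization.surj (.powers f) (show Γ(X, X.basicOpen f) from t)
    refine ⟨n, a, h.symm.trans ?_⟩
    rw [mul_comm, RingHom.map_pow]
    rfl
  · have := hU.isLocalization_basicOpen f
    obtain ⟨⟨_, n, rfl⟩, h⟩ := (IsLocalization.map_eq_zero_iff (.powers f) Γ(X, X.basicOpen f)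
      (show Γ(X, U) from s)).1 hs
    exact ⟨n, h⟩

/-- Evaluation of linear forms at a section. -/
noncomputable def dualEvalₗ {L : X.Modules} (l : Γ(L, U)) : Γ(dual L, U) →ₗ[Γ(X, U)] Γ(X, U) where
  toFun h := dualEval h le_rfl l
  map_add' _ _ := rfl
  map_smul' a h := (dualEval_smul a h (𝟙 U) l).trans (by
    rw [op_id, CategoryTheory.Functor.map_id]; rfl)

/-- A form is determined by its value on a generator, and that value is arbitrary: the coordinate
with respect to `l`, multiplied by a function, is a form. -/
theorem IsGenerator.dualEval_bijective {L : X.Modules} {l : Γ(L, U)} (hl : IsGenerator l) :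
    Function.Bijective (dualEvalₗ l) := by
  have hinj {V : X.Opens} (i : V ⟶ U) := (hl i).1
  choose c hc using fun {V : X.Opens} (i : V ⟶ U) => (hl i).2
  constructor
  · intro h h' hh
    refine dualEval_ext fun V hV t => ?_
    rw [← hc (homOfLE hV) t]
    dsimp only
    rw [LinearMap.map_smul, LinearMap.map_smul]
    refine congrArg (c (homOfLE hV) t • ·) ?_
    refine (dualEval_map h le_rfl (homOfLE hV) l).trans (Eq.trans ?_ (dualEval_map h' le_rfl (homOfLE hV) l).symm)
    exact congrArg _ hh
  · intro a
    obtain ⟨h, hh⟩ := exists_dualEval_eq (L := L) (U := U) (fun V hV =>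
      { toFun := fun t => c (homOfLE hV) t * X.presheaf.map (homOfLE hV).op a
        map_add' := fun t t' => by
          rw [← add_mul]
          exact congrArg (· * _) (hinj (homOfLE hV) (by dsimp only; rw [add_smul]; exact (hc _ _).trans (congrArg₂ _ (hc _ _).symm (hc _ _).symm)))
        map_smul' := fun b t => by
          rw [RingHom.id_apply, smul_eq_mul, ← mul_assoc]
          exact congrArg (· * _) (hinj (homOfLE hV) (by dsimp only; rw [mul_smul]; exact (hc _ _).trans (congrArg (b • ·) (hc _ _).symm))) })
      (fun V W hV i t => by
        have : c (homOfLE (i.le.trans hV)) (L.presheaf.map i.op t) = X.presheaf.map i.op (c (homOfLE hV) t) := by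
          refine hinj (homOfLE (i.le.trans hV)) ((hc _ _).trans ?_)
          refine (congrArg (L.presheaf.map i.op) (hc (homOfLE hV) t)).symm.trans ?_
          dsimp only
          rw [map_smul, map_map]
          rfl
        refine (congrArg (· * _) this).trans ?_
        refine Eq.trans ?_ (map_mul (X.presheaf.map i.op).hom _ _).symm
        refine congrArg (_ * ·) ?_
        exact (presheaf_map_map _ _ _).symm)
    refine ⟨h, (LinearMap.congr_fun (hh U le_rfl) l).trans ?_⟩
    have h1 : c (homOfLE le_rfl) l = 1 := hinj (homOfLE le_rfl) ((hc _ _).trans (by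
      dsimp only
      rw [one_smul, map_self]))
    refine (congrArg (· * _) h1).trans ((one_mul _).trans ?_)
    exact map_self (structureSheaf X) _ a

theorem coherent_dual : coherent X (dual D.L) := by
  refine coherent_of_forall fun x => ?_
  obtain ⟨V, l, hxV, hl⟩ := exists_generator D x
  obtain ⟨U, hxU, hU, hUV⟩ := exists_affine x V hxV
  have hl' (W : X.Opens) (hW : W ≤ U) := hl.map (homOfLE (hW.trans hUV))
  refine ⟨U, hxU, hU, isQCohOn_and_finite_of_bijective (isQCohOn_structureSheaf hU)
    (inferInstanceAs (Module.Finite Γ(X, U) Γ(X, U)))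
    (fun W hW => (LinearEquiv.ofBijective _ (hl' W hW).dualEval_bijective).symm.toLinearMap)
    (fun W hW => (LinearEquiv.ofBijective _ (hl' W hW).dualEval_bijective).symm.bijective)
    (fun W W' hW i m => ?_)⟩
  apply (hl' W' (i.le.trans hW)).dualEval_bijective.1
  refine Eq.trans ?_ (LinearEquiv.apply_symm_apply (LinearEquiv.ofBijective _ (hl' W' (i.le.trans hW)).dualEval_bijective) _).symm
  obtain ⟨h, rfl⟩ := (LinearEquiv.ofBijective _ (hl' W hW).dualEval_bijective).surjective m
  refine (congrArg (fun t => dualEvalₗ _ ((dual D.L).presheaf.map i.op t)) (LinearEquiv.symm_apply_apply _ h)).trans ?_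
  refine Eq.trans ?_ (dualEval_map h le_rfl i _)
  rw [map_map]
  rfl

/-- The image of the dual of a line bundle under evaluation at the section. -/
noncomputable def evalIdeal : X.IdealSheafData where
  ideal U := LinearMap.range (dualEvalₗ (sectionOn D U.1))
  map_ideal_basicOpen U f := by
    have hQ := (coherent_dual D).isQCohOn U.2
    have hu : IsUnit (X.presheaf.map (homOfLE (X.basicOpen_le f)).op f) :=
      RingedSpace.isUnit_res_basicOpen _ f
    have key (h : Γ(dual D.L, U.1)) : X.presheaf.map (homOfLE (X.basicOpen_le f)).op (dualEvalₗ (sectionOn D U.1) h) =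
        dualEvalₗ (sectionOn D (X.basicOpen f)) ((dual D.L).presheaf.map (homOfLE (X.basicOpen_le f)).op h) := by
      refine (dualEval_map h le_rfl _ _).symm.trans ?_
      rw [map_sectionOn]
      rfl
    apply le_antisymm
    · refine Ideal.map_le_iff_le_comap.2 ?_
      rintro _ ⟨h, rfl⟩
      exact ⟨_, (key h).symm⟩
    · rintro _ ⟨(h : Γ(dual D.L, X.basicOpen f)), rfl⟩
      -- By quasi-coherence of the dual, the form `h` extends to `U` after multiplication by a power
      -- of `f`, which is a unit over `D(f)`.
      obtain ⟨n, t, ht⟩ := hQ.exists_eq_pow_smul f h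
      have h₁ := key t
      rw [ht, LinearMap.map_smul, smul_eq_mul] at h₁
      refine (Ideal.unit_mul_mem_iff_mem _ (hu.pow n)).1 ?_
      exact h₁ ▸ Ideal.mem_map_of_mem (X.presheaf.map (homOfLE (X.basicOpen_le f)).op).hom ⟨t, rfl⟩

/-- `zeroIdeal` is the largest ideal sheaf inside the family of ideals spanned by the functions
`φ(s)`. The values of forms at `s` lie in that family and constitute an ideal sheaf, so they are not
lost in passing to `zeroIdeal`. -/
theorem evalIdeal_le_zeroIdeal : evalIdeal D ≤ D.zeroIdeal := by
  rw [LineBundleWithSection.zeroIdeal, IdealSheafData.le_ofIdeals_iff]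
  rintro U _ ⟨h, rfl⟩
  obtain ⟨φ, hφ⟩ := exists_evalSection_eq D h
  exact Ideal.subset_span ⟨φ, hφ⟩

end
end AlgebraicGeometry.Scheme.Modules

/-! ### Being killed by the ideal of a zero scheme means being killed by the section -/

namespace AlgebraicGeometry.Scheme.Modules

section
variable {X : Scheme.{u}} {U : X.Opens}

theorem isKilledBy_subschemeι_iff (I : X.IdealSheafData) (M : X.Modules) :
    IsKilledBy I.subschemeι M ↔
      ∀ (U : X.affineOpens) (a : Γ(X, U)) (m : Γ(M, U.1)), a ∈ I.ideal U → a • m = 0 := by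
  constructor
  · exact fun h U a m ha => h _ a m ((I.ker_subschemeι_app U).ge ha)
  · intro h U a m ha
    refine section_ext fun x hx => ?_
    obtain ⟨W, hxW, hW, hWU⟩ := exists_affine x U hx
    refine ⟨W, homOfLE hWU, hxW, ?_⟩
    rw [map_zero, map_smul]
    refine h ⟨W, hW⟩ _ _ ((I.ker_subschemeι_app ⟨W, hW⟩).le ?_)
    refine (ConcreteCategory.congr_hom (I.subschemeι.naturality (homOfLE hWU).op) a).trans ?_
    exact (congrArg _ ha).trans (map_zero (I.subscheme.presheaf.map _).hom)

theorem isKilledBy_iSup_iff {ι : Sort*} (I : ι → X.IdealSheafData) (M : X.Modules) :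
    IsKilledBy (⨆ a, I a).subschemeι M ↔ ∀ a, IsKilledBy (I a).subschemeι M := by
  simp_rw [isKilledBy_subschemeι_iff]
  constructor
  · exact fun h a U f m hf => h U f m (le_iSup I a U hf)
  · intro h U f m hf
    -- The index is moved into a type because the lemma is also applied to a supremum over proofs of
    -- `i ∈ T`.
    rw [← iSup_plift_down I, IdealSheafData.ideal_iSup, iSup_apply] at hf
    have : (⨆ a : PLift ι, (I a.down).ideal U) ≤ Ideal.comap (RingHom.id _) ((⊥ : Submodule Γ(X, U.1) Γ(M, U.1)).comap
        (LinearMap.toSpanSingleton _ _ m)) :=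
      iSup_le fun a f hf => h a.down U f m hf
    exact this hf

/-- Locally `s = g l` with a generator `l`, so multiplication by `s` sends `m` to `l ⊗ g m`. The
function `g` belongs to the ideal, and conversely the generators `φ(s)` of the ideals are locally
multiples of `g`. -/
theorem isKilledBy_zeroIdeal_iff (D : LineBundleWithSection X) (M : X.Modules) :
    IsKilledBy D.zeroIdeal.subschemeι M ↔ D.mulSection M = 0 := by
  rw [isKilledBy_subschemeι_iff]
  constructor
  · intro h
    refine hom_ext _ _ fun V => ?_
    ext m
    refine section_ext fun x hx => ?_
    obtain ⟨V', i, l, hxV', hl⟩ := exists_generator_le D x hx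
    obtain ⟨W, hxW, hW, hWV⟩ := exists_affine x V' hxV'
    replace hl := hl.map (homOfLE hWV)
    refine ⟨W, homOfLE (hWV.trans i.le), hxW, ?_⟩
    obtain ⟨g, hg⟩ := (hl (𝟙 _)).2 (sectionOn D W)
    dsimp only at hg
    rw [map_self] at hg
    -- `a` is the form dual to the generator `l`, so its value at `s = g l` is `g`.
    obtain ⟨a, ha⟩ := hl.dualEval_bijective.2 1
    have hgI : g ∈ D.zeroIdeal.ideal ⟨W, hW⟩ := evalIdeal_le_zeroIdeal D ⟨W, hW⟩ ⟨a, by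
      refine (congrArg (dualEval a le_rfl) hg.symm).trans ?_
      refine (LinearMap.map_smul (dualEval a le_rfl) g _).trans ?_
      exact (congrArg (g • ·) ha).trans (mul_one g)⟩
    refine (app_map (D.mulSection M) (homOfLE (hWV.trans i.le)) m).symm.trans ?_
    rw [mulSection_app]
    refine (congrArg (fun t => tmul t _) hg.symm).trans ?_
    rw [smul_tmul, ← tmul_smul, h ⟨W, hW⟩ g _ hgI, tmul_zero]
    exact (map_zero _).symm
  · intro h U a m ha
    have ha := IdealSheafData.ideal_ofIdeals_le _ U ha
    have : Ideal.span (Set.range (D.evalSection U.1)) ≤ (⊥ : Submodule Γ(X, U.1) Γ(M, U.1)).comap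
        (LinearMap.toSpanSingleton _ _ m) := by
      refine Ideal.span_le.2 ?_
      rintro _ ⟨φ, rfl⟩
      exact evalSection_smul_eq_zero D h φ m
    exact this ha

theorem isKilledBy_zeroLocusι_iff {n : ℕ} (D : Fin n → LineBundleWithSection X) (T : Finset (Fin n))
    (M : X.Modules) : IsKilledBy (ExtendablePair.zeroLocusι D T) M ↔ ∀ i ∈ T, (D i).mulSection M = 0 := by
  rw [ExtendablePair.zeroLocusι, isKilledBy_iSup_iff]
  refine forall_congr' fun i => ?_
  rw [isKilledBy_iSup_iff]
  exact forall_congr' fun _ => isKilledBy_zeroIdeal_iff (D i) M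

end
end AlgebraicGeometry.Scheme.Modules

/-! ### Abelian structures from exact functors, and products of categories -/

namespace CategoryTheory

/-- A preadditive category with kernels, cokernels and finite products is abelian if there is
a family of exact functors to abelian categories which jointly reflects isomorphisms. -/
@[reducible]
noncomputable def abelianOfExactFunctors {C : Type*} [Category* C] [Preadditive C]
    [HasFiniteProducts C] [HasKernels C] [HasCokernels C] {I : Type*} {A : I → Type*} [∀ i, Category* (A i)]
    [∀ i, Abelian (A i)] (F : ∀ i, C ⥤ A i) [∀ i, (F i).PreservesZeroMorphisms] [∀ i, PreservesFiniteLimits (F i)]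
    [∀ i, PreservesFiniteColimits (F i)]
    (hF : ∀ {X Y : C} (f : X ⟶ Y), (∀ i, IsIso ((F i).map f)) → IsIso f) : Abelian C :=
  have (X Y : C) (f : X ⟶ Y) : IsIso (Abelian.coimageImageComparison f) := hF _ fun i => by
    exact ((MorphismProperty.isomorphisms _).arrow_mk_iso_iff
      (Abelian.PreservesCoimageImageComparison.iso (F i) f)).2
      (inferInstanceAs (IsIso (Abelian.coimageImageComparison ((F i).map f))))
  Abelian.ofCoimageImageComparisonIsIso

namespace ObjectProperty

variable {C : Type*} [Category* C] [Abelian C] (P : ObjectProperty C) [P.ContainsZero]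
  [P.IsClosedUnderKernels] [P.IsClosedUnderCokernels] [P.IsClosedUnderFiniteProducts]

instance additive_ι {C : Type*} [Category* C] [Preadditive C] (P : ObjectProperty C) : P.ι.Additive where

theorem preservesFiniteLimits_ι : PreservesFiniteLimits P.ι := by
  have := P.preservesKernels_ι
  exact P.ι.preservesFiniteLimits_of_preservesKernels

theorem preservesFiniteColimits_ι : PreservesFiniteColimits P.ι := by
  have := P.preservesCokernels_ι
  exact P.ι.preservesFiniteColimits_of_preservesCokernels

end ObjectProperty

namespace Pi

section
variable {I : Type*} {C : I → Type*} [∀ i, Category* (C i)] {J : Type*} [Category* J]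

/-- A cone in a product category is a limit cone if its components are. -/
def isLimitOfEval {F : J ⥤ ∀ i, C i} {c : Cone F} (h : ∀ i, IsLimit ((Pi.eval C i).mapCone c)) :
    IsLimit c where
  lift s i := (h i).lift ((Pi.eval C i).mapCone s)
  fac s j := funext fun i => (h i).fac ((Pi.eval C i).mapCone s) j
  uniq s m w := funext fun i =>
    (h i).uniq ((Pi.eval C i).mapCone s) (m i) fun j => congrFun (w j) i

/-- A cocone in a product category is a colimit cocone if its components are. -/
def isColimitOfEval {F : J ⥤ ∀ i, C i} {c : Cocone F} (h : ∀ i, IsColimit ((Pi.eval C i).mapCocone c)) :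
    IsColimit c where
  desc s i := (h i).desc ((Pi.eval C i).mapCocone s)
  fac s j := funext fun i => (h i).fac ((Pi.eval C i).mapCocone s) j
  uniq s m w := funext fun i =>
    (h i).uniq ((Pi.eval C i).mapCocone s) (m i) fun j => congrFun (w j) i

section
variable (F : J ⥤ ∀ i, C i) [∀ i, HasLimit (F ⋙ Pi.eval C i)]

/-- The componentwise limit cone. -/
noncomputable def limitCone : Cone F where
  pt i := limit (F ⋙ Pi.eval C i)
  π :=
    { app := fun j i => limit.π (F ⋙ Pi.eval C i) j
      naturality := fun _ _ f => funext fun i => (limit.cone (F ⋙ Pi.eval C i)).π.naturality f }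

/-- The componentwise limit cone is a limit cone. -/
noncomputable def evalLimitConeIsLimit (i : I) : IsLimit ((Pi.eval C i).mapCone (limitCone F)) :=
  IsLimit.ofIsoLimit (limit.isLimit (F ⋙ Pi.eval C i)) (Cone.ext (Iso.refl _) fun _ => (Category.id_comp _).symm)

theorem hasLimit : HasLimit F := ⟨⟨⟨limitCone F, isLimitOfEval (evalLimitConeIsLimit F)⟩⟩⟩

theorem preservesLimit_eval (i : I) : PreservesLimit F (Pi.eval C i) :=
  preservesLimit_of_preserves_limit_cone (isLimitOfEval (evalLimitConeIsLimit F)) (evalLimitConeIsLimit F i)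
end

section
variable (F : J ⥤ ∀ i, C i) [∀ i, HasColimit (F ⋙ Pi.eval C i)]

/-- The componentwise colimit cocone. -/
noncomputable def colimitCocone : Cocone F where
  pt i := colimit (F ⋙ Pi.eval C i)
  ι :=
    { app := fun j i => colimit.ι (F ⋙ Pi.eval C i) j
      naturality := fun _ _ f => funext fun i => (colimit.cocone (F ⋙ Pi.eval C i)).ι.naturality f }

/-- The componentwise colimit cocone is a colimit cocone. -/
noncomputable def evalColimitCoconeIsColimit (i : I) : IsColimit ((Pi.eval C i).mapCocone (colimitCocone F)) :=
  IsColimit.ofIsoColimit (colimit.isColimit (F ⋙ Pi.eval C i)) (Cocone.ext (Iso.refl _) fun _ => Category.comp_id _)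

theorem hasColimit : HasColimit F := ⟨⟨⟨colimitCocone F, isColimitOfEval (evalColimitCoconeIsColimit F)⟩⟩⟩

theorem preservesColimit_eval (i : I) : PreservesColimit F (Pi.eval C i) :=
  preservesColimit_of_preserves_colimit_cocone (isColimitOfEval (evalColimitCoconeIsColimit F)) (evalColimitCoconeIsColimit F i)
end

theorem preservesFiniteLimits_pi' {D : Type*} [Category* D] (F : ∀ i, D ⥤ C i)
    [∀ i, PreservesFiniteLimits (F i)] : PreservesFiniteLimits (Functor.pi' F) where
  preservesFiniteLimits _ _ _ := ⟨⟨fun hc => ⟨isLimitOfEval fun i => isLimitOfPreserves (F i) hc⟩⟩⟩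

theorem preservesFiniteColimits_pi' {D : Type*} [Category* D] (F : ∀ i, D ⥤ C i)
    [∀ i, PreservesFiniteColimits (F i)] : PreservesFiniteColimits (Functor.pi' F) where
  preservesFiniteColimits _ _ _ := ⟨⟨fun hc => ⟨isColimitOfEval fun i => isColimitOfPreserves (F i) hc⟩⟩⟩

theorem isIso_of_eval {X Y : ∀ i, C i} (f : X ⟶ Y) (h : ∀ i, IsIso (f i)) : IsIso f :=
  ⟨fun i => inv (f i), funext fun _ => IsIso.hom_inv_id _, funext fun _ => IsIso.inv_hom_id _⟩

end

section
variable {I : Type*} {C : I → Type*} [∀ i, Category* (C i)]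

/-- The preadditive structure on a product of categories. -/
@[reducible]
def preadditive [∀ i, Preadditive (C i)] : Preadditive (∀ i, C i) where
  homGroup X Y := inferInstanceAs (AddCommGroup (∀ i, X i ⟶ Y i))
  add_comp _ _ _ _ _ _ := funext fun _ => Preadditive.add_comp _ _ _ _ _ _
  comp_add _ _ _ _ _ _ := funext fun _ => Preadditive.comp_add _ _ _ _ _ _

/-- A product of abelian categories is abelian. -/
@[reducible]
noncomputable def abelian [∀ i, Abelian (C i)] : Abelian (∀ i, C i) :=
  letI : Preadditive (∀ i, C i) := preadditive
  have : HasFiniteLimits (∀ i, C i) := ⟨fun _ _ _ => ⟨fun F => hasLimit F⟩⟩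
  have : HasFiniteColimits (∀ i, C i) := ⟨fun _ _ _ => ⟨fun F => hasColimit F⟩⟩
  have (i : I) : PreservesFiniteLimits (Pi.eval C i) := ⟨fun _ _ _ => ⟨fun {F} => preservesLimit_eval F i⟩⟩
  have (i : I) : PreservesFiniteColimits (Pi.eval C i) := ⟨fun _ _ _ => ⟨fun {F} => preservesColimit_eval F i⟩⟩
  have (i : I) : (Pi.eval C i).PreservesZeroMorphisms := ⟨fun _ _ => rfl⟩
  abelianOfExactFunctors (fun i => Pi.eval C i) fun f h => isIso_of_eval f h

end
end Pi
end CategoryTheory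

/-! ### Interchanging two tensor factors -/

namespace CategoryTheory.MonoidalCategory

section
variable {C : Type*} [Category* C] [MonoidalCategory C] [SymmetricCategory C]

/-- The symmetry `A ⊗ (B ⊗ M) ⟶ B ⊗ (A ⊗ M)`. -/
def swap (A B M : C) : A ⊗ (B ⊗ M) ⟶ B ⊗ (A ⊗ M) :=
  (α_ A B M).inv ≫ (β_ A B).hom ▷ M ≫ (α_ B A M).hom

theorem swap_naturality (A B : C) {M N : C} (f : M ⟶ N) :
    A ◁ B ◁ f ≫ swap A B N = swap A B M ≫ B ◁ A ◁ f := by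
  rw [swap, swap, associator_inv_naturality_right_assoc, whisker_exchange_assoc,
    associator_naturality_right, Category.assoc, Category.assoc]

@[simp]
theorem swap_swap (A B M : C) : swap A B M ≫ swap B A M = 𝟙 _ := by
  simp [swap, ← comp_whiskerRight_assoc]

/-- The Yang–Baxter relation for the braiding, whiskered by `M`. -/
theorem swap_yang_baxter (A B B' M : C) :
    A ◁ swap B B' M ≫ swap A B' (B ⊗ M) ≫ B' ◁ swap A B M =
      swap A B (B' ⊗ M) ≫ B ◁ swap A B' M ≫ swap B B' (A ⊗ M) := by
  have h := congrArg (· ▷ M) (BraidedCategory.yang_baxter' A B B')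
  calc
    _ = 𝟙 (A ⊗ B ⊗ B' ⊗ M) ⊗≫ (𝟙 ((A ⊗ B) ⊗ B') ⊗≫ (A ◁ (β_ B B').hom ⊗≫ (β_ A B').hom ▷ B ⊗≫ B' ◁ (β_ A B).hom) ⊗≫
        𝟙 ((B' ⊗ B) ⊗ A)) ▷ M ⊗≫ 𝟙 (B' ⊗ B ⊗ A ⊗ M) := by
      simp only [swap]
      monoidal
    _ = _ := by
      rw [← h]
      simp only [swap]
      monoidal

theorem swap_self (A M : C) (h : (β_ A A).hom = 𝟙 _) : swap A A M = 𝟙 _ := by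
  simp [swap, h]

/-- The braiding with the unit object is trivial, so by naturality multiplication by `s` passes
through the second factor. -/
theorem unit_whiskerRight_swap (A B M : C) (s : 𝟙_ C ⟶ A) :
    ((λ_ (B ⊗ M)).inv ≫ s ▷ (B ⊗ M)) ≫ swap A B M = B ◁ ((λ_ M).inv ≫ s ▷ M) := by
  have h := BraidedCategory.braiding_naturality_left s B
  rw [swap, Category.assoc, associator_inv_naturality_left_assoc, ← comp_whiskerRight_assoc, h]
  simp only [comp_whiskerRight, Category.assoc, whiskerLeft_comp, associator_naturality_middle]
  simp

end
end CategoryTheory.MonoidalCategory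

/-! ### Extendable pairs: additive structure, limits and colimits -/

namespace ExtendablePair

section
variable {X : Scheme.{u}} {ι : Type} {D : ι → LineBundleWithSection X} {r : ι → ℕ}
  {E E' E'' : ExtendablePair D r}

theorem whiskerLeft_add {L : LineBundleWithSection X} {M N : X.Modules} (f g : M ⟶ N) :
    L.L ◁ (f + g) = L.L ◁ f + L.L ◁ g := (tensorLeft L.L).map_add

theorem whiskerLeft_neg {L : LineBundleWithSection X} {M N : X.Modules} (f : M ⟶ N) :
    L.L ◁ (-f) = -L.L ◁ f := (tensorLeft L.L).map_neg

theorem whiskerLeft_zero {L : LineBundleWithSection X} {M N : X.Modules} :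
    L.L ◁ (0 : M ⟶ N) = 0 := (tensorLeft L.L).map_zero _ _

/-- The morphisms of diagrams which are compatible with the pseudo-period isomorphisms. -/
def homSubgroup (E E' : ExtendablePair D r) : AddSubgroup (E.F ⟶ E'.F) where
  carrier := {f | ∀ (i : ι) (α β : Box r) (h : IsTranslate i α β),
    (E.ρ i α β h).hom ≫ (D i).L ◁ f.app β = f.app α ≫ (E'.ρ i α β h).hom}
  add_mem' hf hg i α β h := by
    rw [NatTrans.app_add, NatTrans.app_add, whiskerLeft_add, Preadditive.comp_add, hf, hg,
      Preadditive.add_comp]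
  zero_mem' i α β h := by
    rw [NatTrans.app_zero, NatTrans.app_zero, whiskerLeft_zero, comp_zero, zero_comp]
  neg_mem' hf i α β h := by
    rw [NatTrans.app_neg, NatTrans.app_neg, whiskerLeft_neg, Preadditive.comp_neg, hf,
      Preadditive.neg_comp]

/-- Morphisms of extendable pairs as a group of morphisms of diagrams. -/
def homEquiv (E E' : ExtendablePair D r) : (E ⟶ E') ≃ homSubgroup E E' where
  toFun f := ⟨Hom.app f, Hom.comm f⟩
  invFun f := ⟨f.1, f.2⟩

noncomputable instance : Preadditive (ExtendablePair D r) where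
  homGroup E E' := (homEquiv E E').addCommGroup
  add_comp _ _ _ f f' g := Hom.ext (Preadditive.add_comp _ _ _ (Hom.app f) (Hom.app f') (Hom.app g))
  comp_add _ _ _ f g g' := Hom.ext (Preadditive.comp_add _ _ _ (Hom.app f) (Hom.app g) (Hom.app g'))

instance : (toDiagram D r).Additive where
  map_add := rfl

/-- The inverse of a natural isomorphism compatible with `ρ` is itself compatible with `ρ`. -/
instance : (toDiagram D r).ReflectsIsomorphisms where
  reflects {E E'} f hf := by
    have : IsIso (Hom.app f) := hf
    refine ⟨⟨inv (Hom.app f), fun i α β h => ?_⟩, Hom.ext (IsIso.hom_inv_id (Hom.app f)), Hom.ext (IsIso.inv_hom_id (Hom.app f))⟩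
    rw [NatIso.isIso_inv_app, NatIso.isIso_inv_app, IsIso.eq_inv_comp, ← Category.assoc, ← Hom.comm f,
      Category.assoc, ← MonoidalCategory.whiskerLeft_comp, IsIso.hom_inv_id,
      MonoidalCategory.whiskerLeft_id, Category.comp_id]

theorem whiskerLeft_comp_eq {L : LineBundleWithSection X} {M N N' P : X.Modules} {f : M ⟶ N} {g : N ⟶ P} {f' : M ⟶ N'}
    {g' : N' ⟶ P} (h : f ≫ g = f' ≫ g') : L.L ◁ f ≫ L.L ◁ g = L.L ◁ f' ≫ L.L ◁ g' := by
  rw [← MonoidalCategory.whiskerLeft_comp, h, MonoidalCategory.whiskerLeft_comp]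

/-- An extendable pair from a diagram with jointly monic morphisms to extendable pairs. -/
def ofJointlyMono {J : Type} (P : Box r ⥤ X.Modules) (hP : ∀ α, Scheme.Modules.coherent X (P.obj α))
    (E : J → ExtendablePair D r) (π : ∀ j, P ⟶ (E j).F)
    (ρ : ∀ (i : ι) (α β : Box r), IsTranslate i α β → (P.obj α ≅ (D i).L ⊗ P.obj β))
    (hρ : ∀ i α β h j, (ρ i α β h).hom ≫ (D i).L ◁ (π j).app β = (π j).app α ≫ ((E j).ρ i α β h).hom)
    -- EX1 and EX2 end in one twist and EX3 in two, so joint monicity is needed after tensoring once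
    -- and twice. In the dual construction all axioms start at an untwisted value and no tensoring
    -- intervenes.
    (h₁ : ∀ i α {M : X.Modules} (f g : M ⟶ (D i).L ⊗ P.obj α),
      (∀ j, f ≫ (D i).L ◁ (π j).app α = g ≫ (D i).L ◁ (π j).app α) → f = g)
    (h₂ : ∀ i i' α {M : X.Modules} (f g : M ⟶ (D i).L ⊗ (D i').L ⊗ P.obj α),
      (∀ j, f ≫ (D i).L ◁ (D i').L ◁ (π j).app α = g ≫ (D i).L ◁ (D i').L ◁ (π j).app α) → f = g) :
    ExtendablePair D r where
  F := P
  coherent := hP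
  ρ := ρ
  ex1 i β α γ h hβα hαγ := h₁ _ _ _ _ fun j => by
    have n₁ := (π j).naturality (homOfLE hβα)
    have n₂ := (π j).naturality (homOfLE hαγ)
    rw [Category.assoc, Category.assoc, whiskerLeft_comp_eq n₁, ← Category.assoc (ρ i γ β h).hom,
      hρ, ← Scheme.Modules.mulSection_naturality, Category.assoc, reassoc_of% n₂, (E j).ex1]
  ex2 i α β α' β' h h' hα hβ := h₁ _ _ _ _ fun j => by
    have n₁ := (π j).naturality (homOfLE hα)
    have n₂ := (π j).naturality (homOfLE hβ)
    rw [Category.assoc, hρ, Category.assoc, whiskerLeft_comp_eq n₂, ← Category.assoc (ρ i α β h).hom,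
      hρ, reassoc_of% n₁, Category.assoc, (E j).ex2 i α β α' β' h h' hα hβ]
  ex3 i j hij α β γ δ hαβ hαγ hβδ hγδ := h₂ _ _ _ _ _ fun l => by
    change _ = (_ ≫ _ ≫ swap (D j).L (D i).L _) ≫ _
    rw [Category.assoc, Category.assoc, Category.assoc, ← swap_naturality, whiskerLeft_comp_eq (hρ j β δ hβδ l),
      ← Category.assoc (ρ i α β hαβ).hom, hρ, Category.assoc,
      ← Category.assoc ((D j).L ◁ _) , whiskerLeft_comp_eq (hρ i γ δ hγδ l), Category.assoc,
      ← Category.assoc (ρ j α γ hαγ).hom, hρ, Category.assoc,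
      (E l).ex3 i j hij α β γ δ hαβ hαγ hβδ hγδ]
    rfl

/-- An extendable pair from a diagram with jointly epic morphisms from extendable pairs. -/
def ofJointlyEpi {J : Type} (P : Box r ⥤ X.Modules) (hP : ∀ α, Scheme.Modules.coherent X (P.obj α))
    (E : J → ExtendablePair D r) (π : ∀ j, (E j).F ⟶ P)
    (ρ : ∀ (i : ι) (α β : Box r), IsTranslate i α β → (P.obj α ≅ (D i).L ⊗ P.obj β))
    (hρ : ∀ i α β h j, (π j).app α ≫ (ρ i α β h).hom = ((E j).ρ i α β h).hom ≫ (D i).L ◁ (π j).app β)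
    (h₁ : ∀ α {M : X.Modules} (f g : P.obj α ⟶ M),
      (∀ j, (π j).app α ≫ f = (π j).app α ≫ g) → f = g) :
    ExtendablePair D r where
  F := P
  coherent := hP
  ρ := ρ
  ex1 i β α γ h hβα hαγ := h₁ _ _ _ fun j => by
    have n₁ := (π j).naturality (homOfLE hβα)
    have n₂ := (π j).naturality (homOfLE hαγ)
    rw [← reassoc_of% n₂, reassoc_of% (hρ i γ β h j), ← whiskerLeft_comp_eq n₁,
      Scheme.Modules.mulSection_naturality, ← (E j).ex1 i β α γ h hβα hαγ]
    simp only [Category.assoc]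
  ex2 i α β α' β' h h' hα hβ := h₁ _ _ _ fun j => by
    have n₁ := (π j).naturality (homOfLE hα)
    have n₂ := (π j).naturality (homOfLE hβ)
    rw [← reassoc_of% n₁, hρ, reassoc_of% (hρ i α β h j), ← whiskerLeft_comp_eq n₂,
      reassoc_of% ((E j).ex2 i α β α' β' h h' hα hβ)]
  ex3 i j hij α β γ δ hαβ hαγ hβδ hγδ := h₁ _ _ _ fun l => by
    change _ = _ ≫ (_ ≫ _ ≫ swap (D j).L (D i).L _)
    have h := (E l).ex3 i j hij α β γ δ hαβ hαγ hβδ hγδ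
    change _ = _ ≫ _ ≫ swap (D j).L (D i).L _ at h
    rw [reassoc_of% (hρ i α β hαβ l), whiskerLeft_comp_eq (hρ j β δ hβδ l), reassoc_of% h,
      reassoc_of% (hρ j α γ hαγ l), ← Category.assoc ((D j).L ◁ (π l).app γ), whiskerLeft_comp_eq (hρ i γ δ hγδ l),
      Category.assoc, swap_naturality]

section
variable {J : Type} [SmallCategory J] [FinCategory J] (K : J ⥤ ExtendablePair D r)

/-- The pseudo-period isomorphisms of a diagram of extendable pairs. -/
noncomputable def ρNatIso (i : ι) (α β : Box r) (h : IsTranslate i α β) :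
    (K ⋙ toDiagram D r) ⋙ (CategoryTheory.evaluation _ _).obj α ≅
      ((K ⋙ toDiagram D r) ⋙ (CategoryTheory.evaluation _ _).obj β) ⋙ tensorLeft (D i).L :=
  NatIso.ofComponents (fun j => (K.obj j).ρ i α β h) fun f => (Hom.comm (K.map f) i α β h).symm

section
variable {K} {c : Cone (K ⋙ toDiagram D r)} (t : IsLimit c)

/-- The values of a limit of diagrams are limits. -/
noncomputable def isLimitEval (α : Box r) : IsLimit (((CategoryTheory.evaluation _ _).obj α).mapCone c) :=
  isLimitOfPreserves _ t

/-- The values of a limit of diagrams, tensored with a line bundle, are limits. -/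
noncomputable def isLimitTensorEval (i : ι) (α : Box r) :
    IsLimit ((tensorLeft (D i).L).mapCone (((CategoryTheory.evaluation _ _).obj α).mapCone c)) :=
  isLimitOfPreserves _ (isLimitEval t α)

include t in
theorem tensor_limit_hom_ext {i : ι} {α : Box r} {M : X.Modules} {f g : M ⟶ (D i).L ⊗ c.pt.obj α}
    (h : ∀ j, f ≫ (D i).L ◁ (c.π.app j).app α = g ≫ (D i).L ◁ (c.π.app j).app α) : f = g :=
  (isLimitTensorEval t i α).hom_ext h

include t in
theorem tensor_tensor_limit_hom_ext {i j : ι} {α : Box r} {M : X.Modules}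
    {f g : M ⟶ (D i).L ⊗ (D j).L ⊗ c.pt.obj α}
    (h : ∀ l, f ≫ (D i).L ◁ (D j).L ◁ (c.π.app l).app α =
      g ≫ (D i).L ◁ (D j).L ◁ (c.π.app l).app α) : f = g :=
  (isLimitOfPreserves (tensorLeft (D i).L) (isLimitTensorEval t j α)).hom_ext h

/-- The pseudo-period isomorphisms of a limit. -/
noncomputable def limitρ (i : ι) (α β : Box r) (h : IsTranslate i α β) :
    c.pt.obj α ≅ (D i).L ⊗ c.pt.obj β :=
  (isLimitEval t α).conePointsIsoOfNatIso (isLimitTensorEval t i β) (ρNatIso K i α β h)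

theorem limitρ_hom_π (i : ι) (α β : Box r) (h : IsTranslate i α β) (j : J) :
    (limitρ t i α β h).hom ≫ (D i).L ◁ (c.π.app j).app β =
      (c.π.app j).app α ≫ ((K.obj j).ρ i α β h).hom :=
  IsLimit.conePointsIsoOfNatIso_hom_comp _ _ _ _

/-- The limit of a diagram of extendable pairs. -/
noncomputable def limitPair (hc : ∀ α, Scheme.Modules.coherent X (c.pt.obj α)) : ExtendablePair D r :=
  ofJointlyMono c.pt hc K.obj (fun j => c.π.app j) (limitρ t) (limitρ_hom_π t)
    (fun _ _ _ _ _ h => tensor_limit_hom_ext t h) (fun _ _ _ _ _ _ h => tensor_tensor_limit_hom_ext t h)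

/-- Limits of diagrams of coherent sheaves lift to extendable pairs. -/
noncomputable def liftsToLimit (hc : ∀ α, Scheme.Modules.coherent X (c.pt.obj α)) :
    LiftsToLimit K (toDiagram D r) c t where
  liftedCone :=
    { pt := limitPair t hc
      π :=
        { app := fun j => { app := c.π.app j, comm := fun i α β h => limitρ_hom_π t i α β h j }
          naturality := fun _ _ f => Hom.ext (c.π.naturality f) } }
  validLift := Iso.refl _
  makesLimit :=
    { lift := fun s =>
        { app := t.lift ((toDiagram D r).mapCone s)
          comm := fun i α β h => tensor_limit_hom_ext t fun j => by
            have hf (α) : (t.lift ((toDiagram D r).mapCone s)).app α ≫ (c.π.app j).app α = (Hom.app (s.π.app j)).app α :=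
              congrArg (fun f => NatTrans.app f α) (t.fac ((toDiagram D r).mapCone s) j)
            refine (Category.assoc _ _ _).trans (Eq.trans ?_ (Category.assoc _ _ _).symm)
            refine (congrArg ((s.pt.ρ i α β h).hom ≫ ·) (MonoidalCategory.whiskerLeft_comp _ _ _).symm).trans ?_
            refine (congrArg (fun f => (s.pt.ρ i α β h).hom ≫ (D i).L ◁ f) (hf β)).trans ?_
            refine (Hom.comm (s.π.app j) i α β h).trans ?_
            refine Eq.trans ?_ (congrArg ((t.lift ((toDiagram D r).mapCone s)).app α ≫ ·) (limitρ_hom_π t i α β h j)).symm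
            exact (congrArg (· ≫ ((K.obj j).ρ i α β h).hom) (hf α)).symm.trans (Category.assoc _ _ _) }
      fac := fun s j => Hom.ext (t.fac ((toDiagram D r).mapCone s) j)
      uniq := fun s m w => Hom.ext (t.uniq ((toDiagram D r).mapCone s) (Hom.app m)
        fun j => congrArg (fun f => Hom.app f) (w j)) }
end

section
variable {K} {c : Cocone (K ⋙ toDiagram D r)} (t : IsColimit c)

/-- The values of a colimit of diagrams are colimits. -/
noncomputable def isColimitEval (α : Box r) : IsColimit (((CategoryTheory.evaluation _ _).obj α).mapCocone c) :=
  isColimitOfPreserves _ t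

/-- The values of a colimit of diagrams, tensored with a line bundle, are colimits. -/
noncomputable def isColimitTensorEval (i : ι) (α : Box r) :
    IsColimit ((tensorLeft (D i).L).mapCocone (((CategoryTheory.evaluation _ _).obj α).mapCocone c)) :=
  isColimitOfPreserves _ (isColimitEval t α)

include t in
theorem colimit_hom_ext {α : Box r} {M : X.Modules} {f g : c.pt.obj α ⟶ M}
    (h : ∀ j, (c.ι.app j).app α ≫ f = (c.ι.app j).app α ≫ g) : f = g :=
  (isColimitEval t α).hom_ext h

/-- The pseudo-period isomorphisms of a colimit. -/
noncomputable def colimitρ (i : ι) (α β : Box r) (h : IsTranslate i α β) :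
    c.pt.obj α ≅ (D i).L ⊗ c.pt.obj β :=
  (isColimitEval t α).coconePointsIsoOfNatIso (isColimitTensorEval t i β) (ρNatIso K i α β h)

theorem ι_colimitρ_hom (i : ι) (α β : Box r) (h : IsTranslate i α β) (j : J) :
    (c.ι.app j).app α ≫ (colimitρ t i α β h).hom =
      ((K.obj j).ρ i α β h).hom ≫ (D i).L ◁ (c.ι.app j).app β :=
  IsColimit.comp_coconePointsIsoOfNatIso_hom (isColimitEval t α) (isColimitTensorEval t i β)
    (ρNatIso K i α β h) j

/-- The colimit of a diagram of extendable pairs. -/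
noncomputable def colimitPair (hc : ∀ α, Scheme.Modules.coherent X (c.pt.obj α)) : ExtendablePair D r :=
  ofJointlyEpi c.pt hc K.obj (fun j => c.ι.app j) (colimitρ t) (ι_colimitρ_hom t)
    (fun _ _ _ _ h => colimit_hom_ext t h)

/-- Colimits of diagrams of coherent sheaves lift to extendable pairs. -/
noncomputable def liftsToColimit (hc : ∀ α, Scheme.Modules.coherent X (c.pt.obj α)) :
    LiftsToColimit K (toDiagram D r) c t where
  liftedCocone :=
    { pt := colimitPair t hc
      ι :=
        { app := fun j => { app := c.ι.app j, comm := fun i α β h => (ι_colimitρ_hom t i α β h j).symm }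
          naturality := fun _ _ f => Hom.ext (c.ι.naturality f) } }
  validLift := Iso.refl _
  makesColimit :=
    { desc := fun s =>
        { app := t.desc ((toDiagram D r).mapCocone s)
          comm := fun i α β h => colimit_hom_ext t fun j => by
            have hf (α) : (c.ι.app j).app α ≫ (t.desc ((toDiagram D r).mapCocone s)).app α = (Hom.app (s.ι.app j)).app α :=
              congrArg (fun f => NatTrans.app f α) (t.fac ((toDiagram D r).mapCocone s) j)
            refine ((Category.assoc _ _ _).symm.trans (congrArg (· ≫ (D i).L ◁ (t.desc ((toDiagram D r).mapCocone s)).app β) (ι_colimitρ_hom t i α β h j))).trans ?_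
            refine Eq.trans ?_ ((congrArg (· ≫ (s.pt.ρ i α β h).hom) (hf α)).symm.trans (Category.assoc _ _ _))
            refine Eq.trans ?_ (Hom.comm (s.ι.app j) i α β h)
            refine (Category.assoc _ _ _).trans (congrArg (((K.obj j).ρ i α β h).hom ≫ ·) ?_)
            exact (MonoidalCategory.whiskerLeft_comp _ _ _).symm.trans (congrArg ((D i).L ◁ ·) (hf β)) }
      fac := fun s j => Hom.ext (t.fac ((toDiagram D r).mapCocone s) j)
      uniq := fun s m w => Hom.ext (t.uniq ((toDiagram D r).mapCocone s) (Hom.app m)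
        fun j => congrArg (fun f => Hom.app f) (w j)) }
end
end
end
end ExtendablePair

/-! ### Extendable pairs form an abelian category; vanishing conditions -/

namespace ExtendablePair

section
variable {X : Scheme.{u}} [IsLocallyNoetherian X] {ι : Type} {D : ι → LineBundleWithSection X}
  {r : ι → ℕ}

/-- The value of an extendable pair, as a coherent sheaf. -/
def evalCoh (α : Box r) : ExtendablePair D r ⥤ Scheme.Modules.Coh X :=
  (Scheme.Modules.coherent X).lift (toDiagram D r ⋙ (CategoryTheory.evaluation (Box r) X.Modules).obj α)
    (fun E => E.coherent α)

section
variable {J : Type} [SmallCategory J] [FinCategory J] (K : J ⥤ ExtendablePair D r)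

/-- The inclusion of coherent sheaves into all modules is left exact, so the pointwise limit is
isomorphic to one taken among coherent sheaves. -/
theorem coherent_of_isLimit {c : Cone (K ⋙ toDiagram D r)} (t : IsLimit c) (α : Box r) :
    Scheme.Modules.coherent X (c.pt.obj α) := by
  have := (Scheme.Modules.coherent X).preservesFiniteLimits_ι
  let e := (isLimitOfPreserves (Scheme.Modules.coherent X).ι (limit.isLimit (K ⋙ evalCoh α))).conePointUniqueUpToIso
    (isLimitEval t α)
  exact (Scheme.Modules.coherent X).prop_of_iso e (limit (K ⋙ evalCoh α)).property

theorem coherent_of_isColimit {c : Cocone (K ⋙ toDiagram D r)} (t : IsColimit c) (α : Box r) :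
    Scheme.Modules.coherent X (c.pt.obj α) := by
  have := (Scheme.Modules.coherent X).preservesFiniteColimits_ι
  let e := (isColimitOfPreserves (Scheme.Modules.coherent X).ι (colimit.isColimit (K ⋙ evalCoh α))).coconePointUniqueUpToIso
    (isColimitEval t α)
  exact (Scheme.Modules.coherent X).prop_of_iso e (colimit (K ⋙ evalCoh α)).property

/-- Limits of extendable pairs are computed on the underlying diagrams. -/
noncomputable instance : CreatesLimit K (toDiagram D r) :=
  createsLimitOfReflectsIso fun _ t => liftsToLimit t (coherent_of_isLimit K t)

/-- Colimits of extendable pairs are computed on the underlying diagrams. -/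
noncomputable instance : CreatesColimit K (toDiagram D r) :=
  createsColimitOfReflectsIso fun _ t => liftsToColimit t (coherent_of_isColimit K t)

end

instance : HasFiniteLimits (ExtendablePair D r) :=
  ⟨fun _ _ _ => ⟨fun K => hasLimit_of_created K (toDiagram D r)⟩⟩

instance : HasFiniteColimits (ExtendablePair D r) :=
  ⟨fun _ _ _ => ⟨fun K => hasColimit_of_created K (toDiagram D r)⟩⟩

instance : PreservesFiniteLimits (toDiagram D r) :=
  ⟨fun _ _ _ => ⟨fun {_} => inferInstance⟩⟩

instance : PreservesFiniteColimits (toDiagram D r) :=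
  ⟨fun _ _ _ => ⟨fun {_} => inferInstance⟩⟩

/-- The functor `toDiagram` is exact, reflects isomorphisms and takes values in an abelian category
of diagrams. -/
noncomputable instance : Abelian (ExtendablePair D r) :=
  abelianOfExactFunctors (fun _ : Unit => toDiagram D r) fun f h =>
    have := h ()
    isIso_of_reflects_iso f (toDiagram D r)
end

section
variable {X : Scheme.{u}} {ι : Type} {D : ι → LineBundleWithSection X} {r : ι → ℕ}

variable (D) in
/-- The value of an extendable pair. -/
abbrev eval (α : Box r) : ExtendablePair D r ⥤ X.Modules :=
  toDiagram D r ⋙ (CategoryTheory.evaluation (Box r) X.Modules).obj α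

/-- Extendable pairs whose values vanish on a set of indices. -/
def zeroOn (D : ι → LineBundleWithSection X) (S : Set (Box r)) : ObjectProperty (ExtendablePair D r) :=
  fun E => ∀ α ∈ S, IsZero (E.F.obj α)

theorem isZero_iff (E : ExtendablePair D r) : IsZero E ↔ ∀ α, IsZero (E.F.obj α) := by
  constructor
  · intro h α
    rw [IsZero.iff_id_eq_zero] at h ⊢
    exact congrArg (fun f => (Hom.app f).app α) h
  · intro h
    rw [IsZero.iff_id_eq_zero]
    exact Hom.ext (NatTrans.ext (funext fun α => (h α).eq_of_src _ _))

section
variable (S : Set (Box r))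

theorem zeroOn_of_mono {E E' : ExtendablePair D r} (f : E ⟶ E') (hf : ∀ α, Mono ((Hom.app f).app α))
    (h : zeroOn D S E') : zeroOn D S E := fun α hα =>
  have := hf α
  IsZero.of_mono ((Hom.app f).app α) (h α hα)

theorem zeroOn_of_epi {E E' : ExtendablePair D r} (f : E ⟶ E') (hf : ∀ α, Epi ((Hom.app f).app α))
    (h : zeroOn D S E) : zeroOn D S E' := fun α hα =>
  have := hf α
  IsZero.of_epi ((Hom.app f).app α) (h α hα)

instance : (zeroOn D S).IsClosedUnderIsomorphisms where
  of_iso e h := fun α hα => (h α hα).of_iso ((eval D α).mapIso e.symm)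

variable [IsLocallyNoetherian X]

instance : (zeroOn D S).ContainsZero where
  exists_zero :=
    have : HasZeroObject (ExtendablePair D r) := Abelian.hasZeroObject
    let ⟨Z, hZ⟩ := this.zero
    ⟨Z, hZ, fun α _ => (isZero_iff Z).1 hZ α⟩

instance : (zeroOn D S).IsClosedUnderKernels where
  kernels_le := by
    rintro E ⟨f, k, hk, hf⟩
    have hm : Mono k.ι := Fork.IsLimit.mono hk
    exact zeroOn_of_mono S k.ι (fun α => inferInstanceAs (Mono ((eval D α).map k.ι))) hf.1

instance : (zeroOn D S).IsClosedUnderCokernels where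
  cokernels_le := by
    rintro E ⟨f, k, hk, hf⟩
    have hm : Epi k.π := Cofork.IsColimit.epi hk
    exact zeroOn_of_epi S k.π (fun α => inferInstanceAs (Epi ((eval D α).map k.π))) hf.2

instance : (zeroOn D S).IsClosedUnderFiniteProducts :=
  have : (zeroOn D S).IsClosedUnderBinaryProducts :=
    { limitsOfShape_le := by
        rintro E ⟨p⟩ α hα
        rw [IsZero.iff_id_eq_zero]
        exact (isLimitOfPreserves (eval D α) p.isLimit).hom_ext fun j =>
          (p.prop_diag_obj j α hα).eq_of_tgt _ _ }
  .mk'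

end
end
end ExtendablePair

namespace CategoryTheory

theorem Pi.isZero_iff {I : Type*} {A : I → Type*} [∀ i, Category (A i)] [∀ i, Preadditive (A i)]
    (a : ∀ i, A i) : IsZero a ↔ ∀ i, IsZero (a i) := by
  let : Preadditive (∀ i, A i) := Pi.preadditive
  simp only [IsZero.iff_id_eq_zero]
  exact funext_iff

theorem ObjectProperty.isZero_obj_iff {C : Type*} [Category C] [HasZeroMorphisms C]
    {P : ObjectProperty C} (a : P.FullSubcategory) : IsZero a.obj ↔ IsZero a := by
  simp only [IsZero.iff_id_eq_zero]
  exact ⟨fun h => ObjectProperty.hom_ext _ h, fun h => congrArg (fun f => f.hom) h⟩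

end CategoryTheory

/-! ### Indices with zero, interior and maximal coordinates -/

namespace Box
variable {ι : Type} {r : ι → ℕ} [DecidableEq ι]

/-- The index obtained by setting the `i`-th coordinate to zero. -/
def zeroAt (u : Box r) (i : ι) : Box r :=
  ⟨Function.update u.1 i 0, fun j => by
    by_cases h : j = i
    · subst h; simp
    · simpa [h] using u.2 j⟩

/-- The index obtained by setting the `i`-th coordinate to its maximal value. -/
def topAt (u : Box r) (i : ι) : Box r :=
  ⟨Function.update u.1 i (r i), fun j => by
    by_cases h : j = i
    · subst h; simp
    · simpa [h] using u.2 j⟩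

@[simp] theorem zeroAt_self (u : Box r) (i : ι) : (u.zeroAt i).1 i = 0 := by simp [zeroAt]

@[simp] theorem zeroAt_of_ne (u : Box r) {i j : ι} (h : j ≠ i) : (u.zeroAt i).1 j = u.1 j := by
  simp [zeroAt, h]

@[simp] theorem topAt_self (u : Box r) (i : ι) : (u.topAt i).1 i = r i := by simp [topAt]

@[simp] theorem topAt_of_ne (u : Box r) {i j : ι} (h : j ≠ i) : (u.topAt i).1 j = u.1 j := by
  simp [topAt, h]

theorem zeroAt_le (u : Box r) (i : ι) : u.zeroAt i ≤ u := fun j => by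
  by_cases h : j = i
  · subst h; simp
  · simp [h]

theorem le_topAt (u : Box r) (i : ι) : u ≤ u.topAt i := fun j => by
  by_cases h : j = i
  · subst h; simpa using u.2 j
  · simp [h]

theorem zeroAt_mono {u v : Box r} (h : u ≤ v) (i : ι) : u.zeroAt i ≤ v.zeroAt i := fun j => by
  by_cases hj : j = i
  · subst hj; simp
  · simpa [hj] using h j

theorem isTranslate_zeroAt {u : Box r} {i : ι} (h : u.1 i = r i) : IsTranslate i u (u.zeroAt i) where
  top := h
  bot := by simp
  eq j hj := by simp [hj]

theorem isTranslate_topAt (u : Box r) (i : ι) : IsTranslate i (u.topAt i) (u.zeroAt i) where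
  top := by simp
  bot := by simp
  eq j hj := by simp [hj]

/-- Induction on the number of coordinates which are maximal. -/
theorem induction_top [Fintype ι] (hr : ∀ i, 0 < r i) {p : Box r → Prop}
    (base : ∀ u : Box r, (∀ i, u.1 i < r i) → p u)
    (step : ∀ (i : ι) (u : Box r), u.1 i = r i → p (u.zeroAt i) → p u) (u : Box r) : p u := by
  generalize hm : (Finset.univ.filter fun i => u.1 i = r i).card = m
  induction m generalizing u with
  | zero =>
    refine base u fun i => lt_of_le_of_ne (u.2 i) fun h => ?_
    rw [Finset.card_eq_zero] at hm
    simpa [h] using Finset.ext_iff.1 hm i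
  | succ m ih =>
    obtain ⟨i, hi⟩ : (Finset.univ.filter fun i => u.1 i = r i).Nonempty := by
      rw [← Finset.card_pos]; omega
    have hi' : u.1 i = r i := by simpa using hi
    refine step i u hi' (ih _ ?_)
    have : (Finset.univ.filter fun j => (u.zeroAt i).1 j = r j) =
        (Finset.univ.filter fun j => u.1 j = r j).erase i := by
      ext j
      by_cases h : j = i
      · subst h
        simpa using (hr j).ne
      · simp [h]
    rw [this, Finset.card_erase_of_mem hi, hm]
    rfl

/-- The coordinates in which an index is neither zero nor maximal. -/
def interior [Fintype ι] (u : Box r) : Finset ι := Finset.univ.filter fun i => 0 < u.1 i ∧ u.1 i < r i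

omit [DecidableEq ι] in
@[simp] theorem mem_interior [Fintype ι] (u : Box r) (i : ι) :
    i ∈ u.interior ↔ 0 < u.1 i ∧ u.1 i < r i := by simp [interior]

theorem interior_zeroAt [Fintype ι] (u : Box r) {i : ι} (h : u.1 i = r i) :
    (u.zeroAt i).interior = u.interior := by
  ext j
  by_cases hj : j = i
  · subst hj; simp [h]
  · simp [hj]

end Box

/-! ### The kernels `ker^k` as vanishing conditions -/

namespace ExtendablePair

section
variable {X : Scheme.{u}} {ι : Type} {D : ι → LineBundleWithSection X} {r : ι → ℕ}

theorem isZero_of_isTranslate (E : ExtendablePair D r) {i : ι} {α β : Box r}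
    (h : IsTranslate i α β) (hβ : IsZero (E.F.obj β)) : IsZero (E.F.obj α) :=
  ((tensorLeft (D i).L).map_isZero hβ).of_iso (E.ρ i α β h)

end

variable {X : Scheme.{u}} {n : ℕ} (D : Fin n → LineBundleWithSection X) (r : Fin n → ℕ)

theorem ker_iff_forall_extendBox (k : ℕ) (E : ExtendablePair D r) :
    ker D r k E ↔ ∀ T : Finset (Fin n), T.card = k → ∀ v, IsZero (E.F.obj (extendBox r T v)) := by
  match k with
  | 0 =>
    refine (ObjectProperty.isZero_obj_iff ((piStar D r).obj E)).symm.trans ⟨fun h T hT v => ?_, fun h => ?_⟩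
    · obtain rfl := Finset.card_eq_zero.1 hT
      have : extendBox r ∅ v = ⟨fun _ => 0, fun _ => Nat.zero_le _⟩ := by
        ext i; simp [extendBox]
      rw [this]
      exact h
    · have := h ∅ rfl ⟨fun i => 0, fun _ => Nat.zero_le _⟩
      have e : extendBox r ∅ ⟨fun i => 0, fun _ => Nat.zero_le _⟩ = ⟨fun _ => 0, fun _ => Nat.zero_le _⟩ := by
        ext i; simp [extendBox]
      rw [e] at this
      exact this
  | k + 1 =>
    refine (Pi.isZero_iff ((face D r (k + 1)).obj E)).trans ⟨fun h T hT v => ?_, fun h T => ?_⟩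
    · exact (isZero_iff _).1 (h ⟨T, hT⟩) v
    · exact (isZero_iff _).2 fun v => h T.1 T.2 v

-- By `ρ` it suffices to treat indices without maximal coordinates. Such an index lies on every face
-- containing its interior coordinates, and as `k ≤ n` these can be completed to a `k`-element set.
-- Conversely an index on a `k`-face has at most `k` interior coordinates.
variable {r} in
theorem ker_eq_zeroOn (hr : ∀ i, 0 < r i) {k : ℕ} (hk : k ≤ n) :
    ker D r k = zeroOn D {u : Box r | u.interior.card ≤ k} := by
  ext E
  rw [ker_iff_forall_extendBox]
  refine ⟨fun h u hu => ?_, fun h T hT v => h _ ?_⟩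
  · change u.interior.card ≤ k at hu
    induction u using Box.induction_top hr with
    | base u hlt =>
      obtain ⟨T, hT, hc⟩ := Finset.exists_superset_card_eq hu (by simpa using hk)
      have : u = extendBox r T ⟨fun i => u.1 i, fun i => u.2 i⟩ := by
        ext i
        dsimp [extendBox]
        split_ifs with hi
        · rfl
        · by_contra h0
          exact hi (hT ((Box.mem_interior u i).2 ⟨by omega, hlt i⟩))
      rw [this]
      exact h T hc _
    | step i u hi ih =>
      exact isZero_of_isTranslate E (Box.isTranslate_zeroAt hi) (ih ((Box.interior_zeroAt u hi).symm ▸ hu))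
  · rw [Set.mem_ofPred_eq, ← hT]
    refine Finset.card_le_card fun i hi => ?_
    rw [Box.mem_interior] at hi
    by_contra hT'
    simp [extendBox, hT'] at hi

end ExtendablePair

/-! ### Twisting by a line bundle on a maximal face -/

namespace LineBundleWithSection
variable {X : Scheme.{u}} (D D' D'' : LineBundleWithSection X)

/-- The functors `M ↦ M` and `M ↦ L ⊗ M`. -/
noncomputable def twist (b : Bool) : X.Modules ⥤ X.Modules :=
  match b with
  | false => 𝟭 _
  | true => tensorLeft D.L

/-- The transition map from `M` to `L ⊗ M`. -/
noncomputable def twistMap {b b' : Bool} (h : b ≤ b') (M : X.Modules) :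
    (D.twist b).obj M ⟶ (D.twist b').obj M :=
  match b, b', h with
  | false, false, _ => 𝟙 _
  | false, true, _ => D.mulSection M
  | true, true, _ => 𝟙 _
  | true, false, h => absurd h (by decide)

/-- The transition map from a twist of `M` to `L ⊗ M`. -/
noncomputable def toTensor (b : Bool) (M : X.Modules) : (D.twist b).obj M ⟶ D.L ⊗ M :=
  D.twistMap (Bool.le_true b) M

/-- The transition map from `M` to a twist of `M`. -/
noncomputable def ofBase (b : Bool) (M : X.Modules) : M ⟶ (D.twist b).obj M :=
  D.twistMap (Bool.false_le b) M

/-- The transition map from an untwisted `M`. -/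
noncomputable def toBase {b : Bool} (hb : b = false) (M : X.Modules) : (D.twist b).obj M ⟶ M :=
  D.twistMap hb.le M

variable {D} in
theorem coherent_twist {M : X.Modules} (hM : Scheme.Modules.coherent X M) (b : Bool) :
    Scheme.Modules.coherent X ((D.twist b).obj M) := by
  cases b
  · exact hM
  · exact Scheme.Modules.coherent_tensor D hM

@[simp] theorem twistMap_self (b : Bool) (h : b ≤ b) (M : X.Modules) : D.twistMap h M = 𝟙 _ := by
  cases b <;> rfl

@[simp]
theorem twistMap_trans {b b' b'' : Bool} (h : b ≤ b') (h' : b' ≤ b'') (M : X.Modules) :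
    D.twistMap h M ≫ D.twistMap h' M = D.twistMap (h.trans h') M := by
  cases b <;> cases b' <;> cases b'' <;>
    first | (exfalso; revert h h'; decide) | exact Category.id_comp _ | exact Category.comp_id _

theorem twistMap_naturality {b b' : Bool} (h : b ≤ b') {M N : X.Modules} (f : M ⟶ N) :
    (D.twist b).map f ≫ D.twistMap h N = D.twistMap h M ≫ (D.twist b').map f := by
  cases b <;> cases b'
  · exact (Category.comp_id _).trans (Category.id_comp _).symm
  · exact Scheme.Modules.mulSection_naturality D f
  · exact absurd h (by decide)
  · exact (Category.comp_id _).trans (Category.id_comp _).symm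

@[simp]
theorem twistMap_toTensor {b b' : Bool} (h : b ≤ b') (M : X.Modules) :
    D.twistMap h M ≫ D.toTensor b' M = D.toTensor b M :=
  D.twistMap_trans h _ M

@[simp]
theorem ofBase_twistMap {b b' : Bool} (h : b ≤ b') (M : X.Modules) :
    D.ofBase b M ≫ D.twistMap h M = D.ofBase b' M :=
  D.twistMap_trans _ h M

@[simp]
theorem twistMap_toBase {b b' : Bool} (h : b ≤ b') (hb : b' = false) (M : X.Modules) :
    D.twistMap h M ≫ D.toBase hb M = D.toBase (Bool.eq_false_of_le_false (h.trans hb.le)) M :=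
  D.twistMap_trans h _ M

@[simp]
theorem ofBase_toBase {b : Bool} (hb : b = false) (M : X.Modules) :
    D.ofBase b M ≫ D.toBase hb M = 𝟙 M :=
  D.twistMap_trans _ _ M

theorem toBase_mulSection {b : Bool} (hb : b = false) (M : X.Modules) :
    D.toBase hb M ≫ D.mulSection M = D.toTensor b M :=
  D.twistMap_trans hb.le (Bool.false_le true) M

theorem toTensor_naturality (b : Bool) {M N : X.Modules} (f : M ⟶ N) :
    (D.twist b).map f ≫ D.toTensor b N = D.toTensor b M ≫ D.L ◁ f :=
  D.twistMap_naturality (Bool.le_true b) f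

theorem ofBase_naturality (b : Bool) {M N : X.Modules} (f : M ⟶ N) :
    f ≫ D.ofBase b N = D.ofBase b M ≫ (D.twist b).map f :=
  D.twistMap_naturality (Bool.false_le b) f

theorem toBase_naturality {b : Bool} (hb : b = false) {M N : X.Modules} (f : M ⟶ N) :
    (D.twist b).map f ≫ D.toBase hb N = D.toBase hb M ≫ f :=
  D.twistMap_naturality hb.le f

/-- The core of EX1 for `twistDiagram`. In the twisted case it compares multiplication by `s` on `L
⊗ M` with `L` tensored with multiplication by `s` on `M`; they differ by the symmetry of `L ⊗ L`,
which is the identity by `braiding_self`. -/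
theorem toTensor_whiskerLeft_ofBase (b : Bool) (M : X.Modules) :
    D.toTensor b M ≫ D.L ◁ D.ofBase b M = D.mulSection ((D.twist b).obj M) := by
  cases b
  · exact (congrArg (D.mulSection M ≫ ·) (whiskerLeft_id _ _)).trans (Category.comp_id _)
  · have h := unit_whiskerRight_swap D.L D.L M D.s
    rw [swap_self _ _ (Scheme.Modules.braiding_self D)] at h
    exact (Category.id_comp _).trans (h.symm.trans (Category.comp_id _))

theorem isIso_toTensor {b : Bool} (hb : b = true) (M : X.Modules) : IsIso (D.toTensor b M) := by
  subst hb
  exact inferInstanceAs (IsIso (𝟙 (D.L ⊗ M)))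

theorem isIso_ofBase {b : Bool} (hb : b = false) (M : X.Modules) : IsIso (D.ofBase b M) := by
  subst hb
  exact inferInstanceAs (IsIso (𝟙 M))

theorem isIso_toBase {b : Bool} (hb : b = false) (M : X.Modules) : IsIso (D.toBase hb M) := by
  subst hb
  exact inferInstanceAs (IsIso (𝟙 M))

theorem isIso_twistMap {b b' : Bool} (hb : b = b') (M : X.Modules) :
    IsIso (D.twistMap hb.le M) := by
  subst hb
  rw [twistMap_self]
  infer_instance

/-- Twisting commutes with tensoring with another line bundle. -/
noncomputable def twistSwap (b : Bool) (M : X.Modules) :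
    (D.twist b).obj (D'.L ⊗ M) ≅ D'.L ⊗ (D.twist b).obj M :=
  match b with
  | false => Iso.refl _
  | true => ⟨swap D.L D'.L M, swap D'.L D.L M, swap_swap _ _ _, swap_swap _ _ _⟩

theorem twistSwap_naturality (b : Bool) {M N : X.Modules} (f : M ⟶ N) :
    (D.twist b).map (D'.L ◁ f) ≫ (D.twistSwap D' b N).hom =
      (D.twistSwap D' b M).hom ≫ D'.L ◁ (D.twist b).map f := by
  cases b
  · exact (Category.comp_id _).trans (Category.id_comp _).symm
  · exact swap_naturality _ _ f

theorem toTensor_swap (b : Bool) (M : X.Modules) :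
    D.toTensor b (D'.L ⊗ M) ≫ swap D.L D'.L M =
      (D.twistSwap D' b M).hom ≫ D'.L ◁ D.toTensor b M := by
  cases b
  · exact (unit_whiskerRight_swap D.L D'.L M D.s).trans (Category.id_comp _).symm
  · exact (Category.id_comp _).trans ((Category.comp_id _).symm.trans
      (congrArg ((D.twistSwap D' true M).hom ≫ ·) (whiskerLeft_id D'.L (D.L ⊗ M)).symm))

theorem ofBase_twistSwap (b : Bool) (M : X.Modules) :
    D.ofBase b (D'.L ⊗ M) ≫ (D.twistSwap D' b M).hom = D'.L ◁ D.ofBase b M := by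
  cases b
  · exact (Category.id_comp _).trans (whiskerLeft_id D'.L M).symm
  · exact unit_whiskerRight_swap D.L D'.L M D.s

theorem twistMap_twistSwap {b b' : Bool} (h : b ≤ b') (M : X.Modules) :
    D.twistMap h (D'.L ⊗ M) ≫ (D.twistSwap D' b' M).hom =
      (D.twistSwap D' b M).hom ≫ D'.L ◁ D.twistMap h M := by
  cases b
  · exact (D.ofBase_twistSwap D' b' M).trans (Category.id_comp _).symm
  · obtain rfl : b' = true := by revert h; cases b' <;> decide
    rw [twistMap_self, twistMap_self, whiskerLeft_id, Category.comp_id, Category.id_comp]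

theorem map_mulSection_twistSwap (b : Bool) (M : X.Modules) :
    (D.twist b).map (D'.mulSection M) ≫ (D.twistSwap D' b M).hom =
      D'.mulSection ((D.twist b).obj M) := by
  cases b
  · exact Category.comp_id _
  · have h := unit_whiskerRight_swap D'.L D.L M D'.s
    exact (congrArg (· ≫ swap D.L D'.L M) h.symm).trans ((Category.assoc _ _ _).trans
      ((congrArg (D'.mulSection (D.L ⊗ M) ≫ ·) (swap_swap _ _ _)).trans (Category.comp_id _)))

theorem map_swap_twistSwap (b : Bool) (M : X.Modules) :
    (D.twist b).map (swap D'.L D''.L M) ≫ (D.twistSwap D'' b (D'.L ⊗ M)).hom ≫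
        D''.L ◁ (D.twistSwap D' b M).hom =
      (D.twistSwap D' b (D''.L ⊗ M)).hom ≫ D'.L ◁ (D.twistSwap D'' b M).hom ≫
        swap D'.L D''.L ((D.twist b).obj M) := by
  cases b
  · have h1 : (D.twistSwap D'' false (D'.L ⊗ M)).hom ≫ D''.L ◁ (D.twistSwap D' false M).hom = 𝟙 _ :=
      (Category.id_comp _).trans (whiskerLeft_id _ _)
    have h2 : (D.twistSwap D' false (D''.L ⊗ M)).hom ≫ D'.L ◁ (D.twistSwap D'' false M).hom = 𝟙 _ :=
      (Category.id_comp _).trans (whiskerLeft_id _ _)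
    rw [h1, reassoc_of% h2]
    exact Category.comp_id _
  · exact swap_yang_baxter D.L D'.L D''.L M

end LineBundleWithSection

/-! ### Transition maps and translates of indices -/

namespace CategoryTheory

theorem isIso_map_homOfLE {P C : Type*} [Preorder P] [Category C] (F : P ⥤ C) {a b : P} (h : a = b) :
    IsIso (F.map (homOfLE h.le)) := by
  subst h
  have : F.map (homOfLE le_rfl) = 𝟙 (F.obj a) := F.map_id a
  rw [this]
  infer_instance

theorem map_homOfLE_comp {P C : Type*} [Preorder P] [Category C] (F : P ⥤ C) {a b c : P}
    (h : a ≤ b) (h' : b ≤ c) :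
    F.map (homOfLE h) ≫ F.map (homOfLE h') = F.map (homOfLE (h.trans h')) :=
  (F.map_comp _ _).symm

end CategoryTheory

/-- Whether the `j`-th coordinate is maximal. -/
def Box.isTop {ι : Type} {r : ι → ℕ} (j : ι) (u : Box r) : Bool := decide (u.1 j = r j)

namespace Box
variable {ι : Type} {r : ι → ℕ} {j : ι}

theorem isTop_mono (j : ι) {u v : Box r} (h : u ≤ v) : u.isTop j ≤ v.isTop j := by
  have hv := v.2 j
  have := h j
  intro hu
  simp only [isTop, decide_eq_true_eq] at hu ⊢
  exact le_antisymm hv (hu ▸ this)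

theorem isTop_eq_true {u : Box r} (h : u.1 j = r j) : u.isTop j = true := decide_eq_true h

theorem isTop_eq_false {u : Box r} (h : u.1 j ≠ r j) : u.isTop j = false := decide_eq_false h

theorem _root_.IsTranslate.isTop_eq_false (hj : 0 < r j) {α β : Box r} (h : IsTranslate j α β) :
    β.isTop j = false :=
  Box.isTop_eq_false fun e => hj.ne (h.bot.symm.trans e)

theorem _root_.IsTranslate.isTop_eq {i : ι} (hij : i ≠ j) {α β : Box r} (h : IsTranslate i α β) :
    α.isTop j = β.isTop j := by
  rw [isTop, isTop, h.eq j hij.symm]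

variable [DecidableEq ι]

theorem _root_.IsTranslate.zeroAt {i : ι} (hij : i ≠ j) {α β : Box r} (h : IsTranslate i α β) :
    IsTranslate i (α.zeroAt j) (β.zeroAt j) where
  top := by rw [zeroAt_of_ne _ hij, h.top]
  bot := by rw [zeroAt_of_ne _ hij, h.bot]
  eq l hl := by
    by_cases hlj : l = j
    · subst hlj; simp
    · rw [zeroAt_of_ne _ hlj, zeroAt_of_ne _ hlj, h.eq l hl]

theorem _root_.IsTranslate.zeroAt_eq {α β : Box r} (h : IsTranslate j α β) :
    α.zeroAt j = β := by
  ext l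
  by_cases hlj : l = j
  · subst hlj; rw [zeroAt_self, h.bot]
  · rw [zeroAt_of_ne _ hlj, h.eq l hlj]

theorem zeroAt_eq_self {u : Box r} (h : u.1 j = 0) : u.zeroAt j = u := by
  ext l
  by_cases hlj : l = j
  · subst hlj; rw [zeroAt_self, h]
  · rw [zeroAt_of_ne _ hlj]

end Box

/-! ### Adjoining one direction of pseudo-periodicity -/

namespace ExtendablePair

/-- Diagrams with pseudo-period isomorphisms in the directions `J` only. -/
structure PartialPair {X : Scheme.{u}} {ι : Type} (D : ι → LineBundleWithSection X)
    (r : ι → ℕ) (J : Finset ι) where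
  /-- the diagram of sheaves -/
  F : Box r ⥤ X.Modules
  coherent : ∀ α, Scheme.Modules.coherent X (F.obj α)
  /-- the pseudo-period isomorphisms -/
  ρ : ∀ i ∈ J, ∀ α β : Box r, IsTranslate i α β → (F.obj α ≅ (D i).L ⊗ F.obj β)
  /-- the composite with the transition maps is multiplication by the section -/
  ex1 : ∀ (i : ι) (hi : i ∈ J) (β α γ : Box r) (h : IsTranslate i γ β) (hβα : β ≤ α) (hαγ : α ≤ γ),
    F.map (homOfLE hαγ) ≫ (ρ i hi γ β h).hom ≫ (D i).L ◁ F.map (homOfLE hβα) =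
      (D i).mulSection (F.obj α)
  /-- compatibility with the transition maps inside a face -/
  ex2 : ∀ (i : ι) (hi : i ∈ J) (α β α' β' : Box r) (h : IsTranslate i α β)
    (h' : IsTranslate i α' β') (hα : α ≤ α') (hβ : β ≤ β'),
    F.map (homOfLE hα) ≫ (ρ i hi α' β' h').hom =
      (ρ i hi α β h).hom ≫ (D i).L ◁ F.map (homOfLE hβ)
  /-- the pseudo-period isomorphisms in two directions commute -/
  ex3 : ∀ (i j : ι) (hi : i ∈ J) (hj : j ∈ J) (_ : i ≠ j) (α β γ δ : Box r)
    (hαβ : IsTranslate i α β) (hαγ : IsTranslate j α γ)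
    (hβδ : IsTranslate j β δ) (hγδ : IsTranslate i γ δ),
    (ρ i hi α β hαβ).hom ≫ (D i).L ◁ (ρ j hj β δ hβδ).hom =
      (ρ j hj α γ hαγ).hom ≫ (D j).L ◁ (ρ i hi γ δ hγδ).hom ≫ swap (D j).L (D i).L (F.obj δ)

section
variable {X : Scheme.{u}} {ι : Type} {D : ι → LineBundleWithSection X} {r : ι → ℕ}
  [DecidableEq ι] (L : LineBundleWithSection X) (j : ι) (F : Box r ⥤ X.Modules)

/-- The diagram which is constant in direction `j`, up to a twist by `L` on the maximal face. -/
noncomputable def twistDiagram : Box r ⥤ X.Modules where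
  obj u := (L.twist (u.isTop j)).obj (F.obj (u.zeroAt j))
  map {u v} f := L.twistMap (Box.isTop_mono j (leOfHom f)) _ ≫
    (L.twist (v.isTop j)).map (F.map (homOfLE (Box.zeroAt_mono (leOfHom f) j)))
  map_id u := by
    rw [L.twistMap_self, Category.id_comp]
    exact (congrArg _ (F.map_id _)).trans (CategoryTheory.Functor.map_id _ _)
  map_comp {u v w} f g := by
    rw [Category.assoc, reassoc_of% L.twistMap_naturality, reassoc_of% L.twistMap_trans,
      ← Functor.map_comp, map_homOfLE_comp]

/-- The pseudo-period map in direction `j`. -/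
noncomputable def twistDiagramSelf (α β : Box r) (h : IsTranslate j α β) :
    (twistDiagram L j F).obj α ⟶ L.L ⊗ (twistDiagram L j F).obj β :=
  L.toTensor (α.isTop j) (F.obj (α.zeroAt j)) ≫
    L.L ◁ (F.map (homOfLE (h.zeroAt_eq.trans (Box.zeroAt_eq_self h.bot).symm).le) ≫
      L.ofBase (β.isTop j) (F.obj (β.zeroAt j)))

/-- As `0 < r j`, the index `β` with `β j = 0` is not on the maximal face: the source is twisted and
the target value is not. -/
theorem isIso_twistDiagramSelf (hj : 0 < r j) (α β : Box r) (h : IsTranslate j α β) :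
    IsIso (twistDiagramSelf L j F α β h) := by
  have := L.isIso_toTensor (Box.isTop_eq_true h.top) (F.obj (α.zeroAt j))
  have := isIso_map_homOfLE F (h.zeroAt_eq.trans (Box.zeroAt_eq_self h.bot).symm)
  have := L.isIso_ofBase (h.isTop_eq_false hj) (F.obj (β.zeroAt j))
  dsimp only [twistDiagramSelf, twistDiagram]
  infer_instance

theorem twistDiagramSelf_ex1 (β α γ : Box r) (h : IsTranslate j γ β) (hβα : β ≤ α) (hαγ : α ≤ γ) :
    (twistDiagram L j F).map (homOfLE hαγ) ≫ twistDiagramSelf L j F γ β h ≫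
      L.L ◁ (twistDiagram L j F).map (homOfLE hβα) = L.mulSection ((twistDiagram L j F).obj α) := by
  have hα : γ.zeroAt j = α.zeroAt j := le_antisymm
    ((h.zeroAt_eq.trans (Box.zeroAt_eq_self h.bot).symm).le.trans (Box.zeroAt_mono hβα j))
    (Box.zeroAt_mono hαγ j)
  -- The transition maps form a loop in a poset, so only the contribution of the twists remains.
  have e : F.map (homOfLE (Box.zeroAt_mono hαγ j)) ≫
      F.map (homOfLE (h.zeroAt_eq.trans (Box.zeroAt_eq_self h.bot).symm).le) ≫
        F.map (homOfLE (Box.zeroAt_mono hβα j)) = 𝟙 _ := by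
    rw [map_homOfLE_comp, map_homOfLE_comp]
    exact F.map_id _
  dsimp only [twistDiagram, twistDiagramSelf]
  rw [Category.assoc, Category.assoc, reassoc_of% L.toTensor_naturality,
    reassoc_of% L.twistMap_toTensor, ← whiskerLeft_comp, ← whiskerLeft_comp, Category.assoc,
    reassoc_of% L.ofBase_twistMap, ← L.ofBase_naturality, reassoc_of% e, L.toTensor_whiskerLeft_ofBase]

theorem twistDiagramSelf_ex2 (α β α' β' : Box r) (h : IsTranslate j α β)
    (h' : IsTranslate j α' β') (hα : α ≤ α') (hβ : β ≤ β') :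
    (twistDiagram L j F).map (homOfLE hα) ≫ twistDiagramSelf L j F α' β' h' =
      twistDiagramSelf L j F α β h ≫ L.L ◁ (twistDiagram L j F).map (homOfLE hβ) := by
  dsimp only [twistDiagram, twistDiagramSelf]
  rw [Category.assoc, Category.assoc, reassoc_of% L.toTensor_naturality,
    reassoc_of% L.twistMap_toTensor, ← whiskerLeft_comp, ← whiskerLeft_comp, Category.assoc,
    reassoc_of% L.ofBase_twistMap, ← L.ofBase_naturality, reassoc_of% (map_homOfLE_comp F),
    reassoc_of% (map_homOfLE_comp F)]

variable {j F} {i : ι} (L' : LineBundleWithSection X)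

/-- The pseudo-period map in direction `i ≠ j`. -/
noncomputable def twistDiagramMap (hij : i ≠ j) {α β : Box r} (h : IsTranslate i α β)
    (ρ : F.obj (α.zeroAt j) ⟶ L'.L ⊗ F.obj (β.zeroAt j)) :
    (twistDiagram L j F).obj α ⟶ L'.L ⊗ (twistDiagram L j F).obj β :=
  (L.twist (α.isTop j)).map ρ ≫ (L.twistSwap L' (α.isTop j) (F.obj (β.zeroAt j))).hom ≫
    L'.L ◁ L.twistMap (h.isTop_eq hij).le (F.obj (β.zeroAt j))

theorem isIso_twistDiagramMap (hij : i ≠ j) {α β : Box r} (h : IsTranslate i α β)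
    (ρ : F.obj (α.zeroAt j) ⟶ L'.L ⊗ F.obj (β.zeroAt j)) [IsIso ρ] :
    IsIso (twistDiagramMap L L' hij h ρ) := by
  have := L.isIso_twistMap (h.isTop_eq hij) (F.obj (β.zeroAt j))
  dsimp only [twistDiagramMap, twistDiagram]
  infer_instance

theorem twistDiagramMap_ex1 (hij : i ≠ j) {β α γ : Box r} (h : IsTranslate i γ β) (hβα : β ≤ α)
    (hαγ : α ≤ γ) (ρ : F.obj (γ.zeroAt j) ⟶ L'.L ⊗ F.obj (β.zeroAt j))
    (H : F.map (homOfLE (Box.zeroAt_mono hαγ j)) ≫ ρ ≫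
      L'.L ◁ F.map (homOfLE (Box.zeroAt_mono hβα j)) = L'.mulSection (F.obj (α.zeroAt j))) :
    (twistDiagram L j F).map (homOfLE hαγ) ≫ twistDiagramMap L L' hij h ρ ≫
      L'.L ◁ (twistDiagram L j F).map (homOfLE hβα) =
        L'.mulSection ((twistDiagram L j F).obj α) := by
  -- A translation in direction `i ≠ j` leaves coordinate `j` alone, so `α`, lying between `β` and
  -- `γ`, carries the same twist.
  have hb : γ.isTop j ≤ α.isTop j := (h.isTop_eq hij).le.trans (Box.isTop_mono j hβα)
  have H' := congrArg (fun f => (L.twist (γ.isTop j)).map f) H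
  simp only [Functor.map_comp] at H'
  dsimp only [twistDiagram, twistDiagramMap]
  simp only [Category.assoc]
  rw [← whiskerLeft_comp, reassoc_of% L.twistMap_trans, ← L.twistMap_naturality, whiskerLeft_comp,
    ← reassoc_of% L.twistSwap_naturality, reassoc_of% H', reassoc_of% L.map_mulSection_twistSwap,
    ← Scheme.Modules.mulSection_naturality, reassoc_of% L.twistMap_trans, L.twistMap_self,
    Category.id_comp]

theorem twistDiagramMap_ex2 (hij : i ≠ j) {α β α' β' : Box r} (h : IsTranslate i α β)
    (h' : IsTranslate i α' β') (hα : α ≤ α') (hβ : β ≤ β')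
    (ρ : F.obj (α.zeroAt j) ⟶ L'.L ⊗ F.obj (β.zeroAt j))
    (ρ' : F.obj (α'.zeroAt j) ⟶ L'.L ⊗ F.obj (β'.zeroAt j))
    (H : F.map (homOfLE (Box.zeroAt_mono hα j)) ≫ ρ' =
      ρ ≫ L'.L ◁ F.map (homOfLE (Box.zeroAt_mono hβ j))) :
    (twistDiagram L j F).map (homOfLE hα) ≫ twistDiagramMap L L' hij h' ρ' =
      twistDiagramMap L L' hij h ρ ≫ L'.L ◁ (twistDiagram L j F).map (homOfLE hβ) := by
  have H' := congrArg (fun f => (L.twist (α'.isTop j)).map f) H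
  simp only [Functor.map_comp] at H'
  dsimp only [twistDiagram, twistDiagramMap]
  simp only [Category.assoc]
  rw [reassoc_of% H', reassoc_of% L.twistSwap_naturality, ← whiskerLeft_comp, L.twistMap_naturality,
    ← whiskerLeft_comp, reassoc_of% L.twistMap_trans, reassoc_of% (L.twistMap_naturality _ ρ).symm,
    reassoc_of% L.twistMap_twistSwap, ← whiskerLeft_comp, reassoc_of% L.twistMap_trans]

theorem twistDiagramMap_comp {i' : ι} (L'' : LineBundleWithSection X) (hij : i ≠ j) (hij' : i' ≠ j)
    {α β δ : Box r} (h : IsTranslate i α β) (h' : IsTranslate i' β δ)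
    (ρ : F.obj (α.zeroAt j) ⟶ L'.L ⊗ F.obj (β.zeroAt j))
    (ρ' : F.obj (β.zeroAt j) ⟶ L''.L ⊗ F.obj (δ.zeroAt j)) :
    twistDiagramMap L L' hij h ρ ≫ L'.L ◁ twistDiagramMap L L'' hij' h' ρ' =
      (L.twist (α.isTop j)).map (ρ ≫ L'.L ◁ ρ') ≫
        (L.twistSwap L' (α.isTop j) (L''.L ⊗ F.obj (δ.zeroAt j))).hom ≫
          L'.L ◁ (L.twistSwap L'' (α.isTop j) (F.obj (δ.zeroAt j))).hom ≫
            L'.L ◁ L''.L ◁ L.twistMap ((h.isTop_eq hij).le.trans (h'.isTop_eq hij').le)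
              (F.obj (δ.zeroAt j)) := by
  dsimp only [twistDiagram, twistDiagramMap]
  simp only [Category.assoc]
  rw [← whiskerLeft_comp, reassoc_of% (L.twistMap_naturality _ ρ').symm,
    reassoc_of% L.twistMap_twistSwap, ← whiskerLeft_comp, L.twistMap_trans, CategoryTheory.Functor.map_comp,
    Category.assoc, reassoc_of% L.twistSwap_naturality, ← whiskerLeft_comp, ← whiskerLeft_comp]

theorem twistDiagramMap_ex3 {i' : ι} (L'' : LineBundleWithSection X) (hij : i ≠ j) (hij' : i' ≠ j)
    {α β γ δ : Box r} (hαβ : IsTranslate i α β) (hαγ : IsTranslate i' α γ)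
    (hβδ : IsTranslate i' β δ) (hγδ : IsTranslate i γ δ)
    (ρ₁ : F.obj (α.zeroAt j) ⟶ L'.L ⊗ F.obj (β.zeroAt j))
    (ρ₂ : F.obj (β.zeroAt j) ⟶ L''.L ⊗ F.obj (δ.zeroAt j))
    (ρ₃ : F.obj (α.zeroAt j) ⟶ L''.L ⊗ F.obj (γ.zeroAt j))
    (ρ₄ : F.obj (γ.zeroAt j) ⟶ L'.L ⊗ F.obj (δ.zeroAt j))
    (H : ρ₁ ≫ L'.L ◁ ρ₂ = ρ₃ ≫ L''.L ◁ ρ₄ ≫ swap L''.L L'.L _) :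
    twistDiagramMap L L' hij hαβ ρ₁ ≫ L'.L ◁ twistDiagramMap L L'' hij' hβδ ρ₂ =
      twistDiagramMap L L'' hij' hαγ ρ₃ ≫ L''.L ◁ twistDiagramMap L L' hij hγδ ρ₄ ≫
        swap L''.L L'.L _ := by
  refine (twistDiagramMap_comp L L' L'' hij hij' hαβ hβδ ρ₁ ρ₂).trans ?_
  refine Eq.trans ?_ (Category.assoc _ _ _)
  refine Eq.trans ?_ (congrArg (· ≫ swap L''.L L'.L _)
    (twistDiagramMap_comp L L'' L' hij' hij hαγ hγδ ρ₃ ρ₄)).symm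
  dsimp only [twistDiagram]
  have H' : ρ₁ ≫ L'.L ◁ ρ₂ = (ρ₃ ≫ L''.L ◁ ρ₄) ≫ swap L''.L L'.L _ := by rw [H, Category.assoc]
  rw [H', CategoryTheory.Functor.map_comp, Category.assoc, Category.assoc, Category.assoc,
    Category.assoc, swap_naturality, ← reassoc_of% L.map_swap_twistSwap L'' L']

/-- In direction `j` the pseudo-period map is a transition map of `F` up to twists, so EX3 for the
pair `i`, `j` reduces to EX2 in direction `i`. -/
theorem twistDiagramMap_self_ex3 (hij : i ≠ j)
    {α β γ δ : Box r} (hαβ : IsTranslate i α β) (hαγ : IsTranslate j α γ)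
    (hβδ : IsTranslate j β δ) (hγδ : IsTranslate i γ δ)
    (ρ₁ : F.obj (α.zeroAt j) ⟶ L'.L ⊗ F.obj (β.zeroAt j))
    (ρ₂ : F.obj (γ.zeroAt j) ⟶ L'.L ⊗ F.obj (δ.zeroAt j))
    (H : F.map (homOfLE (hαγ.zeroAt_eq.trans (Box.zeroAt_eq_self hαγ.bot).symm).le) ≫ ρ₂ =
      ρ₁ ≫ L'.L ◁ F.map (homOfLE (hβδ.zeroAt_eq.trans (Box.zeroAt_eq_self hβδ.bot).symm).le)) :
    twistDiagramMap L L' hij hαβ ρ₁ ≫ L'.L ◁ twistDiagramSelf L j F β δ hβδ =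
      twistDiagramSelf L j F α γ hαγ ≫ L.L ◁ twistDiagramMap L L' hij hγδ ρ₂ ≫
        swap L.L L'.L _ := by
  dsimp only [twistDiagram, twistDiagramSelf, twistDiagramMap]
  simp only [Category.assoc]
  rw [← reassoc_of% (whiskerLeft_comp L.L), Category.assoc, ← reassoc_of% L.ofBase_naturality,
    reassoc_of% L.ofBase_twistSwap, ← whiskerLeft_comp, ← whiskerLeft_comp L'.L, L.ofBase_twistMap,
    reassoc_of% H, reassoc_of% L.twistMap_toTensor, ← whiskerLeft_comp L'.L, whiskerLeft_comp L.L ρ₁,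
    Category.assoc, swap_naturality, ← reassoc_of% L.toTensor_naturality,
    reassoc_of% L.toTensor_swap, ← whiskerLeft_comp L'.L]

end

section
variable {X : Scheme.{u}} {ι : Type} {D : ι → LineBundleWithSection X} {r : ι → ℕ}
  [DecidableEq ι] {J : Finset ι} (P : PartialPair D r J) {j : ι}

/-- The pseudo-period maps after adjoining the direction `j`. -/
noncomputable def PartialPair.insertMap (i : ι) (hi : i ∈ insert j J) (α β : Box r)
    (h : IsTranslate i α β) :
    (twistDiagram (D j) j P.F).obj α ⟶ (D i).L ⊗ (twistDiagram (D j) j P.F).obj β :=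
  if hij : i = j then
    twistDiagramSelf (D j) j P.F α β (hij ▸ h) ≫ eqToHom (by rw [hij])
  else
    twistDiagramMap (D j) (D i) hij h
      (P.ρ i ((Finset.mem_insert.1 hi).resolve_left hij) _ _ (h.zeroAt hij)).hom

theorem PartialPair.insertMap_self (hi : j ∈ insert j J) (α β : Box r) (h : IsTranslate j α β) :
    P.insertMap j hi α β h = twistDiagramSelf (D j) j P.F α β h :=
  (dif_pos rfl).trans (Category.comp_id _)

theorem PartialPair.insertMap_of_ne {i : ι} (hi : i ∈ insert j J) (hij : i ≠ j) (α β : Box r)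
    (h : IsTranslate i α β) :
    P.insertMap i hi α β h = twistDiagramMap (D j) (D i) hij h
      (P.ρ i ((Finset.mem_insert.1 hi).resolve_left hij) _ _ (h.zeroAt hij)).hom :=
  dif_neg hij

theorem PartialPair.isIso_insertMap (hr : 0 < r j) (i : ι) (hi : i ∈ insert j J) (α β : Box r)
    (h : IsTranslate i α β) : IsIso (P.insertMap i hi α β h) := by
  by_cases hij : i = j
  · subst hij
    rw [P.insertMap_self]
    exact isIso_twistDiagramSelf _ _ _ hr _ _ _
  · rw [P.insertMap_of_ne hi hij]
    exact isIso_twistDiagramMap _ _ _ _ _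

/-- A diagram with pseudo-period isomorphisms in the directions `J`, made constant in direction `j`
up to a twist on the maximal face. -/
noncomputable def PartialPair.insert (hr : 0 < r j) : PartialPair D r (insert j J) where
  F := twistDiagram (D j) j P.F
  coherent α := LineBundleWithSection.coherent_twist (P.coherent _) _
  ρ i hi α β h := @asIso _ _ _ _ (P.insertMap i hi α β h) (P.isIso_insertMap hr i hi α β h)
  ex1 i hi β α γ h hβα hαγ := by
    rw [asIso_hom]
    by_cases hij : i = j
    · subst hij
      rw [P.insertMap_self]
      exact twistDiagramSelf_ex1 _ _ _ _ _ _ _ _ _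
    · rw [P.insertMap_of_ne hi hij]
      exact twistDiagramMap_ex1 _ _ _ _ _ _ _ (P.ex1 _ _ _ _ _ _ _ _)
  ex2 i hi α β α' β' h h' hα hβ := by
    rw [asIso_hom, asIso_hom]
    by_cases hij : i = j
    · subst hij
      rw [P.insertMap_self, P.insertMap_self]
      exact twistDiagramSelf_ex2 _ _ _ _ _ _ _ _ _ _ _
    · rw [P.insertMap_of_ne hi hij, P.insertMap_of_ne hi hij]
      exact twistDiagramMap_ex2 _ _ _ _ _ _ _ _ _ (P.ex2 _ _ _ _ _ _ _ _ _ _)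
  ex3 i i' hi hi' hii' α β γ δ hαβ hαγ hβδ hγδ := by
    simp only [asIso_hom]
    by_cases hij : i = j
    · subst hij
      have hij' := hii'.symm
      rw [P.insertMap_self, P.insertMap_self, P.insertMap_of_ne hi' hij', P.insertMap_of_ne hi' hij']
      -- The relation is the one for `i' = j` with the roles exchanged; the two swaps are inverse to
      -- each other.
      have := twistDiagramMap_self_ex3 (D i) (D i') (F := P.F) hij' hαγ hαβ hγδ hβδ _ _
        (P.ex2 i' ((Finset.mem_insert.1 hi').resolve_left hij') _ _ _ _
          (hαγ.zeroAt hij') (hβδ.zeroAt hij') _ _)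
      rw [← Category.assoc, this, Category.assoc, Category.assoc, swap_swap, Category.comp_id]
    · by_cases hij' : i' = j
      · subst hij'
        rw [P.insertMap_self, P.insertMap_self, P.insertMap_of_ne hi hij, P.insertMap_of_ne hi hij]
        exact twistDiagramMap_self_ex3 _ _ _ _ _ _ _ _ _ (P.ex2 _ _ _ _ _ _ _ _ _ _)
      · rw [P.insertMap_of_ne hi hij, P.insertMap_of_ne hi hij, P.insertMap_of_ne hi' hij',
          P.insertMap_of_ne hi' hij']
        exact twistDiagramMap_ex3 _ _ _ _ _ _ _ _ _ _ _ _ _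
          (P.ex3 _ _ _ _ hii' _ _ _ _ (hαβ.zeroAt hij) (hαγ.zeroAt hij') (hβδ.zeroAt hij') (hγδ.zeroAt hij))

end
end ExtendablePair

/-! ### The universal property of adjoining directions -/

namespace LineBundleWithSection
variable {X : Scheme.{u}} (D D' : LineBundleWithSection X)

theorem twistSwap_toBase {b : Bool} (hb : b = false) (M : X.Modules) :
    (D.twistSwap D' b M).hom ≫ D'.L ◁ D.toBase hb M = D.toBase hb (D'.L ⊗ M) := by
  subst hb
  exact (Category.id_comp _).trans (whiskerLeft_id D'.L M)

end LineBundleWithSection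

namespace ExtendablePair
section
variable {X : Scheme.{u}} {ι : Type} {D : ι → LineBundleWithSection X} {r : ι → ℕ}
  (E : ExtendablePair D r)

/-- EX1 at the bottom index `v'`, moved to `u` by naturality of multiplication by the section. It
handles transition maps that enter a maximal face. -/
theorem map_comp_ρ {i : ι} {u v v' : Box r} (h : IsTranslate i v v') (hv : v' ≤ v) (hu : u ≤ v') :
    E.F.map (homOfLE (hu.trans hv)) ≫ (E.ρ i v v' h).hom =
      (D i).mulSection (E.F.obj u) ≫ (D i).L ◁ E.F.map (homOfLE hu) := by
  have h1 := E.ex1 i v' v' v h le_rfl hv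
  have h2 : E.F.map (homOfLE (le_refl v')) = 𝟙 _ := E.F.map_id _
  rw [h2, whiskerLeft_id, Category.comp_id] at h1
  rw [← map_homOfLE_comp E.F hu hv, Category.assoc, h1, Scheme.Modules.mulSection_naturality]

variable [DecidableEq ι] {J : Finset ι} {P : PartialPair D r J}

/-- Compatibility of a natural transformation with the pseudo-period isomorphisms. -/
def PartialPair.IsCompatible (P : PartialPair D r J) {E : ExtendablePair D r} (g : P.F ⟶ E.F) : Prop :=
  ∀ (i : ι) (hi : i ∈ J) (α β : Box r) (h : IsTranslate i α β),
    (P.ρ i hi α β h).hom ≫ (D i).L ◁ g.app β = g.app α ≫ (E.ρ i α β h).hom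

variable {E} {j : ι} {F : Box r ⥤ X.Modules} (g : F ⟶ E.F)

/-- The components of the extension of a morphism to `twistDiagram`. -/
noncomputable def twistDescApp (j : ι) (g : F ⟶ E.F) (u : Box r) :
    ((D j).twist (u.isTop j)).obj (F.obj (u.zeroAt j)) ⟶ E.F.obj u :=
  if h : u.1 j = r j then
    (D j).toTensor _ _ ≫ (D j).L ◁ g.app (u.zeroAt j) ≫
      (E.ρ j u (u.zeroAt j) (Box.isTranslate_zeroAt h)).inv
  else
    (D j).toBase (Box.isTop_eq_false h) _ ≫ g.app (u.zeroAt j) ≫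
      E.F.map (homOfLE (u.zeroAt_le j))

theorem twistDescApp_comp_ρ {α β : Box r} (h : IsTranslate j α β) :
    twistDescApp j g α ≫ (E.ρ j α β h).hom =
      (D j).toTensor _ _ ≫ (D j).L ◁ (g.app (α.zeroAt j) ≫ E.F.map (homOfLE h.zeroAt_eq.le)) := by
  obtain rfl := h.zeroAt_eq
  have h2 : E.F.map (homOfLE (le_refl (α.zeroAt j))) = 𝟙 _ := E.F.map_id _
  rw [h2, Category.comp_id, twistDescApp, dif_pos h.top, Category.assoc, Category.assoc,
    Iso.inv_hom_id, Category.comp_id]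

theorem twistDescApp_of_ne {u : Box r} (h : u.1 j ≠ r j) :
    twistDescApp j g u = (D j).toBase (Box.isTop_eq_false h) _ ≫ g.app (u.zeroAt j) ≫
      E.F.map (homOfLE (u.zeroAt_le j)) :=
  dif_neg h

/-- Inside the maximal face this is EX2 of `E`, for a map entering that face it is EX1 in the form
`map_comp_ρ`, and away from the face it is naturality of `g`. -/
theorem twistDescApp_naturality {u v : Box r} (huv : u ≤ v) :
    (twistDiagram (D j) j F).map (homOfLE huv) ≫ twistDescApp j g v =
      twistDescApp j g u ≫ E.F.map (homOfLE huv) := by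
  have hg := g.naturality (homOfLE (Box.zeroAt_mono huv j))
  dsimp only [twistDiagram]
  by_cases hv : v.1 j = r j
  · rw [← cancel_mono (E.ρ j v _ (Box.isTranslate_zeroAt hv)).hom, Category.assoc,
      twistDescApp_comp_ρ, Category.assoc]
    rw [Category.assoc, reassoc_of% (D j).toTensor_naturality,
      reassoc_of% (D j).twistMap_toTensor, ← whiskerLeft_comp, reassoc_of% hg]
    by_cases hu : u.1 j = r j
    · rw [E.ex2 j u (u.zeroAt j) v (v.zeroAt j) (Box.isTranslate_zeroAt hu)
        (Box.isTranslate_zeroAt hv) huv (Box.zeroAt_mono huv j), reassoc_of% (twistDescApp_comp_ρ g),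
        ← whiskerLeft_comp, Category.assoc, map_homOfLE_comp, map_homOfLE_comp]
    · rw [twistDescApp_of_ne g hu, Category.assoc, Category.assoc,
        reassoc_of% (map_homOfLE_comp E.F),
        E.map_comp_ρ (Box.isTranslate_zeroAt hv) (v.zeroAt_le j) (Box.zeroAt_mono huv j),
        reassoc_of% (Scheme.Modules.mulSection_naturality (D j)),
        reassoc_of% (D j).toBase_mulSection, ← whiskerLeft_comp, map_homOfLE_comp]
  · have hu : u.1 j ≠ r j := fun hu => hv (le_antisymm (v.2 j) (hu ▸ huv j))
    rw [twistDescApp_of_ne g hu, twistDescApp_of_ne g hv, Category.assoc, reassoc_of% (D j).toBase_naturality, reassoc_of% (D j).twistMap_toBase,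
      reassoc_of% hg, map_homOfLE_comp, Category.assoc, Category.assoc, map_homOfLE_comp]

/-- The extension of a morphism to `twistDiagram`. -/
noncomputable def twistDesc (j : ι) (g : F ⟶ E.F) : twistDiagram (D j) j F ⟶ E.F where
  app := twistDescApp j g
  naturality _ _ f := twistDescApp_naturality g (leOfHom f)

theorem twistDescApp_self (hr : 0 < r j) {α β : Box r} (h : IsTranslate j α β) :
    twistDiagramSelf (D j) j F α β h ≫ (D j).L ◁ twistDescApp j g β =
      twistDescApp j g α ≫ (E.ρ j α β h).hom := by
  have hb : β.1 j ≠ r j := fun e => hr.ne (h.bot.symm.trans e)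
  have hle := (h.zeroAt_eq.trans (Box.zeroAt_eq_self h.bot).symm).le
  have hg := g.naturality (homOfLE hle)
  dsimp only [twistDiagramSelf, twistDiagram]
  rw [twistDescApp_comp_ρ, twistDescApp_of_ne g hb, Category.assoc, ← whiskerLeft_comp, Category.assoc, reassoc_of% (D j).ofBase_toBase,
    reassoc_of% hg, map_homOfLE_comp]

theorem twistDescApp_map {i : ι} (hij : i ≠ j) {α β : Box r} (h : IsTranslate i α β)
    (ρ : F.obj (α.zeroAt j) ⟶ (D i).L ⊗ F.obj (β.zeroAt j))
    (H : ρ ≫ (D i).L ◁ g.app (β.zeroAt j) =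
      g.app (α.zeroAt j) ≫ (E.ρ i _ _ (h.zeroAt hij)).hom) :
    twistDiagramMap (D j) (D i) hij h ρ ≫ (D i).L ◁ twistDescApp j g β =
      twistDescApp j g α ≫ (E.ρ i α β h).hom := by
  dsimp only [twistDiagramMap, twistDiagram]
  by_cases hα : α.1 j = r j
  · have hβ : β.1 j = r j := (h.eq j hij.symm).symm.trans hα
    have h1 := Box.isTranslate_zeroAt hα
    have h2 := Box.isTranslate_zeroAt hβ
    -- On the maximal face in direction `j` the morphism is defined through the isomorphism `ρ` in
    -- that direction, so EX3 is needed to compare it with the one in direction `i`.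
    have h3 := E.ex3 i j hij α β _ _ h h1 h2 (h.zeroAt hij)
    have h4 : E.F.map (homOfLE (le_refl (α.zeroAt j))) = 𝟙 _ := E.F.map_id _
    have h5 : E.F.map (homOfLE (le_refl (β.zeroAt j))) = 𝟙 _ := E.F.map_id _
    rw [← cancel_mono ((D i).L ◁ (E.ρ j β _ h2).hom), Category.assoc, ← whiskerLeft_comp,
      twistDescApp_comp_ρ, Category.assoc]
    refine Eq.trans ?_ (congrArg (twistDescApp j g α ≫ ·) h3).symm
    refine Eq.trans ?_ (congrArg (· ≫ (D j).L ◁ (E.ρ i _ _ (h.zeroAt hij)).hom ≫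
      swap (D j).L (D i).L (E.F.obj (β.zeroAt j))) (twistDescApp_comp_ρ g h1)).symm
      |>.trans (Category.assoc _ _ _)
    rw [h4, h5, Category.comp_id, Category.comp_id]
    rw [Category.assoc, Category.assoc, ← whiskerLeft_comp,
      reassoc_of% (D j).twistMap_toTensor, whiskerLeft_comp,
      ← reassoc_of% (D j).toTensor_swap, ← swap_naturality, reassoc_of% (D j).toTensor_naturality,
      ← reassoc_of% (whiskerLeft_comp (D j).L), H, whiskerLeft_comp, Category.assoc]
  · have hβ : β.1 j ≠ r j := fun hβ => hα ((h.eq j hij.symm).trans hβ)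
    rw [twistDescApp_of_ne g hα, twistDescApp_of_ne g hβ]
    simp only [Category.assoc]
    rw [E.ex2 i _ _ _ _ (h.zeroAt hij) h (α.zeroAt_le j) (β.zeroAt_le j), ← reassoc_of% H,
      ← whiskerLeft_comp, ← whiskerLeft_comp, reassoc_of% (D j).twistMap_toBase,
      whiskerLeft_comp, reassoc_of% ((D j).twistSwap_toBase (D i)),
      reassoc_of% (D j).toBase_naturality]

theorem PartialPair.isCompatible_twistDesc (hr : 0 < r j) {g : P.F ⟶ E.F} (hg : P.IsCompatible g) :
    (P.insert hr).IsCompatible (twistDesc j g) := by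
  intro i hi α β h
  by_cases hij : i = j
  · subst hij
    refine (congrArg (· ≫ _) (P.insertMap_self hi α β h)).trans ?_
    exact twistDescApp_self g hr h
  · refine (congrArg (· ≫ _) (P.insertMap_of_ne hi hij α β h)).trans ?_
    exact twistDescApp_map g hij h _ (hg _ _ _ _ _)

/-- Extendable pairs are determined by partial ones which are constant in the other directions. -/
structure PartialPair.Extension (P : PartialPair D r J) (K : Finset ι) where
  /-- the extension -/
  obj : PartialPair D r K
  /-- the comparison away from the maximal faces -/
  φ : ∀ u : Box r, (∀ i, u.1 i < r i) → (obj.F.obj u ⟶ P.F.obj u)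
  isIso_φ : ∀ u hu, IsIso (φ u hu)
  naturality : ∀ (u v : Box r) (hu : ∀ i, u.1 i < r i) (hv : ∀ i, v.1 i < r i) (huv : u ≤ v),
    obj.F.map (homOfLE huv) ≫ φ v hv = φ u hu ≫ P.F.map (homOfLE huv)
  exists_desc : ∀ (E : ExtendablePair D r) (g : P.F ⟶ E.F), P.IsCompatible g →
    ∃ g' : obj.F ⟶ E.F, obj.IsCompatible g' ∧ ∀ u hu, g'.app u = φ u hu ≫ g.app u

theorem _root_.Box.zeroAt_lt {u : Box r} (hr : ∀ i, 0 < r i) (hu : ∀ i, u.1 i < r i) (j i : ι) :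
    (u.zeroAt j).1 i < r i := by
  by_cases h : i = j
  · subst h; simpa using hr i
  · simpa [h] using hu i

/-- Adjoining one direction to an extension. -/
noncomputable def PartialPair.Extension.insert (hr : ∀ i, 0 < r i) {K : Finset ι}
    (A : P.Extension K) (j : ι)
    (hP : ∀ u : Box r, (∀ i, u.1 i < r i) → IsIso (P.F.map (homOfLE (u.zeroAt_le j)))) :
    P.Extension (Insert.insert j K) where
  obj := A.obj.insert (hr j)
  φ u hu := (D j).toBase (Box.isTop_eq_false (hu j).ne) _ ≫ A.φ _ (Box.zeroAt_lt hr hu j) ≫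
    P.F.map (homOfLE (u.zeroAt_le j))
  isIso_φ u hu := by
    have := (D j).isIso_toBase (Box.isTop_eq_false (hu j).ne) (A.obj.F.obj (u.zeroAt j))
    have := A.isIso_φ _ (Box.zeroAt_lt hr hu j)
    have := hP u hu
    dsimp only [PartialPair.insert, twistDiagram]
    infer_instance
  naturality u v hu hv huv := by
    dsimp only [PartialPair.insert, twistDiagram]
    rw [Category.assoc, reassoc_of% (D j).toBase_naturality, reassoc_of% (D j).twistMap_toBase,
      reassoc_of% (A.naturality _ _ (Box.zeroAt_lt hr hu j) (Box.zeroAt_lt hr hv j)), map_homOfLE_comp,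
      Category.assoc, Category.assoc, map_homOfLE_comp]
  exists_desc E g hg := by
    obtain ⟨g', hg', h⟩ := A.exists_desc E g hg
    refine ⟨twistDesc j g', A.obj.isCompatible_twistDesc (hr j) hg', fun u hu => ?_⟩
    refine (twistDescApp_of_ne g' (hu j).ne).trans ?_
    have hn := g.naturality (homOfLE (u.zeroAt_le j))
    dsimp only [PartialPair.insert, twistDiagram]
    rw [h _ (Box.zeroAt_lt hr hu j), Category.assoc, Category.assoc, Category.assoc, hn]

/-- The missing directions are adjoined one after another. Each step replaces the value at `u` by
the value at `u.zeroAt j`; constancy of `P` in that direction ensures that nothing changes away from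
the maximal faces. -/
theorem PartialPair.exists_extension (hr : ∀ i, 0 < r i) (P : PartialPair D r J)
    (hP : ∀ j ∉ J, ∀ u : Box r, (∀ i, u.1 i < r i) → IsIso (P.F.map (homOfLE (u.zeroAt_le j))))
    (K : Finset ι) (hK : Disjoint K J) : Nonempty (P.Extension (K ∪ J)) := by
  induction K using Finset.induction_on with
  | empty =>
    rw [Finset.empty_union]
    exact ⟨{  obj := P
              φ := fun u _ => 𝟙 _
              isIso_φ := fun _ _ => inferInstance
              naturality := fun _ _ _ _ _ => by rw [Category.comp_id, Category.id_comp]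
              exists_desc := fun E g hg => ⟨g, hg, fun _ _ => (Category.id_comp _).symm⟩ }⟩
  | insert j K _ ih =>
    rw [Finset.disjoint_insert_left] at hK
    obtain ⟨A⟩ := ih hK.2
    rw [Finset.insert_union]
    exact ⟨A.insert hr j (hP j hK.1)⟩

/-- Diagrams with pseudo-period isomorphisms in all directions are extendable pairs. -/
def PartialPair.toExtendablePair (P : PartialPair D r J) (hJ : ∀ i, i ∈ J) : ExtendablePair D r where
  F := P.F
  coherent := P.coherent
  ρ i := P.ρ i (hJ i)
  ex1 i := P.ex1 i (hJ i)
  ex2 i := P.ex2 i (hJ i)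
  ex3 i j := P.ex3 i j (hJ i) (hJ j)

/-- Compatibility with the isomorphisms `ρ` determines a morphism on the maximal faces. -/
theorem hom_ext_of_lt [Fintype ι] (hr : ∀ i, 0 < r i) {E E' : ExtendablePair D r} {f g : E ⟶ E'}
    (h : ∀ u : Box r, (∀ i, u.1 i < r i) → (Hom.app f).app u = (Hom.app g).app u) : f = g := by
  refine Hom.ext (NatTrans.ext (funext fun u => ?_))
  induction u using Box.induction_top hr with
  | base u hu => exact h u hu
  | step i u hu ih =>
    have h := Box.isTranslate_zeroAt hu
    rw [← cancel_mono (E'.ρ i _ _ h).hom, ← Hom.comm f i _ _ h, ← Hom.comm g i _ _ h, ih]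

end
end ExtendablePair

/-! ### Extension by zero from the interior of a face -/

namespace ExtendablePair

section
open scoped ZeroObject
open scoped Classical in
/-- Extension by zero of a diagram on the interior of the face `T`, constant in the directions
outside `T`. -/
noncomputable def zeroExtendObj {C : Type*} [Category C] [HasZeroObject C] {n : ℕ} {r : Fin n → ℕ}
    {T : Finset (Fin n)} (H : InteriorBox (fun i : T => r i) ⥤ C) (u : Box r) : C :=
  if h : ∀ i ∈ T, 1 ≤ u.1 i ∧ u.1 i + 1 ≤ r i then H.obj (interiorProj r T u h) else 0

variable {C : Type*} [Category C] [HasZeroObject C] [HasZeroMorphisms C] {n : ℕ} {r : Fin n → ℕ}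
    {T : Finset (Fin n)} (H : InteriorBox (fun i : T => r i) ⥤ C)

theorem interiorProj_mono {u v : Box r} (huv : u ≤ v)
    (hu : ∀ i ∈ T, 1 ≤ u.1 i ∧ u.1 i + 1 ≤ r i) (hv : ∀ i ∈ T, 1 ≤ v.1 i ∧ v.1 i + 1 ≤ r i) :
    interiorProj r T u hu ≤ interiorProj r T v hv := fun i => huv i

omit [HasZeroMorphisms C] in
theorem isZero_zeroExtendObj {u : Box r} (h : ¬ ∀ i ∈ T, 1 ≤ u.1 i ∧ u.1 i + 1 ≤ r i) :
    IsZero (zeroExtendObj H u) := by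
  rw [zeroExtendObj, dif_neg h]
  exact isZero_zero C

/-- The values of the extension by zero in the interior. -/
noncomputable def zeroExtendIso {u : Box r} (h : ∀ i ∈ T, 1 ≤ u.1 i ∧ u.1 i + 1 ≤ r i) :
    zeroExtendObj H u ≅ H.obj (interiorProj r T u h) :=
  eqToIso (dif_pos h)

open scoped Classical in
/-- The transition maps of the extension by zero. -/
noncomputable def zeroExtendMap {u v : Box r} (huv : u ≤ v) :
    zeroExtendObj H u ⟶ zeroExtendObj H v :=
  if h : (∀ i ∈ T, 1 ≤ u.1 i ∧ u.1 i + 1 ≤ r i) ∧ (∀ i ∈ T, 1 ≤ v.1 i ∧ v.1 i + 1 ≤ r i) then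
    (zeroExtendIso H h.1).hom ≫ H.map (homOfLE (interiorProj_mono huv h.1 h.2)) ≫
      (zeroExtendIso H h.2).inv
  else 0

theorem zeroExtendMap_eq {u v : Box r} (huv : u ≤ v) (hu : ∀ i ∈ T, 1 ≤ u.1 i ∧ u.1 i + 1 ≤ r i)
    (hv : ∀ i ∈ T, 1 ≤ v.1 i ∧ v.1 i + 1 ≤ r i) :
    zeroExtendMap H huv = (zeroExtendIso H hu).hom ≫
      H.map (homOfLE (interiorProj_mono huv hu hv)) ≫ (zeroExtendIso H hv).inv :=
  dif_pos ⟨hu, hv⟩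

/-- Extension by zero of a diagram on the interior of the face `T`, constant in the directions
outside `T`. -/
noncomputable def zeroExtend : Box r ⥤ C where
  obj := zeroExtendObj H
  map f := zeroExtendMap H (leOfHom f)
  map_id u := by
    by_cases h : ∀ i ∈ T, 1 ≤ u.1 i ∧ u.1 i + 1 ≤ r i
    · rw [zeroExtendMap_eq H _ h h]
      have : H.map (homOfLE (interiorProj_mono (le_refl u) h h)) = 𝟙 _ := H.map_id _
      rw [this, Category.id_comp, Iso.hom_inv_id]
    · exact (isZero_zeroExtendObj H h).eq_of_src _ _
  map_comp {u v w} f g := by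
    have hf := leOfHom f
    have hg := leOfHom g
    by_cases hu : ∀ i ∈ T, 1 ≤ u.1 i ∧ u.1 i + 1 ≤ r i
    · by_cases hw : ∀ i ∈ T, 1 ≤ w.1 i ∧ w.1 i + 1 ≤ r i
      · have hv : ∀ i ∈ T, 1 ≤ v.1 i ∧ v.1 i + 1 ≤ r i := fun i hi =>
          ⟨(hu i hi).1.trans (hf i), (Nat.succ_le_succ (hg i)).trans (hw i hi).2⟩
        rw [zeroExtendMap_eq H _ hu hw, zeroExtendMap_eq H _ hu hv, zeroExtendMap_eq H _ hv hw]
        simp only [Category.assoc, Iso.inv_hom_id_assoc]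
        rw [reassoc_of% (map_homOfLE_comp H)]
      · exact (isZero_zeroExtendObj H hw).eq_of_tgt _ _
    · exact (isZero_zeroExtendObj H hu).eq_of_src _ _

theorem isIso_zeroExtend_map {j : Fin n} (hj : j ∉ T) (u : Box r) :
    IsIso ((zeroExtend H).map (homOfLE (u.zeroAt_le j))) := by
  have hne : ∀ i ∈ T, i ≠ j := fun i hi e => hj (e ▸ hi)
  change IsIso (zeroExtendMap H (u.zeroAt_le j))
  by_cases hu : ∀ i ∈ T, 1 ≤ u.1 i ∧ u.1 i + 1 ≤ r i
  · have hu' : ∀ i ∈ T, 1 ≤ (u.zeroAt j).1 i ∧ (u.zeroAt j).1 i + 1 ≤ r i := fun i hi => by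
      rw [Box.zeroAt_of_ne _ (hne i hi)]; exact hu i hi
    rw [zeroExtendMap_eq H _ hu' hu]
    have : interiorProj r T (u.zeroAt j) hu' = interiorProj r T u hu := by
      ext i
      exact Box.zeroAt_of_ne _ (hne i i.2)
    have := isIso_map_homOfLE H this
    infer_instance
  · have hu' : ¬ ∀ i ∈ T, 1 ≤ (u.zeroAt j).1 i ∧ (u.zeroAt j).1 i + 1 ≤ r i := fun h => hu fun i hi => by
      have := h i hi
      rwa [Box.zeroAt_of_ne _ (hne i hi)] at this
    exact ⟨0, (isZero_zeroExtendObj H hu').eq_of_src _ _, (isZero_zeroExtendObj H hu).eq_of_src _ _⟩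

end

theorem _root_.IsTranslate.not_interior_top {n : ℕ} {r : Fin n → ℕ} {T : Finset (Fin n)} {i : Fin n}
    (hi : i ∈ T) {α β : Box r} (h : IsTranslate i α β) :
    ¬ ∀ i ∈ T, 1 ≤ α.1 i ∧ α.1 i + 1 ≤ r i := fun H => by
  have := (H i hi).2
  have := h.top
  omega

theorem _root_.IsTranslate.not_interior_bot {n : ℕ} {r : Fin n → ℕ} {T : Finset (Fin n)} {i : Fin n}
    (hi : i ∈ T) {α β : Box r} (h : IsTranslate i α β) :
    ¬ ∀ i ∈ T, 1 ≤ β.1 i ∧ β.1 i + 1 ≤ r i := fun H => by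
  have := (H i hi).1
  have := h.bot
  omega

variable {X : Scheme.{u}} {n : ℕ} (D : Fin n → LineBundleWithSection X) {r : Fin n → ℕ}
    {T : Finset (Fin n)} (H : InteriorBox (fun i : T => r i) ⥤ X.Modules)

/-- The extension by zero of a diagram killed by the sections, with zero pseudo-period
isomorphisms. -/
noncomputable def zeroExtendPair [IsLocallyNoetherian X]
    (hH : ∀ v, Scheme.Modules.coherent X (H.obj v))
    (hD : ∀ v, ∀ i ∈ T, (D i).mulSection (H.obj v) = 0) : PartialPair D r T where
  F := zeroExtend H
  coherent α := by
    by_cases h : ∀ i ∈ T, 1 ≤ α.1 i ∧ α.1 i + 1 ≤ r i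
    · exact (Scheme.Modules.coherent X).prop_of_iso (zeroExtendIso H h).symm (hH _)
    · exact (Scheme.Modules.coherent X).prop_of_isZero (isZero_zeroExtendObj H h)
  ρ i hi _ _ h := (isZero_zeroExtendObj H (h.not_interior_top hi)).iso
    ((tensorLeft (D i).L).map_isZero (isZero_zeroExtendObj H (h.not_interior_bot hi)))
  -- Both sides vanish: the composite passes through the value at `γ`, which is zero because `γ i =
  -- r i`, and `s_i` kills the values of `H`.
  ex1 i hi β α γ h hβα hαγ := by
    by_cases hα : ∀ i ∈ T, 1 ≤ α.1 i ∧ α.1 i + 1 ≤ r i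
    · have h1 : (D i).mulSection (zeroExtendObj H α) = 0 := by
        have h2 := Scheme.Modules.mulSection_naturality (D i) (zeroExtendIso H hα).inv
        rw [hD _ i hi, zero_comp] at h2
        rwa [← cancel_epi (zeroExtendIso H hα).inv, comp_zero]
      refine Eq.trans ?_ h1.symm
      exact (congrArg (· ≫ _) ((isZero_zeroExtendObj H (h.not_interior_top hi)).eq_of_tgt
        (zeroExtendMap H hαγ) 0)).trans zero_comp
    · exact (isZero_zeroExtendObj H hα).eq_of_src _ _
  ex2 i hi α β α' β' h h' hα hβ := (isZero_zeroExtendObj H (h.not_interior_top hi)).eq_of_src _ _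
  ex3 i j hi hj hij α β γ δ hαβ hαγ hβδ hγδ :=
    (isZero_zeroExtendObj H (hαβ.not_interior_top hi)).eq_of_src _ _

variable {D H}

/-- The components of a morphism to the restriction to the interior of a face. -/
def interiorApp {E : ExtendablePair D r} (m : H ⟶ (restrictInterior D r T).obj E)
    (v : InteriorBox (fun i : T => r i)) : H.obj v ⟶ E.F.obj (interiorInclusion r T v) :=
  m.app v

theorem interiorApp_naturality {E : ExtendablePair D r} (m : H ⟶ (restrictInterior D r T).obj E)
    {v w : InteriorBox (fun i : T => r i)} (h : v ≤ w) :
    H.map (homOfLE h) ≫ interiorApp m w =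
      interiorApp m v ≫ E.F.map (homOfLE (interiorInclusion_monotone r T h)) :=
  m.naturality (homOfLE h)

/-- The map from a diagram on the interior of the face `T`. -/
noncomputable def faceMap {E : ExtendablePair D r} (m : H ⟶ (restrictInterior D r T).obj E) (u : Box r)
    (hu : ∀ i ∈ T, 1 ≤ u.1 i ∧ u.1 i + 1 ≤ r i) :
    H.obj (interiorProj r T u hu) ⟶ E.F.obj u :=
  interiorApp m (interiorProj r T u hu) ≫
    E.F.map (homOfLE (interiorInclusion_interiorProj_le r T u hu))

theorem map_faceMap {E : ExtendablePair D r} (m : H ⟶ (restrictInterior D r T).obj E) {u v : Box r}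
    (huv : u ≤ v) (hu : ∀ i ∈ T, 1 ≤ u.1 i ∧ u.1 i + 1 ≤ r i)
    (hv : ∀ i ∈ T, 1 ≤ v.1 i ∧ v.1 i + 1 ≤ r i) :
    H.map (homOfLE (interiorProj_mono huv hu hv)) ≫ faceMap m v hv =
      faceMap m u hu ≫ E.F.map (homOfLE huv) := by
  rw [faceMap, faceMap, reassoc_of% (interiorApp_naturality m), map_homOfLE_comp, Category.assoc,
    map_homOfLE_comp]

theorem faceMap_comp {E E' : ExtendablePair D r} (m : H ⟶ (restrictInterior D r T).obj E)
    (f : E ⟶ E') (u : Box r) (hu : ∀ i ∈ T, 1 ≤ u.1 i ∧ u.1 i + 1 ≤ r i) :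
    faceMap (m ≫ (restrictInterior D r T).map f) u hu = faceMap m u hu ≫ (Hom.app f).app u := by
  have h : interiorApp (m ≫ (restrictInterior D r T).map f) (interiorProj r T u hu) =
    interiorApp m _ ≫ (Hom.app f).app _ := rfl
  rw [faceMap, faceMap, Category.assoc, (Hom.app f).naturality, h, Category.assoc]

/-- If `v ≥ u` is not interior along `T`, then `v i = r i` for some `i ∈ T`. The composite factors
through the value at `ι_T π_T u` with coordinate `i` raised to the maximum; its interior coordinates
lie in `T` without `i`, so that value is zero. -/
theorem faceMap_map_eq_zero {E : ExtendablePair D r}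
    (hE : zeroOn D {u : Box r | u.interior.card < T.card} E)
    (m : H ⟶ (restrictInterior D r T).obj E) {u v : Box r}
    (huv : u ≤ v) (hu : ∀ i ∈ T, 1 ≤ u.1 i ∧ u.1 i + 1 ≤ r i)
    (hv : ¬ ∀ i ∈ T, 1 ≤ v.1 i ∧ v.1 i + 1 ≤ r i) :
    faceMap m u hu ≫ E.F.map (homOfLE huv) = 0 := by
  push Not at hv
  obtain ⟨i, hi, hv⟩ := hv
  have h0 := interiorInclusion_interiorProj_le r T u hu
  have hvi : v.1 i = r i := le_antisymm (v.2 i) (Nat.lt_succ_iff.1 (hv ((hu i hi).1.trans (huv i))))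
  have hw : (interiorInclusion r T (interiorProj r T u hu)).topAt i ≤ v := fun j => by
    by_cases hj : j = i
    · subst hj; simp [hvi]
    · rw [Box.topAt_of_ne _ hj]; exact (h0 j).trans (huv j)
  have hz : IsZero (E.F.obj ((interiorInclusion r T (interiorProj r T u hu)).topAt i)) := by
    refine hE _ (Finset.card_lt_card ((Finset.ssubset_iff_of_subset fun j hj => ?_).2 ⟨i, hi, by simp⟩))
    by_contra hjT
    have hji : j ≠ i := fun e => hjT (e ▸ hi)
    rw [Box.mem_interior, Box.topAt_of_ne _ hji] at hj
    have := hj.1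
    simp [interiorInclusion, extendBox, hjT] at this
  rw [faceMap, Category.assoc, map_homOfLE_comp,
    ← map_homOfLE_comp E.F (Box.le_topAt _ i) hw, hz.eq_of_tgt (E.F.map (homOfLE (Box.le_topAt _ i))) 0]
  simp

open scoped Classical in
/-- The morphism from the extension by zero. -/
noncomputable def zeroExtendDesc {E : ExtendablePair D r}
    (hE : zeroOn D {u : Box r | u.interior.card < T.card} E)
    (m : H ⟶ (restrictInterior D r T).obj E) : zeroExtend H ⟶ E.F where
  app u := if hu : ∀ i ∈ T, 1 ≤ u.1 i ∧ u.1 i + 1 ≤ r i then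
    (zeroExtendIso H hu).hom ≫ faceMap m u hu else 0
  naturality u v f := by
    have huv := leOfHom f
    by_cases hu : ∀ i ∈ T, 1 ≤ u.1 i ∧ u.1 i + 1 ≤ r i
    · rw [dif_pos hu]
      by_cases hv : ∀ i ∈ T, 1 ≤ v.1 i ∧ v.1 i + 1 ≤ r i
      · rw [dif_pos hv]
        dsimp only [zeroExtend]
        rw [zeroExtendMap_eq H huv hu hv, Category.assoc, Category.assoc, Iso.inv_hom_id_assoc,
          map_faceMap m huv hu hv, Category.assoc]
        rfl
      · rw [dif_neg hv, comp_zero]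
        refine Eq.trans ?_ (Category.assoc _ _ _).symm
        exact ((congrArg ((zeroExtendIso H hu).hom ≫ ·) (faceMap_map_eq_zero hE m huv hu hv)).trans
          comp_zero).symm
    · exact (isZero_zeroExtendObj H hu).eq_of_src _ _

end ExtendablePair

/-! ### The extendable pair generated by a diagram on one face -/

namespace ExtendablePair
section
variable {n : ℕ} {r : Fin n → ℕ} {T : Finset (Fin n)}

theorem interiorInclusion_lt (hr : ∀ i, 0 < r i) (v : InteriorBox (fun i : T => r i)) (i : Fin n) :
    (interiorInclusion r T v).1 i < r i := by
  dsimp only [interiorInclusion, extendBox]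
  split_ifs with h
  · exact (v.2 ⟨i, h⟩).2
  · exact hr i

theorem interiorInclusion_apply (v : InteriorBox (fun i : T => r i)) (i : T) :
    (interiorInclusion r T v).1 i = v.1 i := by
  dsimp only [interiorInclusion, extendBox]
  rw [dif_pos i.2]

theorem interior_interiorInclusion (v : InteriorBox (fun i : T => r i)) (i : Fin n) (hi : i ∈ T) :
    1 ≤ (interiorInclusion r T v).1 i ∧ (interiorInclusion r T v).1 i + 1 ≤ r i := by
  rw [interiorInclusion_apply v ⟨i, hi⟩]
  exact v.2 ⟨i, hi⟩

theorem interiorProj_interiorInclusion (v : InteriorBox (fun i : T => r i)) :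
    interiorProj r T _ (interior_interiorInclusion v) = v := by
  ext i
  exact interiorInclusion_apply v i

theorem subset_interior {u : Box r} (hu : ∀ i ∈ T, 1 ≤ u.1 i ∧ u.1 i + 1 ≤ r i) : T ⊆ u.interior :=
  fun i hi => (Box.mem_interior u i).2 (hu i hi)
end

variable {X : Scheme.{u}} {n : ℕ} {D : Fin n → LineBundleWithSection X} {r : Fin n → ℕ}
    {T : Finset (Fin n)} {H : InteriorBox (fun i : T => r i) ⥤ X.Modules}

theorem zeroExtendDesc_app {E : ExtendablePair D r}
    (hE : zeroOn D {u : Box r | u.interior.card < T.card} E)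
    (m : H ⟶ (restrictInterior D r T).obj E) {u : Box r}
    (hu : ∀ i ∈ T, 1 ≤ u.1 i ∧ u.1 i + 1 ≤ r i) :
    (zeroExtendDesc hE m).app u = (zeroExtendIso H hu).hom ≫ faceMap m u hu :=
  dif_pos hu

theorem interiorApp_eq_faceMap {E : ExtendablePair D r} (m : H ⟶ (restrictInterior D r T).obj E)
    (v : InteriorBox (fun i : T => r i)) :
    interiorApp m v = H.map (homOfLE (interiorProj_interiorInclusion v).ge) ≫
      faceMap m _ (interior_interiorInclusion v) := by
  have h : E.F.map (homOfLE (le_refl (interiorInclusion r T v))) = 𝟙 _ := E.F.map_id _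
  rw [faceMap, reassoc_of% (interiorApp_naturality m), map_homOfLE_comp, h, Category.comp_id]

theorem restrictInterior_hom_ext {E : ExtendablePair D r} {m m' : H ⟶ (restrictInterior D r T).obj E}
    (h : ∀ v, interiorApp m v = interiorApp m' v) : m = m' :=
  NatTrans.ext (funext h)

/-- The properties of the extendable pair generated by a diagram on the interior of a face. -/
structure IsFaceExtension {E : ExtendablePair D r} (ψ : H ⟶ (restrictInterior D r T).obj E) : Prop where
  zeroOn : zeroOn D {u : Box r | u.interior.card < T.card} E
  isIso : ∀ (u : Box r) (_ : ∀ i, u.1 i < r i) (hu : ∀ i ∈ T, 1 ≤ u.1 i ∧ u.1 i + 1 ≤ r i),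
    IsIso (faceMap ψ u hu)
  isZero : ∀ (u : Box r) (_ : ∀ i, u.1 i < r i) (_ : ¬ ∀ i ∈ T, 1 ≤ u.1 i ∧ u.1 i + 1 ≤ r i),
    IsZero (E.F.obj u)
  existsUnique : ∀ (E' : ExtendablePair D r), ExtendablePair.zeroOn D {u : Box r | u.interior.card < T.card} E' →
    ∀ m : H ⟶ (restrictInterior D r T).obj E',
      ∃! h : E ⟶ E', ψ ≫ (restrictInterior D r T).map h = m

/-- The extension by zero is periodic in the directions of `T`, with zero isomorphisms, and constant
in the others, which are then adjoined by `exists_extension`. A morphism out of it exists by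
`zeroExtendDesc` and is unique because, off the maximal faces, the values are zero or reached by the
isomorphisms `faceMap ψ`. -/
theorem exists_isFaceExtension [IsLocallyNoetherian X] (hr : ∀ i, 0 < r i)
    (hH : ∀ v, Scheme.Modules.coherent X (H.obj v))
    (hD : ∀ v, ∀ i ∈ T, (D i).mulSection (H.obj v) = 0) :
    ∃ (E : ExtendablePair D r) (ψ : H ⟶ (restrictInterior D r T).obj E), IsFaceExtension ψ := by
  obtain ⟨A⟩ := (zeroExtendPair D H hH hD).exists_extension hr
    (fun j hj u _ => isIso_zeroExtend_map H hj u) Tᶜ disjoint_compl_left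
  have hJ : ∀ i, i ∈ Tᶜ ∪ T := fun i => by rw [Finset.union_comm, Finset.union_compl]; simp
  let E := A.obj.toExtendablePair hJ
  let eφ (u : Box r) (hu : ∀ i, u.1 i < r i) : E.F.obj u ≅ zeroExtendObj H u :=
    @asIso _ _ _ _ (A.φ u hu) (A.isIso_φ u hu)
  let χ (u : Box r) (hu : ∀ i, u.1 i < r i) (hp : ∀ i ∈ T, 1 ≤ u.1 i ∧ u.1 i + 1 ≤ r i) :
      E.F.obj u ≅ H.obj (interiorProj r T u hp) := eφ u hu ≪≫ zeroExtendIso H hp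
  have hχ (u v : Box r) (hu : ∀ i, u.1 i < r i) (hp : ∀ i ∈ T, 1 ≤ u.1 i ∧ u.1 i + 1 ≤ r i)
      (hv : ∀ i, v.1 i < r i) (hq : ∀ i ∈ T, 1 ≤ v.1 i ∧ v.1 i + 1 ≤ r i) (huv : u ≤ v) :
      E.F.map (homOfLE huv) ≫ (χ v hv hq).hom =
        (χ u hu hp).hom ≫ H.map (homOfLE (interiorProj_mono huv hp hq)) := by
    have h1 : E.F.map (homOfLE huv) ≫ (eφ v hv).hom = (eφ u hu).hom ≫ zeroExtendMap H huv :=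
      A.naturality u v hu hv huv
    rw [zeroExtendMap_eq H huv hp hq] at h1
    dsimp only [χ]
    rw [Iso.trans_hom, Iso.trans_hom, reassoc_of% h1]
    simp only [Category.assoc, Iso.inv_hom_id, Category.comp_id]
  have hzero (u : Box r) (hu : ∀ i, u.1 i < r i) (hp : ¬ ∀ i ∈ T, 1 ≤ u.1 i ∧ u.1 i + 1 ≤ r i) :
      IsZero (E.F.obj u) := (isZero_zeroExtendObj H hp).of_iso (eφ u hu)
  let ψ₀ (v : InteriorBox (fun i : T => r i)) : H.obj v ⟶ E.F.obj (interiorInclusion r T v) :=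
    H.map (homOfLE (interiorProj_interiorInclusion v).ge) ≫
      (χ _ (interiorInclusion_lt hr v) (interior_interiorInclusion v)).inv
  have hψ₀ {v w : InteriorBox (fun i : T => r i)} (h : v ≤ w) :
      H.map (homOfLE h) ≫ ψ₀ w = ψ₀ v ≫ E.F.map (homOfLE (interiorInclusion_monotone r T h)) := by
    have := hχ _ _ (interiorInclusion_lt hr v) (interior_interiorInclusion v)
      (interiorInclusion_lt hr w) (interior_interiorInclusion w) (interiorInclusion_monotone r T h)
    dsimp only [ψ₀]
    rw [← cancel_mono (χ _ (interiorInclusion_lt hr w) (interior_interiorInclusion w)).hom]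
    simp only [Category.assoc, this, Iso.inv_hom_id, Iso.inv_hom_id_assoc, Category.comp_id,
      map_homOfLE_comp]
  let ψ : H ⟶ (restrictInterior D r T).obj E :=
    { app := ψ₀, naturality := fun _ _ f => hψ₀ (leOfHom f) }
  have hψ (u : Box r) (hu : ∀ i, u.1 i < r i) (hp : ∀ i ∈ T, 1 ≤ u.1 i ∧ u.1 i + 1 ≤ r i) :
      faceMap ψ u hp = (χ u hu hp).inv := by
    have h1 := hχ _ _ (interiorInclusion_lt hr _) (interior_interiorInclusion _) hu hp
      (interiorInclusion_interiorProj_le r T u hp)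
    have h2 : H.map (homOfLE (le_refl (interiorProj r T u hp))) = 𝟙 _ := H.map_id _
    rw [← cancel_mono (χ u hu hp).hom, Iso.inv_hom_id, faceMap, Category.assoc, h1]
    change (_ ≫ (χ _ _ _).inv) ≫ (χ _ _ _).hom ≫ _ = _
    simp only [Category.assoc, Iso.inv_hom_id_assoc, map_homOfLE_comp]
    exact h2
  refine ⟨E, ψ, ⟨fun u hu => ?_, fun u hu hp => hψ u hu hp ▸ inferInstance, hzero, ?_⟩⟩
  -- Off the maximal faces a nonzero value requires `T ⊆ u.interior`, so at least `T.card` interior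
  -- coordinates.
  · induction u using Box.induction_top hr with
    | base u hlt =>
      exact hzero u hlt fun hp => absurd (Finset.card_le_card (subset_interior hp)) (not_le.2 hu)
    | step i u hi ih =>
      refine isZero_of_isTranslate E (Box.isTranslate_zeroAt hi) (ih ?_)
      change Finset.card _ < _
      rwa [Box.interior_zeroAt u hi]
  · intro E' hE' m
    obtain ⟨g, hg, hgφ⟩ := A.exists_desc E' (zeroExtendDesc hE' m) (fun i hi α β h =>
      (isZero_zeroExtendObj H (h.not_interior_top hi)).eq_of_src _ _)
    have hgm (u : Box r) (hu : ∀ i, u.1 i < r i) (hp : ∀ i ∈ T, 1 ≤ u.1 i ∧ u.1 i + 1 ≤ r i) :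
        g.app u = (χ u hu hp).hom ≫ faceMap m u hp := by
      refine (hgφ u hu).trans ((congrArg (A.φ u hu ≫ ·) (zeroExtendDesc_app hE' m hp)).trans ?_)
      exact (Category.assoc _ _ _).symm
    let h : E ⟶ E' := { app := g, comm := fun i α β ht => hg i (hJ i) α β ht }
    refine ⟨h, restrictInterior_hom_ext fun v => ?_, fun h' hh' => hom_ext_of_lt hr fun u hu => ?_⟩
    · rw [interiorApp_eq_faceMap, interiorApp_eq_faceMap, faceMap_comp,
        hψ _ (interiorInclusion_lt hr v)]
      refine congrArg (H.map _ ≫ ·) ((congrArg (_ ≫ ·) (hgm _ (interiorInclusion_lt hr v)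
        (interior_interiorInclusion v))).trans ?_)
      exact Iso.inv_hom_id_assoc _ _
    · by_cases hp : ∀ i ∈ T, 1 ≤ u.1 i ∧ u.1 i + 1 ≤ r i
      · have h1 := faceMap_comp ψ h' u hp
        rw [hh', hψ u hu hp] at h1
        refine Eq.trans ?_ (hgm u hu hp).symm
        rw [h1, Iso.hom_inv_id_assoc]
      · exact (hzero u hu hp).eq_of_src _ _

end ExtendablePair

/-! ### The target category is abelian -/

namespace ExtendablePair
variable {X : Scheme.{u}} {n : ℕ} (D : Fin n → LineBundleWithSection X) (T : Finset (Fin n))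

/-- Coherent sheaves killed by the sections `s_i`, `i ∈ T`. -/
def cohKilled : ObjectProperty X.Modules := fun M =>
  Scheme.Modules.coherent X M ∧ ∀ i ∈ T, (D i).mulSection M = 0

theorem cohKilledBy_eq : Scheme.Modules.cohKilledBy (zeroLocusι D T) = cohKilled D T := by
  ext M
  exact and_congr_right fun _ => Scheme.Modules.isKilledBy_zeroLocusι_iff D T M

variable {D T}

theorem mulSection_eq_zero_of_mono {i : Fin n} {M N : X.Modules} (f : M ⟶ N) [Mono f]
    (h : (D i).mulSection N = 0) : (D i).mulSection M = 0 := by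
  have : Mono ((D i).L ◁ f) := inferInstanceAs (Mono ((tensorLeft (D i).L).map f))
  rw [← cancel_mono ((D i).L ◁ f), ← Scheme.Modules.mulSection_naturality, h, comp_zero, zero_comp]

theorem mulSection_eq_zero_of_epi {i : Fin n} {M N : X.Modules} (f : M ⟶ N) [Epi f]
    (h : (D i).mulSection M = 0) : (D i).mulSection N = 0 := by
  rw [← cancel_epi f, Scheme.Modules.mulSection_naturality, h, comp_zero, zero_comp]

variable [IsLocallyNoetherian X]

instance : (cohKilled D T).IsClosedUnderIsomorphisms where
  of_iso e h := ⟨(Scheme.Modules.coherent X).prop_of_iso e h.1,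
    fun i hi => mulSection_eq_zero_of_epi e.hom (h.2 i hi)⟩

instance : (cohKilled D T).ContainsZero where
  exists_zero := ⟨_, isZero_zero _, (Scheme.Modules.coherent X).prop_of_isZero (isZero_zero _),
    fun _ _ => (isZero_zero X.Modules).eq_of_src _ _⟩

instance : (cohKilled D T).IsClosedUnderKernels where
  kernels_le := by
    rintro M ⟨f, k, hk, hf, hg⟩
    have hm : Mono k.ι := Fork.IsLimit.mono hk
    exact ⟨ObjectProperty.IsClosedUnderKernels.kernels_le _ ⟨f, k, hk, hf.1, hg.1⟩,
      fun i hi => mulSection_eq_zero_of_mono k.ι (hf.2 i hi)⟩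

instance : (cohKilled D T).IsClosedUnderCokernels where
  cokernels_le := by
    rintro M ⟨f, k, hk, hf, hg⟩
    have hm : Epi k.π := Cofork.IsColimit.epi hk
    exact ⟨ObjectProperty.IsClosedUnderCokernels.cokernels_le _ ⟨f, k, hk, hf.1, hg.1⟩,
      fun i hi => mulSection_eq_zero_of_epi k.π (hg.2 i hi)⟩

instance : (cohKilled D T).IsClosedUnderFiniteProducts :=
  have : (cohKilled D T).IsClosedUnderBinaryProducts :=
    { limitsOfShape_le := by
        rintro M ⟨p⟩
        refine ⟨(Scheme.Modules.coherent X).prop_of_isLimit p.isLimit fun j => (p.prop_diag_obj j).1,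
          fun i hi => ?_⟩
        refine (isLimitOfPreserves (tensorLeft (D i).L) p.isLimit).hom_ext fun j => ?_
        refine (Scheme.Modules.mulSection_naturality (D i) (p.π.app j)).symm.trans ?_
        rw [(p.prop_diag_obj j).2 i hi, comp_zero, zero_comp] }
  .mk'

/-- Being killed by the ideal is the vanishing of the maps `mulSection`, a condition that visibly
passes to kernels, cokernels and products. -/
noncomputable instance : Abelian (Scheme.Modules.cohKilledBy (zeroLocusι D T)).FullSubcategory :=
  cohKilledBy_eq D T ▸ inferInstanceAs (Abelian (cohKilled D T).FullSubcategory)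

/-- Coherent sheaves on the zero locus form an abelian category. -/
noncomputable instance : Abelian (Scheme.Modules.Coh (zeroLocus D T)) :=
  abelianOfEquivalence (Scheme.Modules.pushforwardCoh (zeroLocusι D T))

variable (D) in
/-- The target of the restriction to faces is abelian. -/
@[reducible]
noncomputable def abelianFaceTarget (r : Fin n → ℕ) (k : ℕ) : Abelian (FaceTarget D r k) :=
  Pi.abelian

end ExtendablePair

/-! ### Restriction to the interior of a face as an exact functor -/

namespace ExtendablePair
variable {X : Scheme.{u}} {n : ℕ} {D : Fin n → LineBundleWithSection X} {r : Fin n → ℕ}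
  {T : Finset (Fin n)}

/-- By EX1 multiplication by `s_i` factors through a twist of the value with coordinate `i` set to
zero. There only elements of `T` other than `i` can be interior, so this value vanishes. -/
theorem mulSection_eq_zero_of_zeroOn {E : ExtendablePair D r}
    (hE : zeroOn D {u : Box r | u.interior.card < T.card} E) (v : InteriorBox (fun i : T => r i))
    {i : Fin n} (hi : i ∈ T) : (D i).mulSection (E.F.obj (interiorInclusion r T v)) = 0 := by
  rw [← E.ex1 i _ _ _ (Box.isTranslate_topAt _ i) (Box.zeroAt_le _ i) (Box.le_topAt _ i)]
  have hz : IsZero (E.F.obj ((interiorInclusion r T v).zeroAt i)) := by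
    refine hE _ (Finset.card_lt_card ((Finset.ssubset_iff_of_subset fun j hj => ?_).2 ⟨i, hi, by simp⟩))
    by_contra hjT
    have hji : j ≠ i := fun e => hjT (e ▸ hi)
    rw [Box.mem_interior, Box.zeroAt_of_ne _ hji] at hj
    have := hj.1
    simp [interiorInclusion, extendBox, hjT] at this
  rw [((tensorLeft (D i).L).map_isZero hz).eq_of_tgt (E.ρ i _ _ _).hom 0, zero_comp, comp_zero]

variable (D r) in
/-- Extendable pairs whose values vanish at indices with fewer than `k` interior coordinates. -/
abbrev KerCat (k : ℕ) := (zeroOn D {u : Box r | u.interior.card < k}).FullSubcategory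

variable {k : ℕ}

variable (D r) in
/-- The restriction to the interior of a face, with values in sheaves killed by the sections. -/
noncomputable def faceKilled (hT : T.card = k) : KerCat D r k ⥤
    (InteriorBox (fun i : T => r i) ⥤ (Scheme.Modules.cohKilledBy (zeroLocusι D T)).FullSubcategory) where
  obj E := (Scheme.Modules.cohKilledBy (zeroLocusι D T)).lift ((restrictInterior D r T).obj E.obj) fun v =>
    ⟨E.obj.coherent _, (Scheme.Modules.isKilledBy_zeroLocusι_iff D T _).2 fun _ hi =>
      mulSection_eq_zero_of_zeroOn (hT ▸ E.property) v hi⟩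
  map f :=
    { app := fun v => ObjectProperty.homMk (((restrictInterior D r T).map f.hom).app v)
      naturality := fun _ _ g => ObjectProperty.hom_ext _ (((restrictInterior D r T).map f.hom).naturality g) }

variable (D r) in
/-- The restriction to the interior of a face, with values in sheaves on the zero locus. -/
noncomputable def faceFunctor (hT : T.card = k) : KerCat D r k ⥤ FaceCat D r T :=
  faceKilled D r hT ⋙ (Functor.whiskeringRight _ _ _).obj
    (Scheme.Modules.pushforwardCoh (zeroLocusι D T)).inv

variable (D r) in
/-- The identification of `faceFunctor` with the restriction of diagrams. -/
noncomputable def faceFunctorIso (hT : T.card = k) : faceFunctor D r hT ⋙ pushFace D r T ≅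
    (zeroOn D {u : Box r | u.interior.card < k}).ι ⋙ restrictInterior D r T :=
  NatIso.ofComponents
    (fun E => NatIso.ofComponents
      (fun v => (Scheme.Modules.cohKilledBy (zeroLocusι D T)).ι.mapIso
        ((Scheme.Modules.pushforwardCoh (zeroLocusι D T)).asEquivalence.counitIso.app
          (((faceKilled D r hT).obj E).obj v)))
      (fun g => congrArg (fun f => f.hom)
        ((Scheme.Modules.pushforwardCoh (zeroLocusι D T)).asEquivalence.counitIso.hom.naturality
          (((faceKilled D r hT).obj E).map g))))
    (fun f => NatTrans.ext (funext fun v => congrArg (fun f => f.hom)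
        ((Scheme.Modules.pushforwardCoh (zeroLocusι D T)).asEquivalence.counitIso.hom.naturality
          (((faceKilled D r hT).map f).app v))))

instance : (pushFace D r T).Full := inferInstanceAs ((Functor.whiskeringRight _ _ _).obj
    ((Scheme.Modules.coherent _).ι ⋙ Scheme.Modules.pushforward (zeroLocusι D T))).Full

instance : (pushFace D r T).Faithful := inferInstanceAs ((Functor.whiskeringRight _ _ _).obj
    ((Scheme.Modules.coherent _).ι ⋙ Scheme.Modules.pushforward (zeroLocusι D T))).Faithful

theorem coherent_pushFace (G : FaceCat D r T) (v) :
    Scheme.Modules.coherent X (((pushFace D r T).obj G).obj v) :=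
  (Scheme.Modules.coherent_pushforward_iff (zeroLocusι D T) (G.obj v).obj).2 (G.obj v).property

theorem mulSection_pushFace (G : FaceCat D r T) (v) (i : Fin n) (hi : i ∈ T) :
    (D i).mulSection (((pushFace D r T).obj G).obj v) = 0 :=
  (Scheme.Modules.isKilledBy_zeroLocusι_iff D T _).1
    (Scheme.Modules.isKilledBy_pushforward (zeroLocusι D T) (G.obj v).obj) i hi

variable [IsLocallyNoetherian X] (hT : T.card = k)

instance : PreservesFiniteLimits ((zeroOn D {u : Box r | u.interior.card < k}).ι ⋙ restrictInterior D r T) :=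
  have := (zeroOn D {u : Box r | u.interior.card < k}).preservesFiniteLimits_ι
  have : PreservesFiniteLimits (restrictInterior D r T) := comp_preservesFiniteLimits _ _
  comp_preservesFiniteLimits _ _

instance : PreservesFiniteColimits ((zeroOn D {u : Box r | u.interior.card < k}).ι ⋙ restrictInterior D r T) :=
  have := (zeroOn D {u : Box r | u.interior.card < k}).preservesFiniteColimits_ι
  have : PreservesFiniteColimits (restrictInterior D r T) := comp_preservesFiniteColimits _ _
  comp_preservesFiniteColimits _ _

/-- After the fully faithful `pushFace`, which reflects limits, the functor becomes restriction of
diagrams, and that is exact. -/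
instance : PreservesFiniteLimits (faceFunctor D r hT) where
  preservesFiniteLimits _ _ _ := by
    have := preservesFiniteLimits_of_natIso (faceFunctorIso D r hT).symm
    exact preservesLimitsOfShape_of_reflects_of_preserves _ (pushFace D r T)

instance : PreservesFiniteColimits (faceFunctor D r hT) where
  preservesFiniteColimits _ _ _ := by
    have := preservesFiniteColimits_of_natIso (faceFunctorIso D r hT).symm
    exact preservesColimitsOfShape_of_reflects_of_preserves _ (pushFace D r T)

end ExtendablePair

/-! ### Universal morphisms and adjunctions with invertible unit -/

namespace CategoryTheory

section
variable {C : Type*} [Category C] [HasZeroMorphisms C] {I : Type*} {A : I → C} {c : C}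
  {i : ∀ a, A a ⟶ c}

/-- A coproduct is also the coproduct of the summands in a subset if the others vanish. -/
theorem nonempty_isColimit_cofan_of_isZero (h : IsColimit (Cofan.mk c i)) {p : I → Prop}
    (hz : ∀ a, ¬ p a → IsZero (A a)) {B : Subtype p → C} (φ : ∀ a, B a ⟶ A a.1)
    (hφ : ∀ a, IsIso (φ a)) : Nonempty (IsColimit (Cofan.mk c fun a => φ a ≫ i a.1)) := by
  classical
  let t (s : Cofan B) : Cofan A := Cofan.mk s.pt fun a =>
    if ha : p a then inv (φ ⟨a, ha⟩) ≫ s.inj ⟨a, ha⟩ else 0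
  have ht (s : Cofan B) (a : Subtype p) : i a.1 ≫ h.desc (t s) = inv (φ a) ≫ s.inj a :=
    (h.fac (t s) ⟨a.1⟩).trans (dif_pos a.2)
  refine ⟨Cofan.IsColimit.mk _ (fun s => h.desc (t s)) (fun s a => ?_) (fun s m hm => ?_)⟩
  · refine (Category.assoc _ _ _).trans ((congrArg (φ a ≫ ·) (ht s a)).trans ?_)
    exact IsIso.hom_inv_id_assoc _ _
  · refine h.hom_ext fun ⟨a⟩ => ?_
    by_cases ha : p a
    · refine Eq.trans ?_ (ht s ⟨a, ha⟩).symm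
      rw [← hm ⟨a, ha⟩]
      change i a ≫ m = inv (φ ⟨a, ha⟩) ≫ (φ ⟨a, ha⟩ ≫ i a) ≫ m
      rw [Category.assoc, IsIso.inv_hom_id_assoc]
    · exact (hz a ha).eq_of_src _ _

theorem isIso_cofan_inj_of_isZero (h : IsColimit (Cofan.mk c i)) (a : I)
    (hz : ∀ b, b ≠ a → IsZero (A b)) : IsIso (i a) := by
  classical
  have h1 : i a ≫ h.desc (Cofan.mk (A a) fun b => if hb : b = a then eqToHom (by rw [hb]) else 0) = 𝟙 _ := by
    refine (h.fac _ ⟨a⟩).trans ?_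
    exact dif_pos rfl
  refine ⟨_, h1, h.hom_ext fun ⟨b⟩ => ?_⟩
  by_cases hb : b = a
  · subst hb
    change i b ≫ _ ≫ i b = i b ≫ 𝟙 c
    rw [reassoc_of% h1, Category.comp_id]
  · exact (hz b hb).eq_of_src _ _

end

section
variable {C D : Type*} [Category C] [Category D] {G : D ⥤ C} {obj : C → D}
  (η : ∀ c, c ⟶ G.obj (obj c))
  (hη : ∀ c d (f : c ⟶ G.obj d), ∃! h : obj c ⟶ d, η c ≫ G.map h = f)

/-- The bijection on morphisms given by universal morphisms. -/
noncomputable def universalHomEquiv (c : C) (d : D) : (obj c ⟶ d) ≃ (c ⟶ G.obj d) where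
  toFun h := η c ≫ G.map h
  invFun f := (hη c d f).choose
  left_inv h := ((hη c d _).choose_spec.2 h rfl).symm
  right_inv f := (hη c d f).choose_spec.1

theorem universalHomEquiv_comp (c : C) (d d' : D) (g : d ⟶ d') (h : obj c ⟶ d) :
    universalHomEquiv η hη c d' (h ≫ g) = universalHomEquiv η hη c d h ≫ G.map g := by
  simp [universalHomEquiv]

/-- The adjunction given by universal morphisms. -/
noncomputable def universalAdjunction :
    Adjunction.leftAdjointOfEquiv (universalHomEquiv η hη) (universalHomEquiv_comp η hη) ⊣ G :=
  Adjunction.adjunctionOfEquivLeft _ _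

theorem universalAdjunction_unit_app (c : C) : (universalAdjunction η hη).unit.app c = η c := by
  simp [universalAdjunction, Adjunction.adjunctionOfEquivLeft, universalHomEquiv]

end

section
variable {C D : Type*} [Category C] [Category D] {F : C ⥤ D} {G : D ⥤ C} (adj : F ⊣ G) [IsIso adj.unit]
include adj

theorem Adjunction.map_counit_app (d : D) :
    G.map (adj.counit.app d) = inv (adj.unit.app (G.obj d)) := by
  rw [← cancel_epi (adj.unit.app (G.obj d)), IsIso.hom_inv_id, adj.right_triangle_components]
  rfl

/-- The roof starts at `F.obj (G.obj d)`: the counit maps to `d` and becomes the inverse of the unit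
under `G`, while `f` transposes to a morphism to `d'`. -/
theorem Adjunction.exists_roof (d d' : D) (f : G.obj d ⟶ G.obj d') :
    ∃ (d'' : D) (h : d'' ⟶ d) (g : d'' ⟶ d'), IsIso (G.map h) ∧ G.map h ≫ f = G.map g := by
  refine ⟨F.obj (G.obj d), adj.counit.app d, F.map f ≫ adj.counit.app d',
    adj.map_counit_app d ▸ inferInstance, ?_⟩
  have := adj.unit.naturality f
  rw [G.map_comp, adj.map_counit_app, adj.map_counit_app, IsIso.inv_comp_eq]
  refine Eq.trans ?_ (Category.assoc _ _ _)
  rw [IsIso.eq_comp_inv]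
  exact this

theorem Adjunction.isEquivalence_of_reflects [G.ReflectsIsomorphisms] : G.IsEquivalence := by
  have (d : D) : IsIso (adj.counit.app d) := by
    have : IsIso (G.map (adj.counit.app d)) := by
      rw [adj.map_counit_app]
      infer_instance
    exact isIso_of_reflects_iso _ G
  exact adj.toEquivalence.isEquivalence_inverse

end

/-- If `G` inverts `f`, it annihilates the kernel and the cokernel of `f`, which are therefore zero.
-/
theorem reflectsIsomorphisms_of_isZero {C D : Type*} [Category C] [Category D] [Abelian C] [Abelian D]
    (G : C ⥤ D) [PreservesFiniteLimits G] [PreservesFiniteColimits G]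
    (h : ∀ c, IsZero (G.obj c) → IsZero c) : G.ReflectsIsomorphisms where
  reflects {c d} f hf := by
    have : G.PreservesZeroMorphisms := inferInstance
    have h1 : G.kernel.isoModSerre f := by
      rw [Abelian.isoModSerre_kernel_eq_inverseImage_isomorphisms]
      exact hf
    have : Mono f := Preadditive.mono_of_isZero_kernel f (h _ h1.1)
    have : Epi f := Preadditive.epi_of_isZero_cokernel f (h _ h1.2)
    exact isIso_of_mono_of_epi f

end CategoryTheory

/-! ### The functor to all faces and its left adjoint -/

namespace ExtendablePair
variable {X : Scheme.{u}} {n : ℕ} (D : Fin n → LineBundleWithSection X) (r : Fin n → ℕ) (k : ℕ)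

/-- The restriction to all faces of dimension `k`. -/
noncomputable def faces : KerCat D r k ⥤ FaceTarget D r k :=
  Functor.pi' fun T => faceFunctor D r T.2

/-- The identification of `faces` with the restriction of diagrams. -/
noncomputable def facesIso (T : SubsetsOfCard n k) : faces D r k ⋙ Pi.eval _ T ⋙ pushFace D r T.1 ≅
    (zeroOn D {u : Box r | u.interior.card < k}).ι ⋙ restrictInterior D r T.1 :=
  faceFunctorIso D r T.2

variable {D r k}

theorem isZero_pushFace_iff {T : Finset (Fin n)} (G : FaceCat D r T) :
    IsZero ((pushFace D r T).obj G) ↔ IsZero G := by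
  refine ⟨fun h => ?_, fun h => (pushFace D r T).map_isZero h⟩
  rw [IsZero.iff_id_eq_zero]
  exact (pushFace D r T).map_injective (h.eq_of_src _ _)

/-- For a pair in `ker^{k-1}` only indices with exactly `k` interior coordinates matter. Modulo `ρ`
there are no maximal coordinates, and then such an index is the inclusion of an interior point of
the face spanned by its interior coordinates. -/
theorem isZero_faces_iff (hr : ∀ i, 0 < r i) (hk : k ≤ n) (E : KerCat D r k) :
    IsZero ((faces D r k).obj E) ↔ ker D r k E.obj := by
  rw [ker_eq_zeroOn D hr hk, Pi.isZero_iff]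
  have h1 (T : SubsetsOfCard n k) : IsZero ((faces D r k).obj E T) ↔
      ∀ v, IsZero (E.obj.F.obj (interiorInclusion r T.1 v)) := by
    rw [← isZero_pushFace_iff]
    exact (((facesIso D r k T).app E).isZero_iff).trans (Functor.isZero_iff _)
  simp only [h1]
  refine ⟨fun h u hu => ?_, fun h T v => h _ ?_⟩
  · induction u using Box.induction_top hr with
    | base u hlt =>
      rcases (show u.interior.card ≤ k from hu).lt_or_eq with hlt' | heq
      · exact E.property u hlt'
      · have hp : ∀ i ∈ u.interior, 1 ≤ u.1 i ∧ u.1 i + 1 ≤ r i := fun i hi =>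
          (Box.mem_interior u i).1 hi
        have : u = interiorInclusion r u.interior (interiorProj r _ u hp) := by
          ext i
          dsimp [interiorInclusion, extendBox, interiorProj]
          split_ifs with hi
          · rfl
          · by_contra h0
            exact hi ((Box.mem_interior u i).2 ⟨Nat.pos_of_ne_zero h0, hlt i⟩)
        rw [this]
        exact h ⟨u.interior, heq⟩ _
    | step i u hi ih =>
      exact isZero_of_isTranslate E.obj (Box.isTranslate_zeroAt hi)
        (ih (by rwa [Set.mem_ofPred_eq, Box.interior_zeroAt u hi]))
  · refine (Finset.card_le_card fun i hi => ?_).trans T.2.le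
    rw [Box.mem_interior] at hi
    by_contra hT'
    simp [interiorInclusion, extendBox, hT'] at hi

/-- The identification of `faceFunctor` with the restriction of diagrams, at an object. -/
noncomputable def faceIso {T : Finset (Fin n)} (hT : T.card = k) (E : KerCat D r k) :
    (pushFace D r T).obj ((faceFunctor D r hT).obj E) ≅ (restrictInterior D r T).obj E.obj :=
  (faceFunctorIso D r hT).app E

theorem faceIso_naturality {T : Finset (Fin n)} (hT : T.card = k) {E E' : KerCat D r k} (f : E ⟶ E') :
    (pushFace D r T).map ((faceFunctor D r hT).map f) ≫ (faceIso hT E').hom =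
      (faceIso hT E).hom ≫ (restrictInterior D r T).map f.hom :=
  (faceFunctorIso D r hT).hom.naturality f

variable [IsLocallyNoetherian X]

instance : PreservesFiniteLimits (faces D r k) := Pi.preservesFiniteLimits_pi' _

instance : PreservesFiniteColimits (faces D r k) := Pi.preservesFiniteColimits_pi' _

/-- The universal object is the coproduct of the pairs generated by the single components `G T`.
Coproducts are computed pointwise, which gives both the invertibility of `η` and the direct sum
formula. -/
theorem exists_universal (hr : ∀ i, 0 < r i) (G : FaceTarget D r k) :
    ∃ (Y : KerCat D r k) (η : G ⟶ (faces D r k).obj Y),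
      (∀ (E : KerCat D r k) (f : G ⟶ (faces D r k).obj E), ∃! h : Y ⟶ E, η ≫ (faces D r k).map h = f) ∧
      IsIso η ∧
      ∀ (u : Box r), (∀ i, u.1 i < r i) → Nonempty (IsColimit (Cofan.mk (Y.obj.F.obj u)
        (fun T : FacesAt r k u => fromFace D r T.1.1
          ((pushFace D r T.1.1).map (η T.1) ≫ (facesIso D r k T.1).hom.app Y) u T.2))) := by
  have (T : SubsetsOfCard n k) := exists_isFaceExtension (D := D) (H := (pushFace D r T.1).obj (G T)) hr
    (coherent_pushFace (G T)) (mulSection_pushFace (G T))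
  choose E ψ hψ using this
  have hE (T : SubsetsOfCard n k) : zeroOn D {u : Box r | u.interior.card < k} (E T) := by
    have := (hψ T).zeroOn
    rwa [T.2] at this
  have : HasFiniteCoproducts (KerCat D r k) := inferInstance
  let A (T : SubsetsOfCard n k) : KerCat D r k := ⟨E T, hE T⟩
  let Y : KerCat D r k := ∐ A
  let inj (T : SubsetsOfCard n k) : E T ⟶ Y.obj := (Sigma.ι A T).hom
  let m (T : SubsetsOfCard n k) : (pushFace D r T.1).obj (G T) ⟶ (restrictInterior D r T.1).obj Y.obj :=
    ψ T ≫ (restrictInterior D r T.1).map (inj T)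
  let η (T : SubsetsOfCard n k) : G T ⟶ (faceFunctor D r T.2).obj Y :=
    (pushFace D r T.1).preimage (m T ≫ (faceIso T.2 Y).inv)
  have hη (T : SubsetsOfCard n k) : (pushFace D r T.1).map (η T) ≫ (faceIso T.2 Y).hom = m T := by
    dsimp only [η]
    rw [Functor.map_preimage, Category.assoc, Iso.inv_hom_id, Category.comp_id]
  have hm (T : SubsetsOfCard n k) (u : Box r) (hu : ∀ i ∈ T.1, 1 ≤ u.1 i ∧ u.1 i + 1 ≤ r i) :
      faceMap (m T) u hu = faceMap (ψ T) u hu ≫ (Hom.app (inj T)).app u := faceMap_comp _ _ _ _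
  -- Since `pushFace` is faithful, the universal property can be tested on `X`, where it becomes
  -- that of the pairs `E T`.
  have key (T : SubsetsOfCard n k) {E' : KerCat D r k} (h : Y ⟶ E') (f : G T ⟶ (faceFunctor D r T.2).obj E') :
      η T ≫ (faceFunctor D r T.2).map h = f ↔ ψ T ≫ (restrictInterior D r T.1).map (Sigma.ι A T ≫ h).hom =
        (pushFace D r T.1).map f ≫ (faceIso T.2 E').hom := by
    rw [← (pushFace D r T.1).map_injective.eq_iff, ← cancel_mono (faceIso T.2 E').hom,
      CategoryTheory.Functor.map_comp, Category.assoc, faceIso_naturality, reassoc_of% hη T]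
    dsimp only [m]
    rw [Category.assoc, ← CategoryTheory.Functor.map_comp]
    rfl
  have hcolim (u : Box r) : IsColimit (Cofan.mk (Y.obj.F.obj u) fun T => (Hom.app (inj T)).app u) := by
    have := (zeroOn D {u : Box r | u.interior.card < k}).preservesFiniteColimits_ι
    have : PreservesFiniteColimits ((zeroOn D {u : Box r | u.interior.card < k}).ι ⋙ eval D u) :=
      comp_preservesFiniteColimits _ _
    exact isColimitCofanMkObjOfIsColimit ((zeroOn D {u : Box r | u.interior.card < k}).ι ⋙ eval D u) _ _
      (coproductIsCoproduct A)
  -- At an interior point of the face `T` a nonzero summand requires `T' ⊆ T`, hence `T' = T` by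
  -- cardinality.
  have hlt (T : SubsetsOfCard n k) (v : InteriorBox (fun i : T.1 => r i)) (T' : SubsetsOfCard n k)
      (hT' : T' ≠ T) : IsZero ((E T').F.obj (interiorInclusion r T.1 v)) := by
    refine (hψ T').isZero _ (interiorInclusion_lt hr v) fun hp => hT' ?_
    refine Subtype.ext (Finset.eq_of_subset_of_card_le (fun i hi => ?_) (T.2.trans T'.2.symm).le)
    by_contra hiT
    have := (hp i hi).1
    simp [interiorInclusion, extendBox, hiT] at this
  refine ⟨Y, η, fun E' f => ?_, ?_, fun u hu => ?_⟩
  · have hex (T : SubsetsOfCard n k) := (hψ T).existsUnique E'.obj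
      (by rw [T.2]; exact E'.property) ((pushFace D r T.1).map (f T) ≫ (faceIso T.2 E').hom)
    choose h hh huniq using hex
    refine ⟨Sigma.desc fun T => ObjectProperty.homMk (h T), ?_, fun h' hh' => ?_⟩
    · refine funext fun T => (key T _ (f T)).2 ?_
      rw [Sigma.ι_desc]
      exact hh T
    · refine Sigma.hom_ext _ _ fun T => ?_
      rw [Sigma.ι_desc]
      exact ObjectProperty.hom_ext _ (huniq T _ ((key T h' (f T)).1 (congrFun hh' T)))
  · refine Pi.isIso_of_eval _ fun T => ?_
    have h1 (v : InteriorBox (fun i : T.1 => r i)) : IsIso (interiorApp (m T) v) := by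
      rw [interiorApp_eq_faceMap, hm]
      have := isIso_map_homOfLE ((pushFace D r T.1).obj (G T)) (interiorProj_interiorInclusion v).symm
      have := (hψ T).isIso _ (interiorInclusion_lt hr v) (interior_interiorInclusion v)
      have := isIso_cofan_inj_of_isZero (hcolim (interiorInclusion r T.1 v)) T (hlt T v)
      infer_instance
    have h2 : IsIso (m T) := @NatIso.isIso_of_isIso_app _ _ _ _ _ _ (m T) h1
    have : IsIso ((pushFace D r T.1).map (η T)) := by
      dsimp only [η]
      rw [Functor.map_preimage]
      infer_instance
    exact isIso_of_reflects_iso (η T) (pushFace D r T.1)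
  · have h1 (T : SubsetsOfCard n k) (hT : ¬ ∀ i ∈ T.1, 1 ≤ u.1 i ∧ u.1 i + 1 ≤ r i) :
        IsZero ((E T).F.obj u) := (hψ T).isZero u hu hT
    have := nonempty_isColimit_cofan_of_isZero (hcolim u) h1 (fun T => faceMap (ψ T.1) u T.2)
      fun T => (hψ T.1).isIso u hu T.2
    have e : (fun T : FacesAt r k u => faceMap (ψ T.1) u T.2 ≫ (Hom.app (inj T.1)).app u) =
        fun T : FacesAt r k u => fromFace D r T.1.1
          ((pushFace D r T.1.1).map (η T.1) ≫ (facesIso D r k T.1).hom.app Y) u T.2 := by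
      funext T
      rw [← hm, ← hη]
      rfl
    rw [e] at this
    exact this

end ExtendablePair

/-! ### Assembly of the main theorem -/

namespace ExtendablePair

theorem ker_pred_eq_zeroOn {X : Scheme.{u}} {n : ℕ} (D : Fin n → LineBundleWithSection X)
    {r : Fin n → ℕ} (hr : ∀ i, 0 < r i) {k : ℕ} (hk : 1 ≤ k) (hkn : k ≤ n) :
    ker D r (k - 1) = zeroOn D {u : Box r | u.interior.card < k} := by
  rw [ker_eq_zeroOn D hr ((Nat.sub_le _ _).trans hkn)]
  congr 1
  ext u
  simp only [Set.mem_ofPred_eq]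
  omega

theorem ker_le_zeroOn {X : Scheme.{u}} {n : ℕ} (D : Fin n → LineBundleWithSection X)
    {r : Fin n → ℕ} (hr : ∀ i, 0 < r i) {k : ℕ} (hkn : k ≤ n) :
    ker D r k ≤ zeroOn D {u : Box r | u.interior.card < k} := by
  rw [ker_eq_zeroOn D hr hkn]
  exact fun E hE u hu => hE u (Nat.le_of_lt (show u.interior.card < k from hu))

/-- No index has more than `n` interior coordinates, so `ker^n` contains only zero objects. -/
theorem reflectsIsomorphisms_faces {X : Scheme.{u}} [IsLocallyNoetherian X] {n : ℕ}
    (D : Fin n → LineBundleWithSection X) {r : Fin n → ℕ} (hr : ∀ i, 0 < r i) :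
    (faces D r n).ReflectsIsomorphisms := by
  let := abelianFaceTarget D r n
  refine reflectsIsomorphisms_of_isZero _ fun E hE => ?_
  rw [isZero_faces_iff hr le_rfl, ker_eq_zeroOn D hr le_rfl] at hE
  rw [← ObjectProperty.isZero_obj_iff, isZero_iff]
  exact fun u => hE u ((Finset.card_le_univ _).trans (Fintype.card_fin n).le)

/-- The full set is the only subset with `n` elements, so the product has a single factor. -/
instance isEquivalence_eval (n : ℕ) (A : SubsetsOfCard n n → Type*) [∀ T, Category (A T)]
    (T : SubsetsOfCard n n) : (Pi.eval A T).IsEquivalence := by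
  have hu (T' : SubsetsOfCard n n) : T' = T := Subtype.ext
    (((Finset.card_eq_iff_eq_univ _).1 (T'.2.trans (Fintype.card_fin n).symm)).trans
      ((Finset.card_eq_iff_eq_univ _).1 (T.2.trans (Fintype.card_fin n).symm)).symm)
  exact
    { faithful := ⟨fun {a b f g} h => funext fun T' => by obtain rfl := hu T'; exact h⟩
      full := ⟨fun {a b} f => ⟨fun T' => hu T' ▸ f, rfl⟩⟩
      essSurj := ⟨fun x => ⟨fun T' => hu T' ▸ x, ⟨Iso.refl _⟩⟩⟩ }

end ExtendablePair

theorem mainTheorem6 {X : Scheme.{u}} [IsLocallyNoetherian X] {n : ℕ}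
    (D : Fin n → LineBundleWithSection X) (r : Fin n → ℕ) (hr : ∀ i, 0 < r i)
    (k : ℕ) (hk : 1 ≤ k) (hkn : k ≤ n) :
    -- `ker^k ⊆ ker^{k-1}`, both sides of the functor are abelian categories
    ExtendablePair.ker D r k ≤ ExtendablePair.ker D r (k - 1) ∧
    ∃ (_ : Abelian (ExtendablePair.ker D r (k - 1)).FullSubcategory)
      (_ : Abelian (ExtendablePair.FaceTarget D r k))
      -- the functor `Face^k` and its identification with restriction to the faces
      (Face : (ExtendablePair.ker D r (k - 1)).FullSubcategory ⥤
        ExtendablePair.FaceTarget D r k)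
      (e : ∀ T : ExtendablePair.SubsetsOfCard n k,
        Face ⋙ Pi.eval _ T ⋙ ExtendablePair.pushFace D r T.1 ≅
          (ExtendablePair.ker D r (k - 1)).ι ⋙ ExtendablePair.restrictInterior D r T.1)
      -- `Face^k` is exact
      (_ : PreservesFiniteLimits Face) (_ : PreservesFiniteColimits Face),
      -- the kernel of `Face^k` is `ker^k`
      (∀ F : (ExtendablePair.ker D r (k - 1)).FullSubcategory,
        IsZero (Face.obj F) ↔ ExtendablePair.ker D r k F.obj) ∧
      -- the left adjoint, with invertible unit `1 ≅ Face^k ∘ D^k` and its explicit description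
      (∃ (Dk : ExtendablePair.FaceTarget D r k ⥤
            (ExtendablePair.ker D r (k - 1)).FullSubcategory)
          (adj : Dk ⊣ Face),
        IsIso adj.unit ∧
        ∀ (G : ExtendablePair.FaceTarget D r k) (u : Box r), (∀ i, u.1 i < r i) →
          Nonempty (IsColimit (Cofan.mk ((Dk.obj G).obj.F.obj u)
            (fun T : ExtendablePair.FacesAt r k u =>
              ExtendablePair.fromFace D r T.1.1
                ((ExtendablePair.pushFace D r T.1.1).map (adj.unit.app G T.1) ≫
                  (e T.1).hom.app (Dk.obj G)) u T.2)))) ∧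
      -- the two conditions of Swan
      (∀ G : ExtendablePair.FaceTarget D r k, ∃ F, Nonempty (Face.obj F ≅ G)) ∧
      (∀ (F F' : (ExtendablePair.ker D r (k - 1)).FullSubcategory)
        (f : Face.obj F ⟶ Face.obj F'),
        ∃ (F'' : (ExtendablePair.ker D r (k - 1)).FullSubcategory)
          (h : F'' ⟶ F) (g : F'' ⟶ F'), IsIso (Face.map h) ∧ Face.map h ≫ f = Face.map g) ∧
      -- `Face^k` exhibits its target as the Serre quotient of `ker^{k-1}` by `ker^k`
      Face.IsLocalization Face.kernel.isoModSerre ∧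
      -- for `k = n` it is an equivalence
      (k = n → Face.IsEquivalence ∧ ∀ T, (Face ⋙ Pi.eval _ T).IsEquivalence) := by
  rw [ExtendablePair.ker_pred_eq_zeroOn D hr hk hkn]
  let := ExtendablePair.abelianFaceTarget D r k
  choose Y η hη hη' hcolim using ExtendablePair.exists_universal (D := D) (k := k) hr
  let adj := universalAdjunction η hη
  have hunit : IsIso adj.unit := by
    have (G : ExtendablePair.FaceTarget D r k) : IsIso (adj.unit.app G) :=
      (universalAdjunction_unit_app η hη G).symm ▸ hη' G
    exact NatIso.isIso_of_isIso_app _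
  refine ⟨ExtendablePair.ker_le_zeroOn D hr hkn, inferInstance, inferInstance,
    ExtendablePair.faces D r k, ExtendablePair.facesIso D r k, inferInstance, inferInstance,
    ExtendablePair.isZero_faces_iff hr hkn, ⟨_, adj, hunit, fun G u hu => ?_⟩,
    fun G => ⟨_, ⟨(asIso (adj.unit.app G)).symm⟩⟩, adj.exists_roof, ?_, ?_⟩
  · have := hcolim G u hu
    rw [← universalAdjunction_unit_app η hη G] at this
    exact this
  -- For an exact functor, having kernel and cokernel in its kernel means being inverted by it. As
  -- the unit is invertible, the left adjoint is fully faithful, and the right adjoint is a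
  -- localization at the morphisms it inverts.
  · rw [Abelian.isoModSerre_kernel_eq_inverseImage_isomorphisms]
    have := adj.fullyFaithfulLOfIsIsoUnit.full
    have := adj.fullyFaithfulLOfIsIsoUnit.faithful
    exact adj.isLocalization'
  · rintro rfl
    have := ExtendablePair.reflectsIsomorphisms_faces D hr
    have := adj.isEquivalence_of_reflects
    exact ⟨this, fun T => inferInstance⟩
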